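/- Let $\mathcal R$ be a commutative ring with identity, $n\ge 1$, and let $f\in\mathcal R[x_1,\dots,x_n]$ be given by a black box $\mathcal B_f$ that evaluates $f$. Let $T\ge 1$ and $D\ge 1$ be integers with $T\ge \#f$ (the number of terms of $f$) and $D\ge\deg f$ (the total degree). An algorithm for interpolating univariate polynomials over $\mathcal R$ is given: from a black box for a univariate polynomial, a degree bound and a bound on the number of terms, it returns this polynomial whenever the bounds hold. For $\mathbf s\in\mathbb N^n$ write $f(x^{\mathbf s})=f(x^{s_1},\dots,x^{s_n})$, and let $\mathbf I_k$ be the $k$-th unit vector. Here $\tilde O(g)$ means $O\big(g\cdot(\log_2(3+g))^{c}\big)$ for some constant $c$. **Algorithm MulPolySI** (input $\mathcal B_f,T,D$ and a tolerance $\mu\in(0,1)$). Put $h=0$, $T_1=T$, $\nu=\mu/(\lceil\log_2T\rceil+1)$. While $T_1>0$: compute $g=\mathrm{HalfPoly}(\mathcal B_f,h,T,T_1,D,\nu)$; if it fails, return failure; otherwise put $h:=h+g$, $T_1:=\lfloor T_1/2\rfloor$. Return $h$. **HalfPoly**$(\mathcal B_f,f^*,T,T_1,D,\nu)$. 1. Let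 $l=\lceil 32\ln(T_1\nu^{-1})\rceil$ and $N=\max\{31\lfloor(T_1-1)\log_2D\rfloor,1\}$. Find the first $N$ primes $p_1,\dots,p_N$ that are at least $32(T_1-1)$. 2. Choose independently $l$ pairs $(p,\mathbf s)$: $p$ uniformly from $\{p_1,\dots,p_N\}$, then $\mathbf s$ uniformly from $\{0,\dots,p-1\}^n$. Delete repeated pairs. 3. For each pair compute $f(x^{\mathbf s})$ by the univariate interpolation algorithm with degree bound $\|\mathbf s\|_\infty D$ and term bound $T$, and then $F=f(x^{\mathbf s})-f^*(x^{\mathbf s})$ and $F^{\mathrm{mod}}=F\bmod(x^p-1)$. 4. Keep a pair $(p,\mathbf s)$ for which $\#F^{\mathrm{mod}}$ is maximal. If $\#F^{\mathrm{mod}}>T_1$, return failure. 5. For $k=1,\dots,n$ compute $f(x^{\mathbf s+p\mathbf I_k})$ by the univariate interpolation algorithm with degree bound $\|\mathbf s+p\mathbf I_k\|_\infty D$ and term bound $T$, and $G_k=f(x^{\mathbf s+p\mathbf I_k})-f^*(x^{\mathbf s+p\mathbf I_k})$. 6. Return the sum of all $a\,x_1^{e_1}\cdots x_n^{e_n}$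 such that, for some term $a x^d$ of $F^{\mathrm{mod}}$: exactly one exponent $u$ occurring in $F$ and, for each $k$, exactly one exponent $b_k$ occurring in $G_k$ is congruent to $d$ modulo $p$; $e_k=(b_k-u)/p\in\mathbb N$ for all $k$; $u=\sum_k e_ks_k$; and $\sum_k e_k\le D$. **Statement.** With $\mu=1/4$, MulPolySI returns $f$ with probability at least $3/4$. Moreover, for every outcome of its random choices, it needs * $O\big(n\log(T+1)+\log^2(T+1)\big)$ interpolations of univariate polynomials of degree (and with prescribed degree bound) $\tilde O(TD)$ and with at most $T$ terms; * in addition, $\tilde O(nT)$ operations in $\mathcal R$ and $\tilde O(nT\log(D+1))$ bit operations. All implied constants are absolute. (For $T,D\ge 2$ one may replace $\log(T+1)$, $\log(D+1)$ by $\log T$, $\log D$.) In the bit count, sums and comparisons of $k$-bit integers cost $O(k)$, products and quotients cost $O(k\log^2k)$, accesses to an array cost the bit size of the address, evaluating the two formulas for $l$ and $N$ costs quasi-linearly in their values, and drawing a uniform element of $\{0,\dots,m-1\}$ costs the bit size of $m$; addition, negation and zero test in $\mathcal R$ are one ring operation each. -/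

import Mathlib

open Polynomial

universe u v

noncomputable section

namespace SparseInterp

/-! ## Cost model

A computation carries its cost: the list of univariate interpolations it has requested, the number
of operations in the coefficient ring, and the number of bit operations.  The algorithm below is
written only with the charged primitives of this section. -/

/-- A requested interpolation of `f(x^{v_1}, …, x^{v_n})`, with the degree bound and the bound on
the number of terms that are handed to the univariate interpolation algorithm. -/
structure Query (n : ℕ) where
  exps : Fin n → ℕ
  degBound : ℕ
  termBound : ℕ

structure Cost (n : ℕ) where
  queries : List (Query n)
  ringOps : ℕ
  bitOps : ℕ

instance (n : ℕ) : Zero (Cost n) := ⟨⟨[], 0, 0⟩⟩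

instance (n : ℕ) : Add (Cost n) :=
  ⟨fun a b => ⟨a.queries ++ b.queries, a.ringOps + b.ringOps, a.bitOps + b.bitOps⟩⟩

/-- A value together with the cost of computing it (in a run with `n` variables). -/
structure Timed (n : ℕ) (α : Type u) where
  val : α
  cost : Cost n

namespace Timed

def pure {n : ℕ} {α : Type u} (a : α) : Timed n α := ⟨a, 0⟩

/-- Sequential composition: the costs add up. -/
def bind {n : ℕ} {α : Type u} {β : Type v} (x : Timed n α) (f : α → Timed n β) : Timed n β :=
  ⟨(f x.val).val, x.cost + (f x.val).cost⟩

/-- `b` bit operations. -/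
def bits {n : ℕ} {α : Type u} (b : ℕ) (a : α) : Timed n α := ⟨a, ⟨[], 0, b⟩⟩

/-- One operation in the coefficient ring. -/
def ringOp {n : ℕ} {α : Type u} (a : α) : Timed n α := ⟨a, ⟨[], 1, 0⟩⟩

/-- A loop over a list, collecting the results; one more bit operation per round. -/
def traverse {n : ℕ} {α : Type u} {β : Type v} (f : α → Timed n β) : List α → Timed n (List β)
  | [] => bits 1 []
  | a :: L => (f a).bind fun b => (traverse f L).bind fun M => bits 1 (b :: M)

/-- A loop over a list with a state; one more bit operation per round. -/
def foldl {n : ℕ} {α : Type u} {σ : Type v} (f : σ → α → Timed n σ) : σ → List α → Timed n σ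
  | s, [] => bits 1 s
  | s, a :: L => (f s a).bind fun s' => (bits 1 s').bind fun s'' => foldl f s'' L

/-- The members of a list that pass a test. -/
def filter {n : ℕ} {α : Type u} (p : α → Timed n Bool) : List α → Timed n (List α)
  | [] => bits 1 []
  | a :: L => (p a).bind fun b => (filter p L).bind fun M => bits 1 (if b then a :: M else M)

/-- A loop `for k = 1, …, n` that fills a vector. -/
def tabulate {n : ℕ} {β : Type v} (g : Fin n → Timed n β) : Timed n (Fin n → β) :=
  ⟨fun k => (g k).val, (List.ofFn fun k => (g k).cost).sum + ⟨[], 0, n + 1⟩⟩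

end Timed

/-! ### Integers: linear cost for addition, subtraction and comparison, and cost `k (log k)²` for
multiplication and division of `k`-bit numbers (fast integer arithmetic). -/

def mulBits (a b : ℕ) : ℕ :=
  (max a.size b.size + 1) * (max a.size b.size + 1).size ^ 2

def natAdd {n : ℕ} (a b : ℕ) : Timed n ℕ := Timed.bits (a.size + b.size + 1) (a + b)
def natSub {n : ℕ} (a b : ℕ) : Timed n ℕ := Timed.bits (a.size + b.size + 1) (a - b)
def natMax {n : ℕ} (a b : ℕ) : Timed n ℕ := Timed.bits (a.size + b.size + 1) (max a b)
def natLe {n : ℕ} (a b : ℕ) : Timed n Bool := Timed.bits (a.size + b.size + 1) (decide (a ≤ b))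
def natEq {n : ℕ} (a b : ℕ) : Timed n Bool := Timed.bits (a.size + b.size + 1) (decide (a = b))
def natMul {n : ℕ} (a b : ℕ) : Timed n ℕ := Timed.bits (mulBits a b) (a * b)
def natDiv {n : ℕ} (a b : ℕ) : Timed n ℕ := Timed.bits (mulBits a b) (a / b)
def natMod {n : ℕ} (a b : ℕ) : Timed n ℕ := Timed.bits (mulBits a b) (a % b)
def natSize {n : ℕ} (a : ℕ) : Timed n ℕ := Timed.bits (a.size + 1) a.size

/-- Length of a list, by counting. -/
def listLength {n : ℕ} {α : Type u} (L : List α) : Timed n ℕ := Timed.bits (L.length + 1) L.length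

/-! ### Ring elements: addition, negation and zero test cost one ring operation each. -/

def ringAdd {n : ℕ} {R : Type u} [CommRing R] (a b : R) : Timed n R := Timed.ringOp (a + b)
def ringNeg {n : ℕ} {R : Type u} [CommRing R] (a : R) : Timed n R := Timed.ringOp (-a)

open Classical in
def ringNeZero {n : ℕ} {R : Type u} [CommRing R] (a : R) : Timed n Bool :=
  Timed.ringOp (decide (a ≠ 0))

/-! ### Arrays: allocation costs the length, an access costs the size of the address. -/

def newArray {n : ℕ} {α : Type u} (len : ℕ) (a : α) : Timed n (ℕ → α) :=
  Timed.bits (len + 1) (fun _ => a)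

def readCell {n : ℕ} {α : Type u} (A : ℕ → α) (i : ℕ) : Timed n α := Timed.bits (i.size + 1) (A i)

def writeCell {n : ℕ} {α : Type u} (A : ℕ → α) (i : ℕ) (a : α) : Timed n (ℕ → α) :=
  Timed.bits (i.size + 1) (Function.update A i a)

/-! ### Randomness -/

/-- A randomized computation: a distribution on the pairs of a result and its cost. -/
abbrev RComp (n : ℕ) (α : Type u) : Type u := PMF (Timed n α)

namespace RComp

def lift {n : ℕ} {α : Type u} (x : Timed n α) : RComp n α := PMF.pure x

def bind {n : ℕ} {α : Type u} {β : Type v} (x : RComp n α) (f : α → RComp n β) : RComp n β :=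
  PMF.bind x fun t => PMF.map (fun s : Timed n β => ⟨s.val, t.cost + s.cost⟩) (f t.val)

/-- `l` independent repetitions. -/
def repeated {n : ℕ} {α : Type u} (x : RComp n α) : ℕ → RComp n (List α)
  | 0 => lift (Timed.pure [])
  | l + 1 => bind x fun a => bind (repeated x l) fun L => lift (Timed.bits 1 (a :: L))

end RComp

/-- A uniformly random element of `{0, …, m-1}` (of `{0}` if `m = 0`). -/
def drawBelow {n : ℕ} (m : ℕ) : RComp n ℕ :=
  match m with
  | 0 => RComp.lift (Timed.pure 0)
  | q + 1 => (PMF.uniformOfFintype (Fin (q + 1))).map fun i => Timed.bits ((q + 1).size) (i : ℕ)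

/-- A uniformly random vector in `{0, …, p-1}^n` (the zero vector if `p = 0`). -/
def drawVector {n : ℕ} (p : ℕ) : RComp n (Fin n → ℕ) :=
  match p with
  | 0 => RComp.lift (Timed.pure fun _ => 0)
  | q + 1 => (PMF.uniformOfFintype (Fin n → Fin (q + 1))).map fun s =>
      Timed.bits (n * (q + 1).size) (fun k => (s k : ℕ))

/-! ## Sorted sparse polynomials -/

/-- Exponents by which a list of terms can be sorted; a comparison costs the total bit size. -/
class Key (κ : Type) where
  le : κ → κ → Bool
  size : κ → ℕ

instance : Key ℕ := ⟨fun a b => decide (a ≤ b), Nat.size⟩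

/-- Exponent vectors, ordered lexicographically. -/
instance (n : ℕ) : Key (Fin n → ℕ) :=
  ⟨fun a b => decide (List.ofFn a ≤ List.ofFn b), fun a => ∑ k, ((a k).size + 1)⟩

def keyLe {n : ℕ} {κ : Type} [Key κ] (a b : κ) : Timed n Bool :=
  Timed.bits (Key.size a + Key.size b + 1) (Key.le a b)

def keyEq {n : ℕ} {κ : Type} [Key κ] [DecidableEq κ] (a b : κ) : Timed n Bool :=
  Timed.bits (Key.size a + Key.size b + 1) (decide (a = b))

def mergeLists {n : ℕ} {κ : Type} [Key κ] {β : Type u} :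
    List (κ × β) → List (κ × β) → Timed n (List (κ × β))
  | [], M => Timed.bits 1 M
  | L, [] => Timed.bits 1 L
  | x :: L, y :: M => (keyLe x.1 y.1).bind fun b =>
      if b then (mergeLists L (y :: M)).bind fun K => Timed.bits 1 (x :: K)
      else (mergeLists (x :: L) M).bind fun K => Timed.bits 1 (y :: K)
  termination_by L M => L.length + M.length

/-- Merge sort with recursion depth `d`; it sorts lists of length at most `2 ^ d`. -/
def mergeSort {n : ℕ} {κ : Type} [Key κ] {β : Type u} :
    ℕ → List (κ × β) → Timed n (List (κ × β))
  | 0, L => Timed.bits 1 L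
  | d + 1, L => (listLength L).bind fun m =>
      (Timed.bits (L.length + 1) (L.take (m / 2), L.drop (m / 2))).bind fun P =>
      (mergeSort d P.1).bind fun A => (mergeSort d P.2).bind fun B => mergeLists A B

/-- Collect the adjacent entries that have the same key. -/
def groupAdjacent {n : ℕ} {κ : Type} [Key κ] [DecidableEq κ] {β : Type u} :
    List (κ × β) → Timed n (List (κ × List β))
  | [] => Timed.bits 1 []
  | x :: L => (groupAdjacent L).bind fun M =>
      match M with
      | [] => Timed.bits 1 [(x.1, [x.2])]
      | g :: M' => (keyEq x.1 g.1).bind fun b =>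
          Timed.bits 1 (if b then (g.1, x.2 :: g.2) :: M' else (x.1, [x.2]) :: g :: M')

/-- Turn a list of terms, given as pairs of an exponent and a coefficient, into the sorted sparse
representation of their sum: distinct exponents, nonzero coefficients. -/
def normalize {n : ℕ} {κ : Type} [Key κ] [DecidableEq κ] {R : Type u} [CommRing R]
    (L : List (κ × R)) : Timed n (List (κ × R)) :=
  (listLength L).bind fun m => (natSize m).bind fun d => (mergeSort d L).bind fun S =>
  (groupAdjacent S).bind fun G =>
  (Timed.traverse (fun g : κ × List R =>
    (Timed.foldl ringAdd 0 g.2).bind fun c => Timed.pure (g.1, c)) G).bind fun P =>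
  Timed.filter (fun t : κ × R => ringNeZero t.2) P

def addTerms {n : ℕ} {κ : Type} [Key κ] [DecidableEq κ] {R : Type u} [CommRing R]
    (F G : List (κ × R)) : Timed n (List (κ × R)) :=
  (Timed.bits (F.length + 1) (F ++ G)).bind normalize

def subTerms {n : ℕ} {κ : Type} [Key κ] [DecidableEq κ] {R : Type u} [CommRing R]
    (F G : List (κ × R)) : Timed n (List (κ × R)) :=
  (Timed.traverse (fun t : κ × R => (ringNeg t.2).bind fun c => Timed.pure (t.1, c)) G).bind
    fun G' => addTerms F G'

/-- The terms of a univariate polynomial, by increasing exponent. -/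
def termList {R : Type u} [CommRing R] (g : R[X]) : List (ℕ × R) :=
  (g.support.sort (· ≤ ·)).map fun d => (d, g.coeff d)

/-- `L` is the sparse representation of `f` as a list of terms: distinct monomials, nonzero
coefficients, sum `f`. -/
def IsSparseRep {n : ℕ} {R : Type u} [CommRing R] (L : List ((Fin n → ℕ) × R))
    (f : MvPolynomial (Fin n) R) : Prop :=
  (L.map Prod.fst).Nodup ∧ (∀ t ∈ L, t.2 ≠ 0) ∧
    (L.map fun t => MvPolynomial.monomial (Finsupp.equivFunOnFinite.symm t.1) t.2).sum = f

/-- `f(x^{v_1}, …, x^{v_n})`. -/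
def kronecker {n : ℕ} {R : Type u} [CommRing R] (f : MvPolynomial (Fin n) R) (v : Fin n → ℕ) :
    R[X] :=
  MvPolynomial.aeval (fun k => (X : R[X]) ^ v k) f

/-! ## Black boxes and univariate interpolation -/

/-- A univariate interpolation algorithm over `R`: it receives a black box that evaluates a
univariate polynomial at points of the `R`-algebra `E`, a degree bound and a bound on the number of
terms, and returns a polynomial. -/
abbrev UnivInterpolator (R : Type u) (E : Type v) [CommRing R] : Type (max u v) :=
  (E → E) → ℕ → ℕ → R[X]

/-- `U` is correct on all inputs with degree bound at most `Δ` and term bound at most `T`. -/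
def UnivInterpolator.CorrectUpTo {R : Type u} {E : Type v} [CommRing R] [CommRing E] [Algebra R E]
    (U : UnivInterpolator R E) (Δ : ℝ) (T : ℕ) : Prop :=
  ∀ (g : R[X]) (d τ : ℕ), (d : ℝ) ≤ Δ → τ ≤ T → g.natDegree ≤ d → g.support.card ≤ τ →
    U (fun a => aeval a g) d τ = g

/-- One univariate interpolation: the algorithm `U` is run on `a ↦ B(a^{v_1}, …, a^{v_n})`. -/
def interpolate {n : ℕ} {R : Type u} {E : Type v} [CommRing R] [CommRing E]
    (B : (Fin n → E) → E) (U : UnivInterpolator R E) (v : Fin n → ℕ) (d τ : ℕ) :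
    Timed n (List (ℕ × R)) :=
  ⟨termList (U (fun a => B fun k => a ^ v k) d τ), ⟨[⟨v, d, τ⟩], 0, 0⟩⟩

/-! ## The first `N` primes that are at least `lo` -/

/-- Mark `2i, 3i, …` up to `bound`. -/
def markMultiples {n : ℕ} (bound i : ℕ) (A : ℕ → Bool) : Timed n (ℕ → Bool) :=
  (natDiv bound i).bind fun q =>
  Timed.foldl (fun A j => (natMul i j).bind fun m => writeCell A m true) A (List.range' 2 (q - 1))

/-- Sieve of Eratosthenes: the unmarked numbers in `[2, bound]` are the primes. -/
def sieve {n : ℕ} (bound : ℕ) : Timed n (ℕ → Bool) :=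
  (newArray (bound + 1) false).bind fun A =>
  Timed.foldl (fun A i => (readCell A i).bind fun b =>
    if b then Timed.pure A else markMultiples bound i A) A (List.range' 2 (bound - 1))

/-- The sieve runs up to `16 K size(K)`, `K = lo + N`, which is beyond the `K`-th prime. -/
def firstPrimes {n : ℕ} (lo N : ℕ) : Timed n (List ℕ) :=
  (natAdd lo N).bind fun K => (natSize K).bind fun z => (natMul K z).bind fun y =>
  (natMul 16 y).bind fun bound => (sieve bound).bind fun A =>
  (Timed.filter (fun i => (natLe lo i).bind fun b => (readCell A i).bind fun c =>
    Timed.pure (b && !c)) (List.range' 2 (bound - 1))).bind fun P =>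
  Timed.bits (N + 1) (P.take N)

/-! ## Substitutions into a sparse polynomial -/

/-- `e_1 s_1 + ⋯ + e_n s_n`. -/
def dot {n : ℕ} (e s : Fin n → ℕ) : Timed n ℕ :=
  Timed.foldl (fun d k => (natMul (e k) (s k)).bind fun m => natAdd d m) 0 (List.finRange n)

def sumVector {n : ℕ} (e : Fin n → ℕ) : Timed n ℕ :=
  Timed.foldl (fun d k => natAdd d (e k)) 0 (List.finRange n)

def maxVector {n : ℕ} (e : Fin n → ℕ) : Timed n ℕ :=
  Timed.foldl (fun d k => natMax d (e k)) 0 (List.finRange n)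

/-- `g(x^s)`. -/
def substitute {n : ℕ} {R : Type u} [CommRing R] (g : List ((Fin n → ℕ) × R)) (s : Fin n → ℕ) :
    Timed n (List (ℕ × R)) :=
  (Timed.traverse (fun t : (Fin n → ℕ) × R =>
    (dot t.1 s).bind fun d => Timed.pure (d, t.2)) g).bind normalize

/-- `F mod (x^p - 1)`. -/
def reduceMod {n : ℕ} {R : Type u} [CommRing R] (p : ℕ) (F : List (ℕ × R)) :
    Timed n (List (ℕ × R)) :=
  (Timed.traverse (fun t : ℕ × R => (natMod t.1 p).bind fun d => Timed.pure (d, t.2)) F).bind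
    normalize

/-- The polynomials `g(x^{s + p I_k})` for `k = 1, …, n`. -/
def polySubs {n : ℕ} {R : Type u} [CommRing R] (g : List ((Fin n → ℕ) × R)) (s : Fin n → ℕ)
    (p : ℕ) : Timed n (Fin n → List (ℕ × R)) :=
  (Timed.traverse (fun t : (Fin n → ℕ) × R =>
    (dot t.1 s).bind fun d => Timed.pure (d, t.1, t.2)) g).bind fun L =>
  Timed.tabulate fun k =>
    (Timed.traverse (fun t : ℕ × (Fin n → ℕ) × R =>
      (natMul (t.2.1 k) p).bind fun m => (natAdd t.1 m).bind fun d =>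
      Timed.pure (d, t.2.2)) L).bind normalize

/-! ## Recovery of terms -/

/-- What is known of the terms of a univariate polynomial whose exponents lie in a fixed residue
class: there is none, there is exactly one (with the given exponent), or there are several. -/
inductive Cell where
  | none
  | one (d : ℕ)
  | many

/-- The array, indexed by the residues modulo `p`, of the cells of `F`. -/
def residueTable {n : ℕ} {R : Type u} (p : ℕ) (F : List (ℕ × R)) : Timed n (ℕ → Cell) :=
  (newArray p Cell.none).bind fun A =>
  Timed.foldl (fun A t => (natMod t.1 p).bind fun r => (readCell A r).bind fun c =>
    match c with
    | Cell.none => (Timed.bits t.1.size (Cell.one t.1)).bind fun c' => writeCell A r c'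
    | _ => writeCell A r Cell.many) A F

/-- `(b - u) / p`, if this is a natural number. -/
def exactQuotient {n : ℕ} (u b p : ℕ) : Timed n (Option ℕ) :=
  (natLe u b).bind fun le => (natSub b u).bind fun m => (natMod m p).bind fun r =>
  (natEq r 0).bind fun z => (natDiv m p).bind fun e =>
  Timed.pure (if le && z then some e else none)

/-- Try to recover a term of `f` from the term `a x^d` of `f(x^s) mod (x^p - 1)` and the
tables of `f(x^s)` and of the `f(x^{s + p I_k})`. -/
def recoverTerm {n : ℕ} {R : Type u} (A : ℕ → Cell) (As : Fin n → ℕ → Cell) (p : ℕ)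
    (s : Fin n → ℕ) (D d : ℕ) (a : R) : Timed n (Option ((Fin n → ℕ) × R)) :=
  (readCell A d).bind fun c =>
  match c with
  | Cell.one u =>
    (Timed.tabulate fun k => (readCell (As k) d).bind fun c' =>
      match c' with
      | Cell.one b => exactQuotient u b p
      | _ => Timed.pure none).bind fun q =>
    if ∀ k, (q k).isSome then
      (Timed.bits (n + 1) fun k => (q k).getD 0).bind fun e =>
      (dot e s).bind fun u' => (natEq u u').bind fun okSum =>
      (sumVector e).bind fun deg => (natLe deg D).bind fun okDeg =>
      Timed.pure (if okSum && okDeg then some (e, a) else none)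
    else Timed.bits (n + 1) none
  | _ => Timed.pure none

/-- Algorithm TSTerms: `Fmod = f(x^s) mod (x^p - 1)`, `F = f(x^s)`, `G k = f(x^{s + p I_k})`. -/
def tsTerms {n : ℕ} {R : Type u} (Fmod F : List (ℕ × R)) (G : Fin n → List (ℕ × R)) (p : ℕ)
    (s : Fin n → ℕ) (D : ℕ) : Timed n (List ((Fin n → ℕ) × R)) :=
  (residueTable p F).bind fun A => (Timed.tabulate fun k => residueTable p (G k)).bind fun As =>
  (Timed.traverse (fun t : ℕ × R => recoverTerm A As p s D t.1 t.2) Fmod).bind fun L =>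
  Timed.bits (L.length + 1) L.reduceOption

/-! ## Algorithm HalfPoly -/

/-- `l = ⌈32 ln(T₁ ν⁻¹)⌉`. -/
def sampleCount (T₁ : ℕ) (ν : ℝ) : ℕ := ⌈32 * Real.log ((T₁ : ℝ) * ν⁻¹)⌉₊

/-- `N = max{31 ⌊(T₁ - 1) log₂ D⌋, 1}`. -/
def primeCount (T₁ D : ℕ) : ℕ := max (31 * ⌊((T₁ : ℝ) - 1) * Real.logb 2 D⌋₊) 1

/-- Evaluation of one of the two logarithmic formulas above, whose arguments have total bit size
`z`.  The charge is quasi-linear in the resulting value `m`, as for forming `D ^ (T₁ - 1)` by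
repeated squaring and reading off its bit length. -/
def evalFormula {n : ℕ} (z m : ℕ) : Timed n ℕ := Timed.bits (z + (m + 1) * (m + 1).size ^ 2) m

/-- A random prime of the list and then a random vector modulo this prime. -/
def drawPair {n : ℕ} (primes : List ℕ) (N : ℕ) : RComp n (ℕ × (Fin n → ℕ)) :=
  RComp.bind (drawBelow N) fun i =>
  RComp.bind (RComp.lift (readCell (fun j => primes.getD j 2) i)) fun p =>
  RComp.bind (drawVector p) fun s => RComp.lift (Timed.pure (p, s))

/-- Delete the repeated pairs. -/
def removeRepeated {n : ℕ} :
    List (ℕ × (Fin n → ℕ)) → Timed n (List (ℕ × (Fin n → ℕ)))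
  | [] => Timed.bits 1 []
  | x :: L => (removeRepeated L).bind fun M =>
      (Timed.foldl (fun found y => (keyEq x.1 y.1).bind fun b => (keyEq x.2 y.2).bind fun c =>
        Timed.pure (found || (b && c))) false M).bind fun found =>
      Timed.bits 1 (if found then M else x :: M)

/-- The data computed for one pair `(p, s)`. -/
structure Sample (n : ℕ) (R : Type u) where
  p : ℕ
  s : Fin n → ℕ
  /-- `‖s‖_∞` -/
  sup : ℕ
  /-- `(f - f*)(x^s)` -/
  F : List (ℕ × R)
  /-- `(f - f*)(x^s) mod (x^p - 1)` -/
  Fmod : List (ℕ × R)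
  /-- number of terms of `Fmod` -/
  count : ℕ

def takeSample {n : ℕ} {R : Type u} {E : Type v} [CommRing R] [CommRing E]
    (B : (Fin n → E) → E) (U : UnivInterpolator R E) (g : List ((Fin n → ℕ) × R)) (T D : ℕ)
    (ps : ℕ × (Fin n → ℕ)) : Timed n (Sample n R) :=
  (maxVector ps.2).bind fun sup => (natMul sup D).bind fun d =>
  (interpolate B U ps.2 d T).bind fun F => (substitute g ps.2).bind fun G =>
  (subTerms F G).bind fun H => (reduceMod ps.1 H).bind fun Hmod =>
  (listLength Hmod).bind fun m => Timed.pure ⟨ps.1, ps.2, sup, H, Hmod, m⟩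

/-- A sample for which `Fmod` has the largest number of terms. -/
def bestSample {n : ℕ} {R : Type u} (L : List (Sample n R)) : Timed n (Option (Sample n R)) :=
  Timed.foldl (fun best y =>
    match best with
    | none => Timed.pure (some y)
    | some x => (natLe y.count x.count).bind fun b => Timed.pure (some (if b then x else y)))
    none L

/-- Algorithm HalfPoly, with `g` in the role of `f*`; `none` stands for failure. -/
def halfPoly {n : ℕ} {R : Type u} {E : Type v} [CommRing R] [CommRing E]
    (B : (Fin n → E) → E) (U : UnivInterpolator R E) (g : List ((Fin n → ℕ) × R))
    (T T₁ D : ℕ) (ν : ℝ) : RComp n (Option (List ((Fin n → ℕ) × R))) :=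
  RComp.bind (RComp.lift (
    (evalFormula (T.size + T₁.size) (sampleCount T₁ ν)).bind fun l =>
    (evalFormula (T₁.size + D.size) (primeCount T₁ D)).bind fun N =>
    (natSub T₁ 1).bind fun T₀ => (natMul 32 T₀).bind fun lo =>
    (firstPrimes lo N).bind fun primes => Timed.pure (l, N, primes))) fun par =>
  RComp.bind (RComp.repeated (drawPair par.2.2 par.2.1) par.1) fun pairs =>
  RComp.lift (
    (removeRepeated pairs).bind fun pairs' =>
    (Timed.traverse (takeSample B U g T D) pairs').bind fun samples =>
    (bestSample samples).bind fun best =>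
    match best with
    | none => Timed.pure none
    | some x => (natLe x.count T₁).bind fun ok =>
      if ok then
        (polySubs g x.s x.p).bind fun gs =>
        (Timed.tabulate fun k =>
          (natAdd (x.s k) x.p).bind fun sk => (natMax x.sup sk).bind fun sup =>
          (natMul sup D).bind fun d =>
          (interpolate B U (Function.update x.s k sk) d T).bind fun F =>
          subTerms F (gs k)).bind fun G =>
        (tsTerms x.Fmod x.F G x.p x.s D).bind fun TS => Timed.pure (some TS)
      else Timed.pure none)

/-! ## Algorithm MulPolySI -/

/-- The loop `while T₁ > 0`, with the current approximation `h`. -/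
def mulPolyLoop {n : ℕ} {R : Type u} {E : Type v} [CommRing R] [CommRing E]
    (B : (Fin n → E) → E) (U : UnivInterpolator R E) (T D : ℕ) (ν : ℝ) (T₁ : ℕ)
    (h : List ((Fin n → ℕ) × R)) : RComp n (Option (List ((Fin n → ℕ) × R))) :=
  if T₁ = 0 then RComp.lift (Timed.bits 1 (some h))
  else
    RComp.bind (halfPoly B U h T T₁ D ν) fun r =>
    match r with
    | none => RComp.lift (Timed.pure none)
    | some g =>
      RComp.bind (RComp.lift (addTerms h g)) fun h' =>
      RComp.bind (RComp.lift (Timed.bits (T₁.size + 1) ())) fun _ =>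
      mulPolyLoop B U T D ν (T₁ / 2) h'
  termination_by T₁
  decreasing_by omega

/-- Algorithm MulPolySI: `B` is the black box, `U` the given univariate interpolation algorithm,
`T` and `D` bound the number of terms and the degree, `μ` is the tolerance. -/
def mulPolySI {n : ℕ} {R : Type u} {E : Type v} [CommRing R] [CommRing E]
    (B : (Fin n → E) → E) (U : UnivInterpolator R E) (T D : ℕ) (μ : ℝ) :
    RComp n (Option (List ((Fin n → ℕ) × R))) :=
  RComp.bind (RComp.lift (Timed.bits (T.size + 1) ())) fun _ =>
  mulPolyLoop B U T D (μ / (⌈Real.logb 2 T⌉₊ + 1)) T []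

/-- `C g (log₂(3 + g))^k`; a quantity is `Õ(g)` if it is at most this for some constants
`C` and `k`. -/
def softO (C : ℝ) (k : ℕ) (g : ℝ) : ℝ := C * (g * Real.logb 2 (3 + g) ^ k)

end SparseInterp

end

open SparseInterp

/-! Fix a round and let φ = f - f*, with at most T₁ terms of total degree at most D. For a pair (p,
s), call a term of φ colliding if another term has the same residue of e·s modulo p, and let c be
the number of colliding terms. A term that does not collide survives in F, in Fmod and in every G_k,
is alone in its residue class there, and satisfies b_k - u = p e_k, so it is recovered exactly. The
test u = e·s forces every recovered term back into the class it was read from. Hence each class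
yields at most one term, and a class that yields a wrong one contains at least two colliding terms.
The new error therefore has at most c + c/2 terms (`two_mul_card_support_sub_tsTerms_le`).

The number c cannot be observed, but #Fmod can, and #φ - c ≤ #Fmod ≤ #φ - c/2
(`card_support_le_add_colliding`, `two_mul_card_support_add_colliding_le`). If some drawn pair has c
≤ T₁/6, then a pair with maximal #Fmod has c ≤ T₁/3, and its error has at most T₁/2 terms
(`finish_val`).

Such a pair is likely. If e and e' differ modulo p in some coordinate, then e·s = e'·s is a
nontrivial linear equation over the field with p elements, satisfied with probability at most 1/p
(`card_residue_eq_mul_le`). A prime that fails to separate e from some e' divides a nonzero number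
of absolute value at most D, so there are at most (T₁ - 1) log₂ D of them for each e
(`card_badPrime_le`). With the prescribed primes every term collides with probability at most 1/31 +
1/32, and Markov's inequality shows that c > T₁/6 has probability at most 2/5
(`sum_card_colliding_le`, `prob_drawPair_le`). Independent draws push this below ν
(`prob_halfPoly_le`), and a union bound over the rounds, whose number is at most ⌈log₂ T⌉ + 1,
leaves failure probability at most 1/4 (`prob_mulPolyLoop_le`).

The cost bounds hold for every outcome, including rounds that went wrong, because they rest on facts
that do not involve luck. The interpolated polynomials are images of f and not of f - f*, so they
always have at most T terms and the expected degree. A round either fails or returns at most T₁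
terms of degree at most D, and T₁ is then halved, so the approximation never exceeds 2T terms
(`mem_support_mulPolyLoop`). The primes lie below the limit of the sieve, which a Chebyshev bound
allows to be Õ(T log D) (`le_primeCounting`, `primeBound_le`). The rest is bookkeeping: logarithmic
factors are absorbed into powers of one number Z, except for the bit length of D, which must enter
linearly (`stepCost_le`, `roundBits_le`). -/

namespace SparseInterp

/-! ## Values and costs of the basic combinators -/

namespace Cost

variable {n : ℕ}

@[simp] theorem zero_queries : (0 : Cost n).queries = [] := rfl
@[simp] theorem zero_ringOps : (0 : Cost n).ringOps = 0 := rfl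
@[simp] theorem zero_bitOps : (0 : Cost n).bitOps = 0 := rfl
@[simp] theorem add_queries (a b : Cost n) : (a + b).queries = a.queries ++ b.queries := rfl
@[simp] theorem add_ringOps (a b : Cost n) : (a + b).ringOps = a.ringOps + b.ringOps := rfl
@[simp] theorem add_bitOps (a b : Cost n) : (a + b).bitOps = a.bitOps + b.bitOps := rfl

theorem sum_queries (L : List (Cost n)) : L.sum.queries = (L.map queries).flatten := by
  induction L with
  | nil => rfl
  | cons a L ih => simp [ih]

theorem sum_ringOps (L : List (Cost n)) : L.sum.ringOps = (L.map ringOps).sum := by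
  induction L with
  | nil => rfl
  | cons a L ih => simp [ih]

theorem sum_bitOps (L : List (Cost n)) : L.sum.bitOps = (L.map bitOps).sum := by
  induction L with
  | nil => rfl
  | cons a L ih => simp [ih]

end Cost

namespace Timed

variable {n : ℕ} {α : Type u} {β : Type v}

@[simp] theorem pure_val (a : α) : (pure a : Timed n α).val = a := rfl
@[simp] theorem pure_cost (a : α) : (pure a : Timed n α).cost = 0 := rfl
@[simp] theorem bind_val (x : Timed n α) (f : α → Timed n β) :
    (x.bind f).val = (f x.val).val := rfl
@[simp] theorem bind_cost (x : Timed n α) (f : α → Timed n β) :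
    (x.bind f).cost = x.cost + (f x.val).cost := rfl
@[simp] theorem bits_val (b : ℕ) (a : α) : (bits b a : Timed n α).val = a := rfl
@[simp] theorem bits_bitOps (b : ℕ) (a : α) : (bits b a : Timed n α).cost.bitOps = b := rfl
@[simp] theorem bits_ringOps (b : ℕ) (a : α) : (bits b a : Timed n α).cost.ringOps = 0 := rfl
@[simp] theorem bits_queries (b : ℕ) (a : α) : (bits b a : Timed n α).cost.queries = [] := rfl
@[simp] theorem ringOp_val (a : α) : (ringOp a : Timed n α).val = a := rfl
@[simp] theorem ringOp_bitOps (a : α) : (ringOp a : Timed n α).cost.bitOps = 0 := rfl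
@[simp] theorem ringOp_ringOps (a : α) : (ringOp a : Timed n α).cost.ringOps = 1 := rfl
@[simp] theorem ringOp_queries (a : α) : (ringOp a : Timed n α).cost.queries = [] := rfl

@[simp] theorem traverse_val (f : α → Timed n β) (L : List α) :
    (traverse f L).val = L.map fun a => (f a).val := by
  induction L with
  | nil => rfl
  | cons a L ih => simp [traverse, ih]

theorem traverse_bitOps (f : α → Timed n β) (L : List α) :
    (traverse f L).cost.bitOps = (L.map fun a => (f a).cost.bitOps).sum + L.length + 1 := by
  induction L with
  | nil => rfl
  | cons a L ih => simp [traverse, ih]; omega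

@[simp] theorem traverse_ringOps (f : α → Timed n β) (L : List α) :
    (traverse f L).cost.ringOps = (L.map fun a => (f a).cost.ringOps).sum := by
  induction L with
  | nil => rfl
  | cons a L ih => simp [traverse, ih]

@[simp] theorem traverse_queries (f : α → Timed n β) (L : List α) :
    (traverse f L).cost.queries = L.flatMap fun a => (f a).cost.queries := by
  induction L with
  | nil => rfl
  | cons a L ih => simp [traverse, ih]

theorem traverse_bitOps_le {f : α → Timed n β} {L : List α} {c : ℕ}
    (h : ∀ a ∈ L, (f a).cost.bitOps ≤ c) :
    (traverse f L).cost.bitOps ≤ L.length * (c + 1) + 1 := by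
  rw [traverse_bitOps]
  have := List.sum_le_card_nsmul (L.map fun a => (f a).cost.bitOps) c (by simpa using h)
  simp at this
  nlinarith

theorem traverse_ringOps_le {f : α → Timed n β} {L : List α} {c : ℕ}
    (h : ∀ a ∈ L, (f a).cost.ringOps ≤ c) :
    (traverse f L).cost.ringOps ≤ L.length * c := by
  rw [traverse_ringOps]
  simpa using List.sum_le_card_nsmul (L.map fun a => (f a).cost.ringOps) c (by simpa using h)

theorem foldl_val (f : β → α → Timed n β) (s : β) (L : List α) :
    (foldl f s L).val = L.foldl (fun s a => (f s a).val) s := by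
  induction L generalizing s with
  | nil => rfl
  | cons a L ih => simp [foldl, ih]

/-- Cost of a loop whose state satisfies an invariant that may depend on the remaining list. -/
theorem foldl_bitOps_le {f : β → α → Timed n β} {c : ℕ} (I : List α → β → Prop)
    (h : ∀ a L s, I (a :: L) s → (f s a).cost.bitOps ≤ c ∧ I L (f s a).val)
    (L : List α) (s : β) (hs : I L s) :
    (foldl f s L).cost.bitOps ≤ L.length * (c + 1) + 1 := by
  induction L generalizing s with
  | nil => simp [foldl]
  | cons a L ih =>
    obtain ⟨h1, h2⟩ := h a L s hs
    have := ih _ h2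
    simp [foldl]
    nlinarith

theorem foldl_bitOps_le' {f : β → α → Timed n β} {c : ℕ} {L : List α}
    (h : ∀ a ∈ L, ∀ s, (f s a).cost.bitOps ≤ c) (s : β) :
    (foldl f s L).cost.bitOps ≤ L.length * (c + 1) + 1 := by
  refine foldl_bitOps_le (fun M _ => ∀ a ∈ M, ∀ s, (f s a).cost.bitOps ≤ c) ?_ L s h
  intro a M s hM
  exact ⟨hM a (by simp) s, fun b hb => hM b (by simp [hb])⟩

theorem foldl_ringOps_eq {f : β → α → Timed n β} {c : ℕ}
    (h : ∀ a s, (f s a).cost.ringOps = c) (L : List α) (s : β) :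
    (foldl f s L).cost.ringOps = L.length * c := by
  induction L generalizing s with
  | nil => simp [foldl]
  | cons a L ih => simp [foldl, ih, h]; ring

theorem foldl_queries_eq_nil {f : β → α → Timed n β}
    (h : ∀ a s, (f s a).cost.queries = []) (L : List α) (s : β) :
    (foldl f s L).cost.queries = [] := by
  induction L generalizing s with
  | nil => rfl
  | cons a L ih => simp [foldl, ih, h]

@[simp] theorem filter_val (p : α → Timed n Bool) (L : List α) :
    (filter p L).val = L.filter fun a => (p a).val := by
  induction L with
  | nil => rfl
  | cons a L ih => simp [filter, ih, List.filter_cons]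

theorem filter_bitOps_le {p : α → Timed n Bool} {L : List α} {c : ℕ}
    (h : ∀ a ∈ L, (p a).cost.bitOps ≤ c) :
    (filter p L).cost.bitOps ≤ L.length * (c + 1) + 1 := by
  induction L with
  | nil => simp [filter]
  | cons a L ih =>
    have h1 := h a (by simp)
    have := ih fun b hb => h b (by simp [hb])
    simp [filter]
    nlinarith

theorem filter_ringOps_eq {p : α → Timed n Bool} {c : ℕ}
    (h : ∀ a, (p a).cost.ringOps = c) (L : List α) :
    (filter p L).cost.ringOps = L.length * c := by
  induction L with
  | nil => simp [filter]
  | cons a L ih => simp [filter, ih, h]; ring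

theorem filter_queries_eq_nil {p : α → Timed n Bool}
    (h : ∀ a, (p a).cost.queries = []) (L : List α) :
    (filter p L).cost.queries = [] := by
  induction L with
  | nil => rfl
  | cons a L ih => simp [filter, ih, h]

@[simp] theorem tabulate_val (g : Fin n → Timed n β) :
    (tabulate g).val = fun k => (g k).val := rfl

theorem tabulate_bitOps_le {g : Fin n → Timed n β} {c : ℕ} (h : ∀ k, (g k).cost.bitOps ≤ c) :
    (tabulate g).cost.bitOps ≤ n * (c + 1) + 1 := by
  have := List.sum_le_card_nsmul (List.ofFn fun k => (g k).cost.bitOps) c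
    (by simpa [List.mem_ofFn] using h)
  simp [tabulate, Cost.sum_bitOps, List.map_ofFn, Function.comp_def] at this ⊢
  nlinarith

theorem tabulate_ringOps_le {g : Fin n → Timed n β} {c : ℕ} (h : ∀ k, (g k).cost.ringOps ≤ c) :
    (tabulate g).cost.ringOps ≤ n * c := by
  have := List.sum_le_card_nsmul (List.ofFn fun k => (g k).cost.ringOps) c
    (by simpa [List.mem_ofFn] using h)
  simpa [tabulate, Cost.sum_ringOps, List.map_ofFn, Function.comp_def] using this

theorem tabulate_queries (g : Fin n → Timed n β) :
    (tabulate g).cost.queries = (List.ofFn fun k => (g k).cost.queries).flatten := by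
  simp [tabulate, Cost.sum_queries, List.map_ofFn, Function.comp_def]

theorem tabulate_queries_eq_nil {g : Fin n → Timed n β} (h : ∀ k, (g k).cost.queries = []) :
    (tabulate g).cost.queries = [] := by
  rw [tabulate_queries, List.flatten_eq_nil_iff]
  simpa [List.mem_ofFn] using h

end Timed

attribute [simp] natAdd natSub natMax natLe natEq natMul natDiv natMod natSize listLength ringAdd
  ringNeg newArray readCell writeCell keyLe keyEq evalFormula

section

variable {n : ℕ} {R : Type u} [CommRing R]

open Classical in
@[simp] theorem ringNeZero_val (a : R) : (ringNeZero a : Timed n Bool).val = decide (a ≠ 0) := rfl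
@[simp] theorem ringNeZero_bitOps (a : R) : (ringNeZero a : Timed n Bool).cost.bitOps = 0 := rfl
@[simp] theorem ringNeZero_ringOps (a : R) : (ringNeZero a : Timed n Bool).cost.ringOps = 1 := rfl
@[simp] theorem ringNeZero_queries (a : R) : (ringNeZero a : Timed n Bool).cost.queries = [] := rfl

end

/-! ## Bit sizes -/

/-- Cost of a product of two `b`-bit numbers. -/
def mulCost (b : ℕ) : ℕ := (b + 1) * (b + 1).size ^ 2

theorem mulCost_mono {a b : ℕ} (h : a ≤ b) : mulCost a ≤ mulCost b := by
  have := Nat.size_le_size (Nat.succ_le_succ h)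
  unfold mulCost
  gcongr

theorem mulBits_le {x y b : ℕ} (hx : x.size ≤ b) (hy : y.size ≤ b) : mulBits x y ≤ mulCost b :=
  mulCost_mono (max_le hx hy)

/-- Lets one multiplication charge absorb the linear charges of additions, comparisons and array
accesses, so that a single unit serves for all integer operations. -/
theorem succ_le_mulCost (b : ℕ) : b + 1 ≤ mulCost b := by
  have : 1 ≤ (b + 1).size := Nat.size_pos.2 (by omega)
  unfold mulCost
  nlinarith [Nat.one_le_pow 2 _ this]

theorem size_add_le (a b : ℕ) : (a + b).size ≤ max a.size b.size + 1 := by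
  rw [Nat.size_le, pow_succ]
  have h1 : a < 2 ^ max a.size b.size := Nat.size_le.1 (le_max_left _ _)
  have h2 : b < 2 ^ max a.size b.size := Nat.size_le.1 (le_max_right _ _)
  omega

theorem size_mul_le (a b : ℕ) : (a * b).size ≤ a.size + b.size := by
  rw [Nat.size_le, pow_add]
  exact Nat.mul_lt_mul'' (Nat.lt_size_self a) (Nat.lt_size_self b)

theorem size_le_self (a : ℕ) : a.size ≤ a := Nat.size_le.2 Nat.lt_two_pow_self

/-- The sort in `normalize` has recursion depth equal to the bit length of the list length; this
keeps the constant costs of its recursion tree linear in the list length. -/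
theorem two_pow_size_le (m : ℕ) : 2 ^ m.size ≤ 2 * m + 1 := by
  rcases Nat.eq_zero_or_pos m with rfl | h
  · simp
  · have h1 : 0 < m.size := Nat.size_pos.2 h
    have : 2 ^ (m.size - 1) ≤ m := Nat.lt_size.1 (by omega)
    have h2 : m.size = m.size - 1 + 1 := by omega
    rw [h2, pow_succ]
    omega


/-! ## Sorting and collecting terms -/

section Keys

variable {n : ℕ} {κ : Type} [Key κ] {β : Type u}

/-- The comparison of keys is a total order. -/
class LawfulKey (κ : Type) [Key κ] : Prop where
  total : ∀ a b : κ, (Key.le a b || Key.le b a) = true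
  trans : ∀ a b c : κ, Key.le a b = true → Key.le b c = true → Key.le a c = true
  antisymm : ∀ a b : κ, Key.le a b = true → Key.le b a = true → a = b

instance : LawfulKey ℕ where
  total a b := by simpa [Key.le] using Nat.le_total a b
  trans a b c := by simpa [Key.le] using Nat.le_trans
  antisymm a b := by simpa [Key.le] using Nat.le_antisymm

instance (n : ℕ) : LawfulKey (Fin n → ℕ) where
  total a b := by simpa [Key.le] using le_total (List.ofFn a) (List.ofFn b)
  trans a b c := by simpa [Key.le] using le_trans
  antisymm a b := by
    intro h1 h2
    simp only [Key.le, decide_eq_true_eq] at h1 h2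
    exact List.ofFn_injective (le_antisymm h1 h2)

theorem mergeLists_val (L M : List (κ × β)) :
    (mergeLists (n := n) L M).val = List.merge L M fun x y => Key.le x.1 y.1 := by
  induction L, M using mergeLists.induct with
  | case1 M => cases M <;> simp [mergeLists]
  | case2 L h => cases L <;> simp [mergeLists] at h ⊢
  | case3 x L y M ih1 ih2 =>
    rw [mergeLists, List.cons_merge_cons]
    by_cases h : Key.le x.1 y.1 = true
    · simp [h, ih1]
    · simp [h, ih2]

theorem mergeLists_bitOps_le {K : ℕ} (L M : List (κ × β))
    (hL : ∀ t ∈ L, Key.size t.1 ≤ K) (hM : ∀ t ∈ M, Key.size t.1 ≤ K) :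
    (mergeLists (n := n) L M).cost.bitOps ≤ (L.length + M.length) * (2 * K + 2) + 1 := by
  induction L, M using mergeLists.induct with
  | case1 M => cases M <;> simp [mergeLists]
  | case2 L h => cases L <;> simp [mergeLists] at h ⊢
  | case3 x L y M ih1 ih2 =>
    have hx := hL x (by simp)
    have hy := hM y (by simp)
    rw [mergeLists]
    by_cases h : Key.le x.1 y.1 = true
    · have := ih1 (fun t ht => hL t (by simp [ht])) hM
      simp [h] at this ⊢
      nlinarith
    · have := ih2 hL (fun t ht => hM t (by simp [ht]))
      simp [h] at this ⊢
      nlinarith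

@[simp] theorem mergeLists_ringOps (L M : List (κ × β)) :
    (mergeLists (n := n) L M).cost.ringOps = 0 := by
  induction L, M using mergeLists.induct with
  | case1 M => cases M <;> simp [mergeLists]
  | case2 L h => cases L <;> simp [mergeLists] at h ⊢
  | case3 x L y M ih1 ih2 =>
    rw [mergeLists]
    by_cases h : Key.le x.1 y.1 = true <;> simp [h, ih1, ih2]

@[simp] theorem mergeLists_queries (L M : List (κ × β)) :
    (mergeLists (n := n) L M).cost.queries = [] := by
  induction L, M using mergeLists.induct with
  | case1 M => cases M <;> simp [mergeLists]
  | case2 L h => cases L <;> simp [mergeLists] at h ⊢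
  | case3 x L y M ih1 ih2 =>
    rw [mergeLists]
    by_cases h : Key.le x.1 y.1 = true <;> simp [h, ih1, ih2]

theorem mergeSort_perm (d : ℕ) (L : List (κ × β)) :
    (mergeSort (n := n) d L).val.Perm L := by
  induction d generalizing L with
  | zero => simp [mergeSort]
  | succ d ih =>
    simp only [mergeSort, Timed.bind_val, Timed.bits_val, mergeLists_val]
    refine (List.merge_perm_append _).trans ?_
    refine ((ih _).append (ih _)).trans ?_
    simp

/-- The depth is fixed in advance, so at depth 0 the list is returned untouched; the length
hypothesis, which halving preserves, ensures that at most one entry is left there. -/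
theorem mergeSort_pairwise [LawfulKey κ] (d : ℕ) (L : List (κ × β)) (h : L.length ≤ 2 ^ d) :
    (mergeSort (n := n) d L).val.Pairwise fun x y => Key.le x.1 y.1 = true := by
  induction d generalizing L with
  | zero =>
    simp only [mergeSort, Timed.bits_val]
    match L, h with
    | [], _ => simp
    | [a], _ => simp
  | succ d ih =>
    simp only [mergeSort, Timed.bind_val, Timed.bits_val, mergeLists_val]
    rw [pow_succ] at h
    refine List.pairwise_merge (fun a b c => LawfulKey.trans a.1 b.1 c.1)
      (fun a b => LawfulKey.total a.1 b.1) _ _ (ih _ ?_) (ih _ ?_)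
    · simp; omega
    · simp; omega

/-- The summand 3 makes the induction close: two subtrees save 6 units, and the three constant units
of a node (counting, splitting, merging) use up half of them. -/
theorem mergeSort_bitOps_le {K : ℕ} (d : ℕ) (L : List (κ × β))
    (hL : ∀ t ∈ L, Key.size t.1 ≤ K) :
    (mergeSort (n := n) d L).cost.bitOps + 3 ≤ 4 * 2 ^ d + d * L.length * (2 * K + 4) := by
  induction d generalizing L with
  | zero => simp [mergeSort]
  | succ d ih =>
    have hA : ∀ t ∈ L.take (L.length / 2), Key.size t.1 ≤ K := fun t ht =>
      hL t (List.mem_of_mem_take ht)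
    have hB : ∀ t ∈ L.drop (L.length / 2), Key.size t.1 ≤ K := fun t ht =>
      hL t (List.mem_of_mem_drop ht)
    have h1 := ih _ hA
    have h2 := ih _ hB
    have pA := mergeSort_perm (n := n) d (L.take (L.length / 2))
    have pB := mergeSort_perm (n := n) d (L.drop (L.length / 2))
    have h3 := mergeLists_bitOps_le (n := n) (K := K)
      (mergeSort (n := n) d (L.take (L.length / 2))).val
      (mergeSort (n := n) d (L.drop (L.length / 2))).val
      (fun t ht => hA t (pA.mem_iff.1 ht)) (fun t ht => hB t (pB.mem_iff.1 ht))
    rw [pA.length_eq, pB.length_eq] at h3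
    have hl : (L.take (L.length / 2)).length + (L.drop (L.length / 2)).length = L.length := by
      simp; omega
    rw [hl] at h3
    simp only [mergeSort, Timed.bind_cost, Timed.bits_val, Cost.add_bitOps, Timed.bits_bitOps,
      listLength]
    generalize (L.take (L.length / 2)).length = a at *
    generalize (L.drop (L.length / 2)).length = b at *
    rw [pow_succ]
    have : d * a * (2 * K + 4) + d * b * (2 * K + 4) = d * L.length * (2 * K + 4) := by
      rw [← hl]; ring
    nlinarith

@[simp] theorem mergeSort_ringOps (d : ℕ) (L : List (κ × β)) :
    (mergeSort (n := n) d L).cost.ringOps = 0 := by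
  induction d generalizing L with
  | zero => simp [mergeSort]
  | succ d ih => simp [mergeSort, ih]

@[simp] theorem mergeSort_queries (d : ℕ) (L : List (κ × β)) :
    (mergeSort (n := n) d L).cost.queries = [] := by
  induction d generalizing L with
  | zero => simp [mergeSort]
  | succ d ih => simp [mergeSort, ih]

end Keys

/-! ### Grouping of adjacent equal keys. -/

section Groups

variable {κ : Type} {β : Type u} [DecidableEq κ]

/-- The value of `groupAdjacent`. -/
def groups : List (κ × β) → List (κ × List β)
  | [] => []
  | x :: L => match groups L with
    | [] => [(x.1, [x.2])]
    | g :: M => if x.1 = g.1 then (g.1, x.2 :: g.2) :: M else (x.1, [x.2]) :: g :: M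

/-- Grouping only inserts brackets. Both the total number of grouped entries and the represented
function are read off from this. -/
theorem groups_flatMap (L : List (κ × β)) :
    (groups L).flatMap (fun g => g.2.map fun b => (g.1, b)) = L := by
  induction L with
  | nil => rfl
  | cons x L ih =>
    rw [groups]
    rcases hL : groups L with _ | ⟨g, M⟩
    · rw [hL] at ih; simp at ih; simp [← ih]
    · rw [hL] at ih
      by_cases h : x.1 = g.1
      · simp only [h, if_true]
        conv_rhs => rw [← ih]
        simp [← h]
      · simp only [h, if_false]
        conv_rhs => rw [← ih]
        simp

theorem groups_sum_length (L : List (κ × β)) :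
    ((groups L).map fun g => g.2.length).sum = L.length := by
  conv_rhs => rw [← groups_flatMap L]
  simp [List.length_flatMap]

theorem mem_groups_ne_nil (L : List (κ × β)) : ∀ g ∈ groups L, g.2 ≠ [] := by
  induction L with
  | nil => simp [groups]
  | cons x L ih =>
    rw [groups]
    rcases hL : groups L with _ | ⟨g, M⟩
    · simp
    · rw [hL] at ih
      by_cases h : x.1 = g.1
      · simp only [h, if_true]
        intro g' hg'
        rcases List.mem_cons.1 hg' with rfl | h'
        · simp
        · exact ih _ (by simp [h'])
      · simp only [h, if_false]
        intro g' hg'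
        rcases List.mem_cons.1 hg' with rfl | h'
        · simp
        · exact ih _ h'

theorem groups_length_le (L : List (κ × β)) : (groups L).length ≤ L.length := by
  rw [← groups_sum_length L]
  have := List.card_nsmul_le_sum ((groups L).map fun g => g.2.length) 1 (by
    intro x hx
    obtain ⟨g, hg, rfl⟩ := List.mem_map.1 hx
    exact List.length_pos_iff.2 (mem_groups_ne_nil L g hg))
  simpa using this

theorem exists_mem_of_mem_groups (L : List (κ × β)) (g : κ × List β) (hg : g ∈ groups L) :
    ∃ t ∈ L, t.1 = g.1 := by
  obtain ⟨b, hb⟩ := List.exists_mem_of_ne_nil _ (mem_groups_ne_nil L g hg)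
  refine ⟨(g.1, b), ?_, rfl⟩
  rw [← groups_flatMap L]
  exact List.mem_flatMap.2 ⟨g, hg, List.mem_map.2 ⟨b, hb, rfl⟩⟩

end Groups

section GroupKeys

variable {n : ℕ} {κ : Type} [Key κ] {β : Type u} [DecidableEq κ]

theorem groupAdjacent_val (L : List (κ × β)) : (groupAdjacent (n := n) L).val = groups L := by
  induction L with
  | nil => rfl
  | cons x L ih =>
    simp only [groupAdjacent, Timed.bind_val, ih, groups]
    rcases groups L with _ | ⟨g, M⟩
    · rfl
    · by_cases h : x.1 = g.1 <;> simp [h]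

/-- In a sorted list equal keys are adjacent. The induction carries the order along with the
inequality of keys, since a key that reappeared later would be squeezed between equal bounds and
antisymmetry would identify it with the head of the next group. -/
theorem groups_nodup [LawfulKey κ] (L : List (κ × β))
    (h : L.Pairwise fun x y => Key.le x.1 y.1 = true) : ((groups L).map Prod.fst).Nodup := by
  suffices H : (groups L).Pairwise fun x y => Key.le x.1 y.1 = true ∧ x.1 ≠ y.1 by
    rw [List.Nodup, List.pairwise_map]
    exact H.imp fun h => h.2
  induction L with
  | nil => simp [groups]
  | cons x L ih =>
    rw [List.pairwise_cons] at h
    have ih := ih h.2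
    have hx : ∀ g ∈ groups L, Key.le x.1 g.1 = true := fun g hg => by
      obtain ⟨t, ht, e⟩ := exists_mem_of_mem_groups L g hg
      exact e ▸ h.1 t ht
    rw [groups]
    rcases hL : groups L with _ | ⟨g, M⟩
    · simp
    · rw [hL] at ih hx
      rw [List.pairwise_cons] at ih
      by_cases e : x.1 = g.1
      · simp only [e, if_true]
        exact List.pairwise_cons.2 ⟨ih.1, ih.2⟩
      · simp only [e, if_false]
        refine List.pairwise_cons.2 ⟨?_, List.pairwise_cons.2 ih⟩
        intro g' hg'
        refine ⟨hx g' hg', fun e' => ?_⟩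
        rcases List.mem_cons.1 hg' with rfl | h'
        · exact e e'
        · change x.1 = g'.1 at e'
          exact e (LawfulKey.antisymm _ _ (hx g (by simp)) (e' ▸ (ih.1 g' h').1))

theorem groupAdjacent_bitOps_le {K : ℕ} (L : List (κ × β)) (hL : ∀ t ∈ L, Key.size t.1 ≤ K) :
    (groupAdjacent (n := n) L).cost.bitOps ≤ L.length * (2 * K + 2) + 1 := by
  induction L with
  | nil => simp [groupAdjacent]
  | cons x L ih =>
    have ih := ih fun t ht => hL t (by simp [ht])
    have hx := hL x (by simp)
    have hg := exists_mem_of_mem_groups L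
    simp only [groupAdjacent, Timed.bind_cost, groupAdjacent_val, Cost.add_bitOps]
    rcases hL' : groups L with _ | ⟨g, M⟩
    · simp; nlinarith
    · rw [hL'] at hg
      obtain ⟨t, ht, e⟩ := hg g (by simp)
      have := hL t (by simp [ht])
      rw [e] at this
      simp
      nlinarith

@[simp] theorem groupAdjacent_ringOps (L : List (κ × β)) :
    (groupAdjacent (n := n) L).cost.ringOps = 0 := by
  induction L with
  | nil => simp [groupAdjacent]
  | cons x L ih =>
    simp only [groupAdjacent, Timed.bind_cost, Cost.add_ringOps, ih]
    rcases (groupAdjacent (n := n) L).val with _ | ⟨g, M⟩ <;> simp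

@[simp] theorem groupAdjacent_queries (L : List (κ × β)) :
    (groupAdjacent (n := n) L).cost.queries = [] := by
  induction L with
  | nil => simp [groupAdjacent]
  | cons x L ih =>
    simp only [groupAdjacent, Timed.bind_cost, Cost.add_queries, ih]
    rcases (groupAdjacent (n := n) L).val with _ | ⟨g, M⟩ <;> simp

end GroupKeys

/-! ## Lists of terms and the functions they represent -/

section Value

variable {κ : Type*} {ι : Type*} {R : Type u} [CommRing R]

/-- The function that sends an exponent to its total coefficient in a list of terms. -/
noncomputable def value (L : List (κ × R)) : κ →₀ R :=
  (L.map fun t => Finsupp.single t.1 t.2).sum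

@[simp] theorem value_nil : value ([] : List (κ × R)) = 0 := rfl

@[simp] theorem value_cons (t : κ × R) (L : List (κ × R)) :
    value (t :: L) = Finsupp.single t.1 t.2 + value L := by simp [value]

@[simp] theorem value_append (L M : List (κ × R)) : value (L ++ M) = value L + value M := by
  simp [value]

theorem value_perm {L M : List (κ × R)} (h : L.Perm M) : value L = value M :=
  (h.map _).sum_eq

theorem value_map_neg (L : List (κ × R)) : value (L.map fun t => (t.1, -t.2)) = -value L := by
  induction L with
  | nil => simp
  | cons t L ih => simp [ih, add_comm]

theorem value_map_sum (G : List (κ × List R)) :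
    value (G.map fun g => (g.1, g.2.sum)) =
      value (G.flatMap fun g => g.2.map fun b => (g.1, b)) := by
  have aux (k : κ) (l : List R) : value (l.map fun b => (k, b)) = Finsupp.single k l.sum := by
    induction l with
    | nil => simp
    | cons a l ih => simp [ih]
  induction G with
  | nil => rfl
  | cons g G ih => simp [ih, aux]

theorem value_filter {p : κ × R → Bool} (L : List (κ × R))
    (hp : ∀ t ∈ L, p t = false → t.2 = 0) : value (L.filter p) = value L := by
  induction L with
  | nil => rfl
  | cons t L ih =>
    have ih := ih fun t ht => hp t (by simp [ht])
    rw [List.filter_cons]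
    cases h : p t
    · simp [ih, hp t (by simp) h]
    · simp [ih]

theorem value_map_key (φ : κ → ι) (L : List (κ × R)) :
    value (L.map fun t => (φ t.1, t.2)) = (value L).mapDomain φ := by
  induction L with
  | nil => simp
  | cons t L ih => simp [ih, Finsupp.mapDomain_add, Finsupp.mapDomain_single]

/-- Arithmetic on term lists creates no new exponents. All bounds on the exponents of computed
polynomials are propagated through this fact. -/
theorem exists_mem_of_value_ne_zero {L : List (κ × R)} {k : κ} (h : value L k ≠ 0) :
    ∃ t ∈ L, t.1 = k := by
  classical
  by_contra! H
  apply h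
  induction L with
  | nil => simp
  | cons t L ih =>
    have h1 := H t (by simp)
    have h2 : value L k = 0 := by
      by_contra h3
      exact h3 (ih h3 fun t ht => H t (by simp [ht]))
    simp [h2, h1]

/-- `L` is a list of terms with distinct exponents and nonzero coefficients that represents `v`. -/
structure Represents (L : List (κ × R)) (v : κ →₀ R) : Prop where
  nodup : (L.map Prod.fst).Nodup
  ne_zero : ∀ t ∈ L, t.2 ≠ 0
  value_eq : value L = v

theorem value_apply_of_nodup {L : List (κ × R)} (h : (L.map Prod.fst).Nodup) {t : κ × R}
    (ht : t ∈ L) : value L t.1 = t.2 := by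
  classical
  induction L with
  | nil => simp at ht
  | cons x L ih =>
    rw [List.map_cons, List.nodup_cons] at h
    rcases List.mem_cons.1 ht with rfl | ht'
    · have : value L t.1 = 0 := by
        by_contra h'
        obtain ⟨y, hy, e⟩ := exists_mem_of_value_ne_zero h'
        exact h.1 (List.mem_map.2 ⟨y, hy, e⟩)
      simp [this]
    · have hne : x.1 ≠ t.1 := fun e => h.1 (List.mem_map.2 ⟨t, ht', e.symm⟩)
      simp [ih h.2 ht', hne]

namespace Represents

variable {L : List (κ × R)} {v : κ →₀ R}

/-- A sparse representation is determined up to order by the function it represents, so the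
algorithm can be analysed on finitely supported functions instead of lists. -/
theorem mem_iff (h : Represents L v) (t : κ × R) : t ∈ L ↔ v t.1 = t.2 ∧ t.2 ≠ 0 := by
  constructor
  · intro ht
    exact ⟨h.value_eq ▸ value_apply_of_nodup h.nodup ht, h.ne_zero t ht⟩
  · rintro ⟨h1, h2⟩
    have h3 : value L t.1 ≠ 0 := by rw [h.value_eq, h1]; exact h2
    obtain ⟨t', ht', e⟩ := exists_mem_of_value_ne_zero h3
    have h4 := value_apply_of_nodup h.nodup ht'
    rw [e, h.value_eq, h1] at h4
    rw [show t = t' from Prod.ext e.symm h4]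
    exact ht'

theorem mem_support_iff (h : Represents L v) (k : κ) : k ∈ v.support ↔ k ∈ L.map Prod.fst := by
  rw [Finsupp.mem_support_iff, List.mem_map]
  constructor
  · intro hk
    exact ⟨(k, v k), (h.mem_iff _).2 ⟨rfl, hk⟩, rfl⟩
  · rintro ⟨t, ht, rfl⟩
    obtain ⟨h1, h2⟩ := (h.mem_iff t).1 ht
    rwa [h1]

theorem length_eq (h : Represents L v) : L.length = v.support.card := by
  classical
  have : v.support = (L.map Prod.fst).toFinset := by
    ext k; rw [h.mem_support_iff, List.mem_toFinset]
  rw [this, List.toFinset_card_of_nodup h.nodup, List.length_map]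

end Represents

theorem card_support_value_le (L : List (κ × R)) : (value L).support.card ≤ L.length := by
  classical
  have : (value L).support ⊆ (L.map Prod.fst).toFinset := by
    intro k hk
    obtain ⟨t, ht, e⟩ := exists_mem_of_value_ne_zero (Finsupp.mem_support_iff.1 hk)
    exact List.mem_toFinset.2 (List.mem_map.2 ⟨t, ht, e⟩)
  calc _ ≤ _ := Finset.card_le_card this
    _ ≤ _ := List.toFinset_card_le _
    _ = _ := List.length_map _

theorem Represents.exists_mem {L M : List (κ × R)} (h : Represents L (value M)) (t : κ × R)
    (ht : t ∈ L) : ∃ t' ∈ M, t'.1 = t.1 := by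
  obtain ⟨h1, h2⟩ := (h.mem_iff t).1 ht
  exact exists_mem_of_value_ne_zero (h1 ▸ h2)

end Value

/-! ## Normal forms of lists of terms -/

section Normalize

variable {n : ℕ} {κ : Type} [Key κ] [DecidableEq κ] {R : Type u} [CommRing R]

open Classical in
theorem normalize_val (L : List (κ × R)) : (normalize (n := n) L).val =
    ((groups (mergeSort (n := n) L.length.size L).val).map fun g => (g.1, g.2.sum)).filter
      fun t => decide (t.2 ≠ 0) := by
  simp [normalize, groupAdjacent_val, Timed.foldl_val, List.sum_eq_foldl]

theorem normalize_represents [LawfulKey κ] (L : List (κ × R)) :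
    Represents (normalize (n := n) L).val (value L) := by
  classical
  rw [normalize_val]
  have h := mergeSort_pairwise (n := n) L.length.size L (Nat.lt_size_self _).le
  refine ⟨?_, ?_, ?_⟩
  · refine (groups_nodup _ h).sublist ?_
    refine (List.filter_sublist.map _).trans ?_
    simp [List.map_map, Function.comp_def]
  · intro t ht
    simpa using (List.mem_filter.1 ht).2
  · rw [value_filter _ (by simp), value_map_sum, groups_flatMap]
    exact value_perm (mergeSort_perm _ _)

theorem normalize_length_le [LawfulKey κ] (L : List (κ × R)) :
    (normalize (n := n) L).val.length ≤ L.length := by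
  rw [(normalize_represents L).length_eq]
  exact card_support_value_le L

/-- Sorting dominates with m log m comparisons of keys; grouping, summing and filtering are linear
in the number m of terms. -/
theorem normalize_bitOps_le {K : ℕ} (L : List (κ × R)) (hL : ∀ t ∈ L, Key.size t.1 ≤ K) :
    (normalize (n := n) L).cost.bitOps ≤ (L.length + 1) * (L.length.size + 1) * (4 * K + 32) := by
  have hp := mergeSort_perm (n := n) L.length.size L
  have h1 := mergeSort_bitOps_le (n := n) L.length.size L hL
  have h2 := groupAdjacent_bitOps_le (n := n) (K := K) (mergeSort (n := n) L.length.size L).val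
    fun t ht => hL t (hp.mem_iff.1 ht)
  have h3 := groups_length_le (mergeSort (n := n) L.length.size L).val
  have h4 := groups_sum_length (mergeSort (n := n) L.length.size L).val
  have h5 : ∀ s : List (κ × R), (Timed.filter (n := n) (fun t : κ × R => ringNeZero t.2)
      s).cost.bitOps
      ≤ s.length * (0 + 1) + 1 := fun s => Timed.filter_bitOps_le (by simp)
  have h6 : ∀ l : List R, (Timed.foldl (n := n) ringAdd 0 l).cost.bitOps ≤ l.length * (0 + 1) + 1 :=
    fun l => Timed.foldl_bitOps_le' (by simp) 0
  have h7 := two_pow_size_le L.length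
  have h8 := size_le_self L.length
  rw [hp.length_eq] at h2 h3 h4
  simp only [normalize, Timed.bind_cost, Cost.add_bitOps, groupAdjacent_val, Timed.bits_bitOps,
    listLength, natSize, Timed.bits_val, Timed.traverse_bitOps, Timed.pure_cost, Cost.zero_bitOps,
    Timed.traverse_val]
  have h9 := h5 ((groups (mergeSort (n := n) L.length.size L).val).map fun g =>
    (((Timed.foldl (n := n) ringAdd 0 g.2).bind fun c => Timed.pure (g.1, c)).val))
  -- The summation loops together cost one unit per term and one per group, because the group
  -- lengths add up to the length of the list.
  have h10 : ((groups (mergeSort (n := n) L.length.size L).val).map fun g =>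
      (Timed.foldl (n := n) ringAdd 0 g.2).cost.bitOps + 0).sum ≤ L.length + L.length := by
    calc _ ≤ ((groups (mergeSort (n := n) L.length.size L).val).map fun g => g.2.length + 1).sum :=
          List.sum_le_sum fun g _ => by simpa using h6 g.2
      _ = L.length + (groups (mergeSort (n := n) L.length.size L).val).length := by
          rw [List.sum_map_add, h4]; simp
      _ ≤ _ := by omega
  rw [List.length_map] at h9
  generalize L.length.size = z at *
  generalize L.length = m at *
  have e1 : z * m * (2 * K + 4) ≤ (m + 1) * (z + 1) * (2 * K + 4) := by gcongr ?_ * _; nlinarith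
  have e2 : m * (2 * K + 2) ≤ (m + 1) * (z + 1) * (2 * K + 2) := by gcongr ?_ * _; nlinarith
  have e3 : m + 1 ≤ (m + 1) * (z + 1) := by nlinarith
  have e4 : z + 1 ≤ m + 1 := by omega
  have e5 : (m + 1) * (z + 1) * (4 * K + 32) = (m + 1) * (z + 1) * (2 * K + 4) +
      (m + 1) * (z + 1) * (2 * K + 2) + 26 * ((m + 1) * (z + 1)) := by ring
  omega

/-- One addition per term, since every group is summed starting from 0, and one zero test per group.
-/
theorem normalize_ringOps_le (L : List (κ × R)) :
    (normalize (n := n) L).cost.ringOps ≤ 2 * L.length := by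
  have hp := mergeSort_perm (n := n) L.length.size L
  have h3 := groups_length_le (mergeSort (n := n) L.length.size L).val
  have h4 := groups_sum_length (mergeSort (n := n) L.length.size L).val
  have h5 : ∀ s : List (κ × R), (Timed.filter (n := n) (fun t : κ × R => ringNeZero t.2)
      s).cost.ringOps = s.length * 1 := fun s => Timed.filter_ringOps_eq (by simp) s
  have h6 : ∀ l : List R, (Timed.foldl (n := n) ringAdd 0 l).cost.ringOps = l.length * 1 :=
    fun l => Timed.foldl_ringOps_eq (by simp) l 0
  rw [hp.length_eq] at h3 h4
  simp [normalize, groupAdjacent_val, h5, h6, h4]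
  omega

@[simp] theorem normalize_queries (L : List (κ × R)) :
    (normalize (n := n) L).cost.queries = [] := by
  have h5 : ∀ s : List (κ × R), (Timed.filter (n := n) (fun t : κ × R => ringNeZero t.2)
      s).cost.queries = [] := fun s => Timed.filter_queries_eq_nil (by simp) s
  have h6 : ∀ l : List R, (Timed.foldl (n := n) ringAdd 0 l).cost.queries = [] :=
    fun l => Timed.foldl_queries_eq_nil (by simp) l 0
  simp [normalize, h5, h6]

theorem addTerms_represents [LawfulKey κ] (F G : List (κ × R)) :
    Represents (addTerms (n := n) F G).val (value F + value G) := by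
  simpa [addTerms] using normalize_represents (n := n) (F ++ G)

theorem addTerms_length_le [LawfulKey κ] (F G : List (κ × R)) :
    (addTerms (n := n) F G).val.length ≤ F.length + G.length := by
  simpa [addTerms] using normalize_length_le (n := n) (F ++ G)

theorem addTerms_mem [LawfulKey κ] (F G : List (κ × R)) (t : κ × R)
    (ht : t ∈ (addTerms (n := n) F G).val) : ∃ t' ∈ F ++ G, t'.1 = t.1 := by
  have h := addTerms_represents (n := n) F G
  rw [← value_append] at h
  exact h.exists_mem t ht

theorem addTerms_bitOps_le {K : ℕ} (F G : List (κ × R)) (hF : ∀ t ∈ F, Key.size t.1 ≤ K)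
    (hG : ∀ t ∈ G, Key.size t.1 ≤ K) :
    (addTerms (n := n) F G).cost.bitOps ≤
      (F.length + G.length + 1) * ((F.length + G.length).size + 1) * (4 * K + 33) := by
  have := normalize_bitOps_le (n := n) (K := K) (F ++ G) (by
    intro t ht
    rcases List.mem_append.1 ht with h | h
    exacts [hF t h, hG t h])
  simp [addTerms] at this ⊢
  nlinarith [Nat.zero_le ((F.length + G.length) * (F.length + G.length).size)]

theorem addTerms_ringOps_le (F G : List (κ × R)) :
    (addTerms (n := n) F G).cost.ringOps ≤ 2 * (F.length + G.length) := by
  simpa [addTerms] using normalize_ringOps_le (n := n) (F ++ G)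

@[simp] theorem addTerms_queries (F G : List (κ × R)) :
    (addTerms (n := n) F G).cost.queries = [] := by simp [addTerms]

theorem subTerms_val (F G : List (κ × R)) : (subTerms (n := n) F G).val =
    (addTerms (n := n) F (G.map fun t => (t.1, -t.2))).val := by
  simp [subTerms]

theorem subTerms_represents [LawfulKey κ] (F G : List (κ × R)) :
    Represents (subTerms (n := n) F G).val (value F - value G) := by
  rw [subTerms_val, sub_eq_add_neg, ← value_map_neg]
  exact addTerms_represents _ _

theorem subTerms_length_le [LawfulKey κ] (F G : List (κ × R)) :
    (subTerms (n := n) F G).val.length ≤ F.length + G.length := by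
  rw [subTerms_val]
  simpa using addTerms_length_le (n := n) F (G.map fun t => (t.1, -t.2))

theorem subTerms_mem [LawfulKey κ] (F G : List (κ × R)) (t : κ × R)
    (ht : t ∈ (subTerms (n := n) F G).val) : ∃ t' ∈ F ++ G, t'.1 = t.1 := by
  rw [subTerms_val] at ht
  obtain ⟨t', h, e⟩ := addTerms_mem _ _ _ ht
  rcases List.mem_append.1 h with h | h
  · exact ⟨t', by simp [h], e⟩
  · obtain ⟨t'', h', rfl⟩ := List.mem_map.1 h
    exact ⟨t'', by simp [h'], e⟩

theorem subTerms_bitOps_le {K : ℕ} (F G : List (κ × R)) (hF : ∀ t ∈ F, Key.size t.1 ≤ K)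
    (hG : ∀ t ∈ G, Key.size t.1 ≤ K) :
    (subTerms (n := n) F G).cost.bitOps ≤
      (F.length + G.length + 1) * ((F.length + G.length).size + 1) * (4 * K + 34) := by
  have := addTerms_bitOps_le (n := n) (K := K) F (G.map fun t => (t.1, -t.2)) hF (by
    intro t ht
    obtain ⟨t'', h, rfl⟩ := List.mem_map.1 ht
    exact hG t'' h)
  have h2 : (Timed.traverse (n := n) (fun t : κ × R => (ringNeg t.2).bind fun c =>
      Timed.pure (t.1, c)) G).cost.bitOps ≤ G.length * (0 + 1) + 1 :=
    Timed.traverse_bitOps_le (by simp)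
  simp [subTerms] at this h2 ⊢
  nlinarith [Nat.zero_le ((F.length + G.length) * (F.length + G.length).size)]

theorem subTerms_ringOps_le (F G : List (κ × R)) :
    (subTerms (n := n) F G).cost.ringOps ≤ 3 * (F.length + G.length) := by
  have := addTerms_ringOps_le (n := n) F (G.map fun t => (t.1, -t.2))
  simp [subTerms] at this ⊢
  omega

@[simp] theorem subTerms_queries (F G : List (κ × R)) :
    (subTerms (n := n) F G).cost.queries = [] := by simp [subTerms]

end Normalize


/-! ## The sieve -/

section Sieve

variable {n : ℕ}

/-- The rounds of the sieve have very different costs; a uniform bound per round would lose the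
harmonic sum and give a quadratic estimate. -/
theorem Timed.foldl_bitOps_le_sum {α : Type u} {β : Type v} {f : β → α → Timed n β} {c : α → ℕ}
    {L : List α} (h : ∀ a ∈ L, ∀ s, (f s a).cost.bitOps ≤ c a) (s : β) :
    (Timed.foldl f s L).cost.bitOps ≤ (L.map c).sum + L.length + 1 := by
  induction L generalizing s with
  | nil => simp [Timed.foldl]
  | cons a L ih =>
    have h1 := h a (by simp) s
    have := ih (fun b hb => h b (by simp [hb])) (f s a).val
    simp [Timed.foldl]
    omega

theorem foldl_update_eq_true_iff (g : ℕ → ℕ) (L : List ℕ) (A : ℕ → Bool) (x : ℕ) :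
    L.foldl (fun A j => Function.update A (g j) true) A x = true ↔
      A x = true ∨ ∃ j ∈ L, g j = x := by
  induction L generalizing A with
  | nil => simp
  | cons a L ih =>
    rw [List.foldl_cons, ih]
    by_cases h : x = g a
    · subst h; simp
    · simp [Function.update_of_ne h, Ne.symm h]

theorem markMultiples_val (bound i : ℕ) (A : ℕ → Bool) (x : ℕ) :
    (markMultiples (n := n) bound i A).val x = true ↔
      A x = true ∨ ∃ j, 2 ≤ j ∧ j ≤ bound / i ∧ i * j = x := by
  have := foldl_update_eq_true_iff (fun j => i * j) (List.range' 2 (bound / i - 1)) A x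
  simp only [markMultiples, natDiv, Timed.bind_val, Timed.bits_val, Timed.foldl_val, natMul,
    writeCell]
  rw [this]
  simp only [List.mem_range'_1]
  constructor
  · rintro (h | ⟨j, h1, h2⟩)
    · exact Or.inl h
    · exact Or.inr ⟨j, by omega, by omega, h2⟩
  · rintro (h | ⟨j, h1, h2, h3⟩)
    · exact Or.inl h
    · exact Or.inr ⟨j, by omega, h3⟩

/-- One round of the sieve. -/
def sieveStep (bound : ℕ) (A : ℕ → Bool) (i : ℕ) : Timed n (ℕ → Bool) :=
  (readCell A i).bind fun b => if b then Timed.pure A else markMultiples bound i A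

theorem sieve_eq (bound : ℕ) : sieve (n := n) bound = (newArray (bound + 1) false).bind fun A =>
    Timed.foldl (sieveStep bound) A (List.range' 2 (bound - 1)) := rfl

theorem sieveStep_of_true {bound i : ℕ} {A : ℕ → Bool} (h : A i = true) :
    sieveStep (n := n) bound A i = ⟨A, ⟨[], 0, i.size + 1⟩ + 0⟩ := by
  simp only [sieveStep, readCell, Timed.bits, Timed.bind, h, if_true, Timed.pure]

theorem sieveStep_of_false {bound i : ℕ} {A : ℕ → Bool} (h : A i = false) :
    sieveStep (n := n) bound A i = ⟨(markMultiples (n := n) bound i A).val,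
      ⟨[], 0, i.size + 1⟩ + (markMultiples (n := n) bound i A).cost⟩ := by
  simp only [sieveStep, readCell, Timed.bits, Timed.bind, h, Bool.false_eq_true, if_false]

/-- The invariant of the sieve: once 2, …, k + 1 are treated, the marked numbers are those with a
proper prime divisor in this range. -/
theorem sieve_loop_val (bound k : ℕ) (hk : k ≤ bound - 1) (j : ℕ) (h2 : 2 ≤ j) (hj : j ≤ bound) :
    (Timed.foldl (n := n) (sieveStep bound) (fun _ => false) (List.range' 2 k)).val j = true ↔
      ∃ q, q.Prime ∧ q < 2 + k ∧ q ∣ j ∧ q < j := by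
  induction k generalizing j with
  | zero =>
    simp only [Timed.foldl_val, List.range'_zero, List.foldl_nil, Bool.false_eq_true, add_zero,
      false_iff]
    rintro ⟨q, hq, h, -⟩
    exact absurd hq.two_le (by omega)
  | succ k ih =>
    have ih := ih (by omega)
    rw [Timed.foldl_val] at ih ⊢
    rw [List.range'_concat, List.foldl_append, one_mul]
    set A := (List.range' 2 k).foldl (fun (s : ℕ → Bool) a => (sieveStep (n := n) bound s a).val)
      (fun _ => false)
    have hA := ih (2 + k) (by omega) (by omega)
    rw [List.foldl_cons, List.foldl_nil]
    by_cases hp : (2 + k).Prime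
    · have : A (2 + k) = false := by
        rw [← Bool.not_eq_true, hA]
        rintro ⟨q, hq, h, hd, -⟩
        rw [(Nat.prime_dvd_prime_iff_eq hq hp).1 hd] at h
        omega
      rw [sieveStep_of_false this, markMultiples_val, ih j h2 hj]
      constructor
      · rintro (⟨q, hq, h, hd, hl⟩ | ⟨m, hm, hm', rfl⟩)
        · exact ⟨q, hq, by omega, hd, hl⟩
        · exact ⟨2 + k, hp, by omega, dvd_mul_right _ _, by nlinarith⟩
      · rintro ⟨q, hq, h, hd, hl⟩
        rcases Nat.lt_or_ge q (2 + k) with h' | h'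
        · exact Or.inl ⟨q, hq, h', hd, hl⟩
        · obtain rfl : q = 2 + k := by omega
          obtain ⟨m, rfl⟩ := hd
          refine Or.inr ⟨m, ?_, ?_, rfl⟩
          · by_contra hm
            have : m ≤ 1 := by omega
            nlinarith
          · rw [Nat.le_div_iff_mul_le hp.pos, mul_comm]
            exact hj
    -- A composite number has already been marked by its least prime factor, so its round changes
    -- nothing.
    · have : A (2 + k) = true := by
        rw [hA]
        have h1 : 2 + k ≠ 1 := by omega
        have h2 := (Nat.not_prime_iff_minFac_lt (by omega)).1 hp
        exact ⟨_, Nat.minFac_prime h1, h2, Nat.minFac_dvd _, h2⟩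
      rw [sieveStep_of_true this, ih j h2 hj]
      constructor
      · rintro ⟨q, hq, h, hd, hl⟩
        exact ⟨q, hq, by omega, hd, hl⟩
      · rintro ⟨q, hq, h, hd, hl⟩
        refine ⟨q, hq, ?_, hd, hl⟩
        rcases Nat.lt_or_ge q (2 + k) with h' | h'
        · exact h'
        · exact absurd ((show q = 2 + k by omega) ▸ hq) hp

theorem sieve_val (bound j : ℕ) (h2 : 2 ≤ j) (hj : j ≤ bound) :
    (sieve (n := n) bound).val j = !decide j.Prime := by
  have h := sieve_loop_val (n := n) bound (bound - 1) le_rfl j h2 hj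
  rw [Bool.eq_iff_iff]
  simp only [sieve_eq, newArray, Timed.bind_val, Timed.bits_val]
  rw [h]
  simp only [Bool.not_eq_eq_eq_not, Bool.not_true, decide_eq_false_iff_not]
  constructor
  · rintro ⟨q, hq, -, hd, hl⟩ hp
    rw [(Nat.prime_dvd_prime_iff_eq hq hp).1 hd] at hl
    omega
  · intro hp
    have := (Nat.not_prime_iff_minFac_lt h2).1 hp
    exact ⟨_, Nat.minFac_prime (by omega), by omega, Nat.minFac_dvd _, this⟩

/-- The harmonic sum by dyadic blocks: the 2^k terms with 2^k ≤ i < 2^(k+1) are each at most B / 2^k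
and so contribute at most B. -/
theorem sum_div_le (B k : ℕ) : ∑ i ∈ Finset.Ico 1 (2 ^ k), B / i ≤ B * k := by
  induction k with
  | zero => simp
  | succ k ih =>
    rw [← Finset.sum_Ico_consecutive _ (Nat.one_le_two_pow) (Nat.pow_le_pow_right two_pos k.le_succ)]
    have : ∑ i ∈ Finset.Ico (2 ^ k) (2 ^ (k + 1)), B / i ≤ B := by
      calc _ ≤ ∑ i ∈ Finset.Ico (2 ^ k) (2 ^ (k + 1)), B / 2 ^ k := by
            refine Finset.sum_le_sum fun i hi => ?_
            exact Nat.div_le_div_left (Finset.mem_Ico.1 hi).1 (by positivity)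
        _ = 2 ^ k * (B / 2 ^ k) := by simp [pow_succ, mul_two]
        _ ≤ B := Nat.mul_div_le _ _
    nlinarith

theorem sum_range'_div_le (B : ℕ) : ((List.range' 2 (B - 1)).map fun i => B / i).sum ≤
    B * B.size := by
  have h1 : ((List.range' 2 (B - 1)).map fun i => B / i).sum =
      ∑ i ∈ Finset.Ico 2 (2 + (B - 1)), B / i := by
    rw [Finset.sum_list_map_count, List.toFinset_range'_1]
    refine Finset.sum_congr rfl fun i hi => ?_
    rw [List.count_eq_one_of_mem List.nodup_range']
    · simp
    · simpa using hi
  rw [h1]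
  refine le_trans (Finset.sum_le_sum_of_subset ?_) (sum_div_le B B.size)
  intro i hi
  have := Nat.lt_size_self B
  rw [Finset.mem_Ico] at hi ⊢
  omega

theorem markMultiples_bitOps_le (bound i : ℕ) (hi : i ≤ bound) (A : ℕ → Bool) :
    (markMultiples (n := n) bound i A).cost.bitOps ≤ (3 * (bound / i) + 2) * mulCost bound.size := by
  have h1 := succ_le_mulCost bound.size
  have h2 : mulBits bound i ≤ mulCost bound.size := mulBits_le le_rfl (Nat.size_le_size hi)
  have h3 : (Timed.foldl (n := n) (fun A j => (natMul i j).bind fun m => writeCell A m true) A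
      (List.range' 2 (bound / i - 1))).cost.bitOps ≤
      (bound / i - 1) * (2 * mulCost bound.size + 1) + 1 := by
    refine (Timed.foldl_bitOps_le' (c := 2 * mulCost bound.size) ?_ A).trans (by simp)
    intro j hj s
    simp only [List.mem_range'_1] at hj
    have hj2 : j ≤ bound / i := by omega
    have hij : i * j ≤ bound := (Nat.mul_le_mul_left i hj2).trans (Nat.mul_div_le _ _)
    have e1 : mulBits i j ≤ mulCost bound.size :=
      mulBits_le (Nat.size_le_size hi) (Nat.size_le_size (hj2.trans (Nat.div_le_self _ _)))
    have e2 := Nat.size_le_size hij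
    simp
    omega
  simp only [markMultiples, natDiv, Timed.bind_cost, Timed.bits_val, Cost.add_bitOps,
    Timed.bits_bitOps]
  rcases h : bound / i with _ | q
  · rw [h] at h3; simp at h3 ⊢; omega
  · rw [h] at h3; simp at h3 ⊢; nlinarith

/-- Marking the multiples of i takes about `bound / i` writes; the harmonic sum turns this into
`bound * bound.size`. -/
theorem sieve_bitOps_le (bound : ℕ) :
    (sieve (n := n) bound).cost.bitOps ≤ (bound + 1) * (3 * bound.size + 8) * mulCost bound.size := by
  have h1 := succ_le_mulCost bound.size
  have h := Timed.foldl_bitOps_le_sum (n := n) (L := List.range' 2 (bound - 1))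
    (f := sieveStep bound)
    (c := fun i => mulCost bound.size + (3 * (bound / i) + 2) * mulCost bound.size) (by
      intro i hi A
      simp only [List.mem_range'_1] at hi
      have hi : i ≤ bound := by omega
      have := markMultiples_bitOps_le (n := n) bound i hi A
      have := Nat.size_le_size hi
      rcases hA : A i
      · rw [sieveStep_of_false hA]; simp; omega
      · rw [sieveStep_of_true hA]; simp; omega) (fun _ => false)
  have h2 := sum_range'_div_le bound
  have h3 : ((List.range' 2 (bound - 1)).map fun i =>
      mulCost bound.size + (3 * (bound / i) + 2) * mulCost bound.size).sum =
      3 * mulCost bound.size * ((List.range' 2 (bound - 1)).map fun i => bound / i).sum +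
      (bound - 1) * (3 * mulCost bound.size) := by
    have : (fun i => mulCost bound.size + (3 * (bound / i) + 2) * mulCost bound.size) =
        fun i => 3 * mulCost bound.size * (bound / i) + 3 * mulCost bound.size := by
      funext i; ring
    rw [this, List.sum_map_add, List.sum_map_mul_left]
    simp
  rw [h3, List.length_range'] at h
  have h4 : 3 * mulCost bound.size * ((List.range' 2 (bound - 1)).map fun i => bound / i).sum ≤
    3 * mulCost bound.size * (bound * bound.size) := by gcongr
  have h5 : (bound - 1) * (3 * mulCost bound.size) ≤ bound * (3 * mulCost bound.size) := by
    gcongr; omega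
  simp only [sieve_eq, newArray, Timed.bind_cost, Timed.bits_val, Cost.add_bitOps,
    Timed.bits_bitOps]
  have h6 : bound ≤ bound * mulCost bound.size := Nat.le_mul_of_pos_right _ (by omega)
  have h7 : (bound + 1) * (3 * bound.size + 8) * mulCost bound.size =
    3 * mulCost bound.size * (bound * bound.size) + bound * (3 * mulCost bound.size) +
    5 * (bound * mulCost bound.size) + (3 * bound.size + 8) * mulCost bound.size := by ring
  have h8 : 8 ≤ (3 * bound.size + 8) * mulCost bound.size := by nlinarith
  omega

theorem markMultiples_ringOps (bound i : ℕ) (A : ℕ → Bool) :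
    (markMultiples (n := n) bound i A).cost.ringOps = 0 := by
  have : ∀ (L : List ℕ) A, (Timed.foldl (n := n) (fun A j => (natMul i j).bind fun m =>
      writeCell A m true) A L).cost.ringOps = L.length * 0 :=
    fun L A => Timed.foldl_ringOps_eq (by simp) L A
  simp [markMultiples] at this ⊢
  simp [this]

theorem markMultiples_queries (bound i : ℕ) (A : ℕ → Bool) :
    (markMultiples (n := n) bound i A).cost.queries = [] := by
  have : ∀ (L : List ℕ) A, (Timed.foldl (n := n) (fun A j => (natMul i j).bind fun m =>
      writeCell A m true) A L).cost.queries = [] :=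
    fun L A => Timed.foldl_queries_eq_nil (by simp) L A
  simp [markMultiples] at this ⊢
  simp [this]

@[simp] theorem sieve_ringOps (bound : ℕ) : (sieve (n := n) bound).cost.ringOps = 0 := by
  have : ∀ (L : List ℕ) A, (Timed.foldl (n := n) (sieveStep bound) A L).cost.ringOps =
      L.length * 0 :=
    fun L A => Timed.foldl_ringOps_eq (by
      intro i A
      rcases hA : A i
      · rw [sieveStep_of_false hA]; simp [markMultiples_ringOps]
      · rw [sieveStep_of_true hA]; simp) L A
  simp only [sieve_eq, newArray, Timed.bind_cost, Timed.bits_val, Cost.add_ringOps, this]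
  simp

@[simp] theorem sieve_queries (bound : ℕ) : (sieve (n := n) bound).cost.queries = [] := by
  have : ∀ (L : List ℕ) A, (Timed.foldl (n := n) (sieveStep bound) A L).cost.queries = [] :=
    fun L A => Timed.foldl_queries_eq_nil (by
      intro i A
      rcases hA : A i
      · rw [sieveStep_of_false hA]; simp [markMultiples_queries]
      · rw [sieveStep_of_true hA]; simp) L A
  simp only [sieve_eq, newArray, Timed.bind_cost, Timed.bits_val, Cost.add_queries, this]
  simp

/-- The limit of the sieve in `firstPrimes`. -/
def sieveBound (lo N : ℕ) : ℕ := 16 * ((lo + N) * (lo + N).size)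

theorem firstPrimes_val (lo N : ℕ) : (firstPrimes (n := n) lo N).val =
    ((List.range' 2 (sieveBound lo N - 1)).filter fun i => decide (lo ≤ i ∧ i.Prime)).take N := by
  simp only [firstPrimes, natAdd, natSize, natMul, Timed.bind_val, Timed.bits_val,
    Timed.filter_val, natLe, readCell, Timed.pure_val]
  congr 1
  refine List.filter_congr fun i hi => ?_
  simp only [List.mem_range'_1] at hi
  rw [sieve_val _ _ hi.1 (by omega)]
  simp

theorem firstPrimes_bitOps_le {lo N : ℕ} (hN1 : 1 ≤ N) :
    (firstPrimes (n := n) lo N).cost.bitOps ≤ (sieveBound lo N + 1) *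
      (3 * (sieveBound lo N).size + 20) * mulCost (sieveBound lo N).size := by
  have h0 := sieve_bitOps_le (n := n) (sieveBound lo N)
  have h1 := succ_le_mulCost (sieveBound lo N).size
  have hz : 1 ≤ (lo + N).size := Nat.size_pos.2 (by omega)
  have hKb : lo + N ≤ sieveBound lo N := by unfold sieveBound; nlinarith
  have hyb : (lo + N) * (lo + N).size ≤ sieveBound lo N := by unfold sieveBound; omega
  have hzb : (lo + N).size ≤ sieveBound lo N := (size_le_self _).trans hKb
  have h16 : 16 ≤ sieveBound lo N := by unfold sieveBound; nlinarith
  have hlo : lo ≤ sieveBound lo N := by omega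
  have hN : N ≤ sieveBound lo N := by omega
  have m1 : mulBits (lo + N) (lo + N).size ≤ mulCost (sieveBound lo N).size :=
    mulBits_le (Nat.size_le_size hKb) (Nat.size_le_size hzb)
  have m2 : mulBits 16 ((lo + N) * (lo + N).size) ≤ mulCost (sieveBound lo N).size :=
    mulBits_le (Nat.size_le_size h16) (Nat.size_le_size hyb)
  have hf : (Timed.filter (n := n) (fun i => (natLe lo i).bind fun b =>
      (readCell (sieve (n := n) (sieveBound lo N)).val i).bind fun c =>
      Timed.pure (b && !c)) (List.range' 2 (sieveBound lo N - 1))).cost.bitOps ≤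
      (sieveBound lo N - 1) * (3 * mulCost (sieveBound lo N).size + 1) + 1 := by
    refine (Timed.filter_bitOps_le (c := 3 * mulCost (sieveBound lo N).size) ?_).trans (by simp)
    intro i hi
    simp only [List.mem_range'_1] at hi
    have := Nat.size_le_size (show i ≤ sieveBound lo N by omega)
    have := Nat.size_le_size hlo
    simp
    omega
  have s1 := Nat.size_le_size hlo
  have s2 := Nat.size_le_size hN
  have s3 := Nat.size_le_size hKb
  simp only [firstPrimes, natAdd, natSize, natMul, Timed.bind_cost, Timed.bits_val,
    Cost.add_bitOps, Timed.bits_bitOps]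
  change _ + (_ + (_ + (_ + ((sieve (sieveBound lo N)).cost.bitOps + (_ + _))))) ≤ _
  have hf' := hf
  rw [show sieveBound lo N = 16 * ((lo + N) * (lo + N).size) from rfl] at hf'
  generalize (sieve (n := n) (16 * ((lo + N) * (lo + N).size))).val = A at *
  have e2 : (sieveBound lo N - 1) * (3 * mulCost (sieveBound lo N).size + 1) + 1 ≤
      (sieveBound lo N + 1) * (4 * mulCost (sieveBound lo N).size) := by
    have : sieveBound lo N - 1 ≤ sieveBound lo N := by omega
    nlinarith
  have e3 : sieveBound lo N + 1 ≤ (sieveBound lo N + 1) * mulCost (sieveBound lo N).size :=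
    Nat.le_mul_of_pos_right _ (by omega)
  have e4 : (sieveBound lo N + 1) * (3 * (sieveBound lo N).size + 20) * mulCost (sieveBound lo N).size
     = (sieveBound lo N + 1) * (3 * (sieveBound lo N).size + 8) * mulCost (sieveBound lo N).size
     + (sieveBound lo N + 1) * (4 * mulCost (sieveBound lo N).size)
     + 8 * ((sieveBound lo N + 1) * mulCost (sieveBound lo N).size) := by ring
  have e5 : 17 * mulCost (sieveBound lo N).size ≤
      (sieveBound lo N + 1) * mulCost (sieveBound lo N).size := by gcongr; omega
  rw [show 16 * ((lo + N) * (lo + N).size) = sieveBound lo N from rfl] at *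
  omega

@[simp] theorem firstPrimes_ringOps (lo N : ℕ) :
    (firstPrimes (n := n) lo N).cost.ringOps = 0 := by
  have : ∀ (A : ℕ → Bool) L, (Timed.filter (n := n) (fun i => (natLe lo i).bind fun b =>
      (readCell A i).bind fun c => Timed.pure (b && !c)) L).cost.ringOps = L.length * 0 :=
    fun A L => Timed.filter_ringOps_eq (by simp) L
  simp only [firstPrimes, Timed.bind_cost, Cost.add_ringOps, this]
  simp

@[simp] theorem firstPrimes_queries (lo N : ℕ) :
    (firstPrimes (n := n) lo N).cost.queries = [] := by
  have : ∀ (A : ℕ → Bool) L, (Timed.filter (n := n) (fun i => (natLe lo i).bind fun b =>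
      (readCell A i).bind fun c => Timed.pure (b && !c)) L).cost.queries = [] :=
    fun A L => Timed.filter_queries_eq_nil (by simp) L
  simp only [firstPrimes, Timed.bind_cost, Cost.add_queries, this]
  simp

open Nat.Prime in
/-- A weak form of Chebyshev's lower bound: there are enough primes for the sieve. -/
theorem le_primeCounting (K : ℕ) (hK : 1 ≤ K) :
    K ≤ Nat.primeCounting (16 * (K * K.size)) := by
  have hz : 1 ≤ K.size := Nat.size_pos.2 hK
  set z := K.size with hz'
  have hKz : K < 2 ^ z := Nat.lt_size_self K
  set x := 16 * (K * z) with hx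
  have hx16 : 16 ≤ x := by nlinarith
  -- For z ≥ 2 the factor 16 and the slack fit into three further powers 2^z; for z = 1 the only
  -- value is K = 1, where 17 ≤ 32.
  have hx2 : x + 1 ≤ 2 ^ (5 * z) := by
    have h1 : z < 2 ^ z := Nat.lt_two_pow_self
    have h2 : 2 ^ (5 * z) = 2 ^ z * 2 ^ z * (2 ^ z * 2 ^ z * 2 ^ z) := by ring
    have h3 : 2 ≤ 2 ^ z := by
      calc 2 = 2 ^ 1 := rfl
        _ ≤ _ := Nat.pow_le_pow_right two_pos hz
    rcases Nat.lt_or_ge z 2 with h | h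
    · have hz1 : z = 1 := by omega
      rw [hz1] at hKz hx ⊢
      have : K = 1 := by omega
      subst this
      rw [hx]; norm_num
    · have h4 : 4 ≤ 2 ^ z := by
        calc 4 = 2 ^ 2 := rfl
          _ ≤ _ := Nat.pow_le_pow_right two_pos h
      have h5 : K * z + 1 ≤ 2 ^ z * 2 ^ z := by nlinarith
      have h6 : 64 ≤ 2 ^ z * 2 ^ z * 2 ^ z := by nlinarith [Nat.mul_le_mul h4 h4]
      rw [h2]
      nlinarith
  have h := Chebyshev.pi_ge x
  have hl2 : 0 < Real.log 2 := Real.log_pos one_lt_two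
  have hlx : 0 < Real.log x := Real.log_pos (by exact_mod_cast (by omega : 1 < x))
  have hlog : Real.log (x + 1) ≤ 5 * z * Real.log 2 := by
    have : ((x : ℝ) + 1) ≤ 2 ^ (5 * z) := by exact_mod_cast hx2
    calc Real.log (x + 1) ≤ Real.log (2 ^ (5 * z)) := Real.log_le_log (by positivity) this
      _ = 5 * z * Real.log 2 := by rw [Real.log_pow]; push_cast; ring
  have hlog' : Real.log x ≤ 5 * z * Real.log 2 :=
    (Real.log_le_log (by positivity) (by linarith)).trans hlog
  -- With x = 16Kz both logarithms are at most 5z log 2, so the claim reduces to 5Kz + 5z ≤ 16Kz,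
  -- which holds because K ≥ 1.
  have h' : (K : ℝ) ≤ (x * Real.log 2 - Real.log (x + 1)) / Real.log x := by
    rw [le_div_iff₀ hlx]
    have hxr : (x : ℝ) = 16 * (K * z) := by rw [hx]; push_cast; ring
    have hK1 : (1 : ℝ) ≤ K := by exact_mod_cast hK
    have hz1 : (1 : ℝ) ≤ z := by exact_mod_cast hz
    have e1 : (K : ℝ) * Real.log x ≤ K * (5 * z * Real.log 2) := by gcongr
    have e2 : 5 * z * Real.log 2 ≤ K * (5 * z * Real.log 2) :=
      le_mul_of_one_le_left (by positivity) hK1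
    have e3 : (0 : ℝ) ≤ K * z * Real.log 2 := by positivity
    rw [hxr] at e1 hlog ⊢
    nlinarith
  exact_mod_cast h'.trans h

/-- There are at least lo + N primes up to the limit of the sieve, and fewer than lo + 1 of them can
lie below lo. -/
theorem firstPrimes_length {lo N : ℕ} (hN : 1 ≤ N) :
    (firstPrimes (n := n) lo N).val.length = N := by
  rw [firstPrimes_val, List.length_take, min_eq_left]
  set B := sieveBound lo N
  have h := le_primeCounting (lo + N) (by omega)
  rw [show 16 * ((lo + N) * (lo + N).size) = B from rfl] at h
  have hnd : ((List.range' 2 (B - 1)).filter fun i => decide (lo ≤ i ∧ i.Prime)).Nodup :=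
    (List.nodup_range' (step := 1)).filter _
  rw [← List.toFinset_card_of_nodup hnd]
  have hsub : (Finset.range (B + 1)).filter Nat.Prime ⊆ Finset.range lo ∪
      ((List.range' 2 (B - 1)).filter fun i => decide (lo ≤ i ∧ i.Prime)).toFinset := by
    intro q hq
    rw [Finset.mem_filter, Finset.mem_range] at hq
    have := hq.2.two_le
    rw [Finset.mem_union, Finset.mem_range, List.mem_toFinset, List.mem_filter, List.mem_range'_1]
    by_cases hlo : q < lo
    · exact Or.inl hlo
    · refine Or.inr ⟨by omega, ?_⟩
      simp [hq.2, not_lt.1 hlo]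
  have h1 := (Finset.card_le_card hsub).trans (Finset.card_union_le _ _)
  rw [Finset.card_range] at h1
  have h2 : Nat.primeCounting B = ((Finset.range (B + 1)).filter Nat.Prime).card := by
    rw [Nat.primeCounting, Nat.primeCounting', Nat.count_eq_card_filter_range]
  omega

theorem firstPrimes_mem {lo N p : ℕ} (hp : p ∈ (firstPrimes (n := n) lo N).val) :
    p.Prime ∧ lo ≤ p ∧ p ≤ sieveBound lo N := by
  rw [firstPrimes_val] at hp
  have := List.mem_of_mem_take hp
  rw [List.mem_filter, List.mem_range'_1] at this
  have h2 := of_decide_eq_true this.2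
  exact ⟨h2.2, h2.1, by omega⟩

theorem firstPrimes_nodup (lo N : ℕ) : (firstPrimes (n := n) lo N).val.Nodup := by
  rw [firstPrimes_val]
  exact ((List.nodup_range' (step := 1)).filter _).sublist (List.take_sublist _ _)

end Sieve


/-! ## Substitutions -/

/-- A bound for the integers that are computed from `n` pairs of integers up to `M`. -/
def capacity (n M : ℕ) : ℕ := (n + 1) * (M + 1) ^ 2

/-- The cost of one operation with integers up to `capacity n M`. -/
def unitCost (n M : ℕ) : ℕ := mulCost (capacity n M).size

section Capacity

variable {n M : ℕ}

theorem size_succ_le_unitCost {x : ℕ} (h : x ≤ capacity n M) : x.size + 1 ≤ unitCost n M :=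
  (Nat.succ_le_succ (Nat.size_le_size h)).trans (succ_le_mulCost _)

theorem mulBits_le_unitCost {x y : ℕ} (hx : x ≤ capacity n M) (hy : y ≤ capacity n M) :
    mulBits x y ≤ unitCost n M :=
  mulBits_le (Nat.size_le_size hx) (Nat.size_le_size hy)

theorem le_capacity {x : ℕ} (h : x ≤ M) : x ≤ capacity n M := by
  unfold capacity; nlinarith [Nat.zero_le (n * (M + 1) ^ 2)]

theorem mul_le_capacity {x y : ℕ} (h : x ≤ M) (hy : y ≤ M) : x * y ≤ capacity n M := by
  unfold capacity; nlinarith [Nat.mul_le_mul h hy, Nat.zero_le (n * (M + 1) ^ 2)]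

theorem mul_add_le_capacity {x y z : ℕ} (h : x ≤ M) (hy : y ≤ M) (hz : z ≤ M) :
    z + x * y ≤ capacity n M := by
  unfold capacity; nlinarith [Nat.mul_le_mul h hy, Nat.zero_le (n * (M + 1) ^ 2)]

theorem sum_mul_le_capacity {e s : Fin n → ℕ} (he : ∀ k, e k ≤ M) (hs : ∀ k, s k ≤ M) :
    ∑ k, e k * s k ≤ capacity n M := by
  have : ∑ k, e k * s k ≤ ∑ _k : Fin n, M * M :=
    Finset.sum_le_sum fun k _ => Nat.mul_le_mul (he k) (hs k)
  simp at this
  unfold capacity; nlinarith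

theorem sum_le_capacity {e : Fin n → ℕ} (he : ∀ k, e k ≤ M) : ∑ k, e k ≤ capacity n M := by
  have : ∑ k, e k ≤ ∑ _k : Fin n, M := Finset.sum_le_sum fun k _ => he k
  simp at this
  unfold capacity; nlinarith [Nat.zero_le (n * M ^ 2)]

end Capacity

/-! ### Loops over the coordinates of exponent vectors. -/

section Vectors

variable {n : ℕ}

@[simp] theorem dot_val (e s : Fin n → ℕ) : (dot e s).val = ∑ k, e k * s k := by
  simp only [dot, Timed.foldl_val, natMul, natAdd, Timed.bind_val, Timed.bits_val]
  rw [Fin.sum_univ_def, List.sum_eq_foldl, List.foldl_map]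

@[simp] theorem sumVector_val (e : Fin n → ℕ) : (sumVector e).val = ∑ k, e k := by
  simp only [sumVector, Timed.foldl_val, natAdd, Timed.bits_val]
  rw [Fin.sum_univ_def, List.sum_eq_foldl, List.foldl_map]

theorem le_foldl_max {α : Type*} (e : α → ℕ) (L : List α) (d : ℕ) :
    d ≤ L.foldl (fun d k => max d (e k)) d ∧ ∀ k ∈ L, e k ≤ L.foldl (fun d k => max d (e k)) d := by
  induction L generalizing d with
  | nil => simp
  | cons a L ih =>
    obtain ⟨h1, h2⟩ := ih (max d (e a))
    simp only [List.foldl_cons, List.mem_cons]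
    refine ⟨(le_max_left _ _).trans h1, ?_⟩
    rintro k (rfl | hk)
    exacts [(le_max_right _ _).trans h1, h2 k hk]

theorem foldl_max_le {α : Type*} {e : α → ℕ} {M : ℕ} (he : ∀ k, e k ≤ M) (L : List α) {d : ℕ}
    (hd : d ≤ M) : L.foldl (fun d k => max d (e k)) d ≤ M := by
  induction L generalizing d with
  | nil => simpa
  | cons a L ih => exact ih (max_le hd (he a))

theorem le_maxVector (e : Fin n → ℕ) (k : Fin n) : e k ≤ (maxVector e).val := by
  simp only [maxVector, Timed.foldl_val, natMax, Timed.bits_val]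
  exact (le_foldl_max e _ 0).2 k (List.mem_finRange k)

theorem maxVector_le {e : Fin n → ℕ} {M : ℕ} (he : ∀ k, e k ≤ M) : (maxVector e).val ≤ M := by
  simp only [maxVector, Timed.foldl_val, natMax, Timed.bits_val]
  exact foldl_max_le he _ (Nat.zero_le _)

@[simp] theorem dot_ringOps (e s : Fin n → ℕ) : (dot e s).cost.ringOps = 0 := by
  simpa [dot] using Timed.foldl_ringOps_eq (n := n) (c := 0)
    (f := fun d k => (natMul (e k) (s k)).bind fun m => natAdd d m) (by simp) (List.finRange n) 0

@[simp] theorem dot_queries (e s : Fin n → ℕ) : (dot e s).cost.queries = [] := by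
  simpa [dot] using Timed.foldl_queries_eq_nil (n := n)
    (f := fun d k => (natMul (e k) (s k)).bind fun m => natAdd d m) (by simp) (List.finRange n) 0

@[simp] theorem sumVector_ringOps (e : Fin n → ℕ) : (sumVector e).cost.ringOps = 0 := by
  simpa [sumVector] using Timed.foldl_ringOps_eq (n := n) (c := 0)
    (f := fun d k => natAdd d (e k)) (by simp) (List.finRange n) 0

@[simp] theorem sumVector_queries (e : Fin n → ℕ) : (sumVector e).cost.queries = [] := by
  simpa [sumVector] using Timed.foldl_queries_eq_nil (n := n)
    (f := fun d k => natAdd d (e k)) (by simp) (List.finRange n) 0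

@[simp] theorem maxVector_ringOps (e : Fin n → ℕ) : (maxVector e).cost.ringOps = 0 := by
  simpa [maxVector] using Timed.foldl_ringOps_eq (n := n) (c := 0)
    (f := fun d k => natMax d (e k)) (by simp) (List.finRange n) 0

@[simp] theorem maxVector_queries (e : Fin n → ℕ) : (maxVector e).cost.queries = [] := by
  simpa [maxVector] using Timed.foldl_queries_eq_nil (n := n)
    (f := fun d k => natMax d (e k)) (by simp) (List.finRange n) 0

theorem dot_bitOps_le {M : ℕ} {e s : Fin n → ℕ} (he : ∀ k, e k ≤ M) (hs : ∀ k, s k ≤ M) :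
    (dot e s).cost.bitOps ≤ (n + 1) * (4 * unitCost n M) := by
  have hpos : 1 ≤ unitCost n M :=
      (Nat.le_add_left _ _).trans (size_succ_le_unitCost (x := 0) (Nat.zero_le _))
  have := Timed.foldl_bitOps_le (n := n) (c := 3 * unitCost n M)
    (f := fun d k => (natMul (e k) (s k)).bind fun m => natAdd d m)
    -- The invariant adds the summands still to come to the partial sum, so that the size of every
    -- intermediate value is controlled by the final sum.
    (fun L d => d + (L.map fun k => e k * s k).sum ≤ capacity n M) (by
      intro k L d h
      simp only [List.map_cons, List.sum_cons] at h
      refine ⟨?_, ?_⟩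
      · have h1 := mulBits_le_unitCost (n := n) (le_capacity (he k)) (le_capacity (hs k))
        have h2 := size_succ_le_unitCost (n := n) (M := M) (x := d) (by omega)
        have h3 := size_succ_le_unitCost (n := n) (M := M) (x := e k * s k) (by omega)
        simp
        omega
      · simp only [natMul, natAdd, Timed.bind_val, Timed.bits_val]
        omega) (List.finRange n) 0 (by
      rw [zero_add, ← Fin.sum_univ_def]
      exact sum_mul_le_capacity he hs)
  rw [List.length_finRange] at this
  refine this.trans ?_
  nlinarith

theorem sumVector_bitOps_le {M : ℕ} {e : Fin n → ℕ} (he : ∀ k, e k ≤ M) :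
    (sumVector e).cost.bitOps ≤ (n + 1) * (4 * unitCost n M) := by
  have hpos : 1 ≤ unitCost n M :=
      (Nat.le_add_left _ _).trans (size_succ_le_unitCost (x := 0) (Nat.zero_le _))
  have := Timed.foldl_bitOps_le (n := n) (c := 3 * unitCost n M)
    (f := fun d k => natAdd d (e k))
    (fun L d => d + (L.map fun k => e k).sum ≤ capacity n M) (by
      intro k L d h
      simp only [List.map_cons, List.sum_cons] at h
      refine ⟨?_, ?_⟩
      · have h2 := size_succ_le_unitCost (n := n) (M := M) (x := d) (by omega)
        have h3 := size_succ_le_unitCost (n := n) (M := M) (x := e k) (by omega)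
        simp
        omega
      · simp only [natAdd, Timed.bits_val]
        omega) (List.finRange n) 0 (by
      rw [zero_add, ← Fin.sum_univ_def]
      exact sum_le_capacity he)
  rw [List.length_finRange] at this
  refine this.trans ?_
  nlinarith

theorem maxVector_bitOps_le {M : ℕ} {e : Fin n → ℕ} (he : ∀ k, e k ≤ M) :
    (maxVector e).cost.bitOps ≤ (n + 1) * (4 * unitCost n M) := by
  have hpos : 1 ≤ unitCost n M :=
      (Nat.le_add_left _ _).trans (size_succ_le_unitCost (x := 0) (Nat.zero_le _))
  have := Timed.foldl_bitOps_le (n := n) (c := 3 * unitCost n M)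
    (f := fun d k => natMax d (e k)) (fun _ d => d ≤ M) (by
      intro k L d h
      refine ⟨?_, max_le h (he k)⟩
      have h2 := size_succ_le_unitCost (n := n) (M := M) (x := d) (le_capacity h)
      have h3 := size_succ_le_unitCost (n := n) (M := M) (x := e k) (le_capacity (he k))
      simp
      omega) (List.finRange n) 0 (Nat.zero_le _)
  rw [List.length_finRange] at this
  refine this.trans ?_
  nlinarith

end Vectors

/-! ### Substitutions and reduction modulo x^p - 1, as maps on exponents. -/

section Substitute

variable {n : ℕ} {R : Type u} [CommRing R]

/-- Substituting powers of x relabels exponents and adds coefficients that meet, which is exactly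
`Finsupp.mapDomain`. All univariate images are handled in this form. -/
theorem substitute_represents (g : List ((Fin n → ℕ) × R)) (s : Fin n → ℕ) :
    Represents (substitute g s).val ((value g).mapDomain fun e => ∑ k, e k * s k) := by
  rw [← value_map_key]
  simpa [substitute] using normalize_represents (n := n) (g.map fun t => (∑ k, t.1 k * s k, t.2))

theorem substitute_length_le (g : List ((Fin n → ℕ) × R)) (s : Fin n → ℕ) :
    (substitute g s).val.length ≤ g.length := by
  simpa [substitute] using normalize_length_le (n := n) (g.map fun t => (∑ k, t.1 k * s k, t.2))

theorem substitute_mem (g : List ((Fin n → ℕ) × R)) (s : Fin n → ℕ) (t : ℕ × R)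
    (ht : t ∈ (substitute g s).val) : ∃ t' ∈ g, ∑ k, t'.1 k * s k = t.1 := by
  have h := substitute_represents g s
  rw [← value_map_key] at h
  obtain ⟨x, hx, e⟩ := h.exists_mem t ht
  obtain ⟨y, hy, rfl⟩ := List.mem_map.1 hx
  exact ⟨y, hy, e⟩

theorem substitute_bitOps_le {M : ℕ} (g : List ((Fin n → ℕ) × R)) {s : Fin n → ℕ}
    (hg : ∀ t ∈ g, ∀ k, t.1 k ≤ M) (hs : ∀ k, s k ≤ M) :
    (substitute g s).cost.bitOps ≤
      (n + 1) * (g.length + 1) * (g.length.size + 1) * (40 * unitCost n M) := by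
  have h1 : (Timed.traverse (n := n) (fun t : (Fin n → ℕ) × R =>
      (dot t.1 s).bind fun d => Timed.pure (d, t.2)) g).cost.bitOps ≤
      g.length * ((n + 1) * (4 * unitCost n M) + 1) + 1 :=
    Timed.traverse_bitOps_le fun t ht => by simpa using dot_bitOps_le (hg t ht) hs
  have hb := size_succ_le_unitCost (n := n) (M := M) (x := capacity n M) le_rfl
  have h2 := normalize_bitOps_le (n := n) (K := (capacity n M).size)
    (g.map fun t => (∑ k, t.1 k * s k, t.2)) (by
      intro t ht
      obtain ⟨y, hy, rfl⟩ := List.mem_map.1 ht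
      exact Nat.size_le_size (sum_mul_le_capacity (hg y hy) hs))
  simp only [List.length_map] at h2
  simp only [substitute, Timed.bind_cost, Cost.add_bitOps, Timed.traverse_val, Timed.bind_val,
    dot_val, Timed.pure_val]
  generalize unitCost n M = w at *
  generalize g.length.size = z at *
  generalize g.length = m at *
  have e0 : m * ((n + 1) * (4 * w) + 1) + 1 ≤ (m + 1) * ((n + 1) * (5 * w)) := by
    have : 1 ≤ (n + 1) * w := by nlinarith
    nlinarith
  have e1 : (m + 1) * (z + 1) * (4 * (capacity n M).size + 32) ≤ (m + 1) * (z + 1) * (32 * w) := by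
    gcongr; omega
  have e2 : (m + 1) * ((n + 1) * (5 * w)) ≤ (n + 1) * (m + 1) * (z + 1) * (5 * w) := by
    have : (m + 1) * ((n + 1) * (5 * w)) = (n + 1) * (m + 1) * 1 * (5 * w) := by ring
    rw [this]; gcongr; omega
  have e3 : (m + 1) * (z + 1) * (32 * w) ≤ (n + 1) * (m + 1) * (z + 1) * (32 * w) := by
    gcongr ?_ * _ * _
    exact Nat.le_mul_of_pos_left _ (by omega)
  nlinarith

theorem substitute_ringOps_le (g : List ((Fin n → ℕ) × R)) (s : Fin n → ℕ) :
    (substitute g s).cost.ringOps ≤ 2 * g.length := by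
  simpa [substitute] using normalize_ringOps_le (n := n) (g.map fun t => (∑ k, t.1 k * s k, t.2))

@[simp] theorem substitute_queries (g : List ((Fin n → ℕ) × R)) (s : Fin n → ℕ) :
    (substitute g s).cost.queries = [] := by simp [substitute]

theorem reduceMod_represents (p : ℕ) (F : List (ℕ × R)) :
    Represents (reduceMod (n := n) p F).val ((value F).mapDomain fun d => d % p) := by
  rw [← value_map_key]
  simpa [reduceMod] using normalize_represents (n := n) (F.map fun t => (t.1 % p, t.2))

theorem reduceMod_length_le (p : ℕ) (F : List (ℕ × R)) :
    (reduceMod (n := n) p F).val.length ≤ F.length := by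
  simpa [reduceMod] using normalize_length_le (n := n) (F.map fun t => (t.1 % p, t.2))

theorem reduceMod_mem (p : ℕ) (F : List (ℕ × R)) (t : ℕ × R)
    (ht : t ∈ (reduceMod (n := n) p F).val) : ∃ t' ∈ F, t'.1 % p = t.1 := by
  have h := reduceMod_represents (n := n) p F
  rw [← value_map_key] at h
  obtain ⟨x, hx, e⟩ := h.exists_mem t ht
  obtain ⟨y, hy, rfl⟩ := List.mem_map.1 hx
  exact ⟨y, hy, e⟩

theorem reduceMod_bitOps_le {M p : ℕ} (F : List (ℕ × R)) (hp : p ≤ M) (hF : ∀ t ∈ F, t.1 ≤ M) :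
    (reduceMod (n := n) p F).cost.bitOps ≤
      (F.length + 1) * (F.length.size + 1) * (40 * unitCost n M) := by
  have h1 : (Timed.traverse (n := n) (fun t : ℕ × R =>
      (natMod t.1 p).bind fun d => Timed.pure (d, t.2)) F).cost.bitOps ≤
      F.length * (unitCost n M + 1) + 1 :=
    Timed.traverse_bitOps_le fun t ht => by
      simpa using mulBits_le_unitCost (le_capacity (hF t ht)) (le_capacity hp)
  have hb := size_succ_le_unitCost (n := n) (M := M) (x := capacity n M) le_rfl
  have h2 := normalize_bitOps_le (n := n) (K := (capacity n M).size)
    (F.map fun t => (t.1 % p, t.2)) (by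
      intro t ht
      obtain ⟨y, hy, rfl⟩ := List.mem_map.1 ht
      exact Nat.size_le_size (le_capacity ((Nat.mod_le _ _).trans (hF y hy))))
  simp only [List.length_map] at h2
  simp only [reduceMod, Timed.bind_cost, Cost.add_bitOps, Timed.traverse_val, Timed.bind_val,
    natMod, Timed.pure_val, Timed.bits_val] at h1 ⊢
  generalize unitCost n M = w at *
  generalize F.length.size = z at *
  generalize F.length = m at *
  have e1 : (m + 1) * (z + 1) * (4 * (capacity n M).size + 32) ≤ (m + 1) * (z + 1) * (32 * w) := by
    gcongr; omega
  have e2 : (m + 1) * (2 * w) ≤ (m + 1) * (z + 1) * (2 * w) := by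
    have : (m + 1) * (2 * w) = (m + 1) * 1 * (2 * w) := by ring
    rw [this]; gcongr; omega
  nlinarith

theorem reduceMod_ringOps_le (p : ℕ) (F : List (ℕ × R)) :
    (reduceMod (n := n) p F).cost.ringOps ≤ 2 * F.length := by
  simpa [reduceMod] using normalize_ringOps_le (n := n) (F.map fun t => (t.1 % p, t.2))

@[simp] theorem reduceMod_queries (p : ℕ) (F : List (ℕ × R)) :
    (reduceMod (n := n) p F).cost.queries = [] := by simp [reduceMod]

theorem polySubs_val (g : List ((Fin n → ℕ) × R)) (s : Fin n → ℕ) (p : ℕ) (k : Fin n) :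
    (polySubs g s p).val k =
      (normalize (n := n) (g.map fun t => (∑ j, t.1 j * s j + t.1 k * p, t.2))).val := by
  simp [polySubs, Function.comp_def]

theorem polySubs_represents (g : List ((Fin n → ℕ) × R)) (s : Fin n → ℕ) (p : ℕ) (k : Fin n) :
    Represents ((polySubs g s p).val k)
      ((value g).mapDomain fun e => ∑ j, e j * s j + e k * p) := by
  rw [← value_map_key, polySubs_val]
  exact normalize_represents _

theorem polySubs_length_le (g : List ((Fin n → ℕ) × R)) (s : Fin n → ℕ) (p : ℕ) (k : Fin n) :
    ((polySubs g s p).val k).length ≤ g.length := by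
  rw [polySubs_val]
  refine (normalize_length_le _).trans (by simp)

theorem polySubs_mem (g : List ((Fin n → ℕ) × R)) (s : Fin n → ℕ) (p : ℕ) (k : Fin n) (t : ℕ × R)
    (ht : t ∈ (polySubs g s p).val k) : ∃ t' ∈ g, ∑ j, t'.1 j * s j + t'.1 k * p = t.1 := by
  have h := polySubs_represents g s p k
  rw [← value_map_key] at h
  obtain ⟨x, hx, e⟩ := h.exists_mem t ht
  obtain ⟨y, hy, rfl⟩ := List.mem_map.1 hx
  exact ⟨y, hy, e⟩

/-- The products e·s are computed once and shared; each of the n shifted images then needs only one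
multiplication and one addition per term before sorting. This keeps the cost linear in n. -/
theorem polySubs_bitOps_le {M p : ℕ} (g : List ((Fin n → ℕ) × R)) {s : Fin n → ℕ}
    (hg : ∀ t ∈ g, ∀ k, t.1 k ≤ M) (hs : ∀ k, s k ≤ M) (hp : p ≤ M)
    (hsum : ∀ t ∈ g, ∑ j, t.1 j * s j ≤ M) :
    (polySubs g s p).cost.bitOps ≤
      (n + 1) * (g.length + 1) * (g.length.size + 1) * (50 * unitCost n M) := by
  have h1 : (Timed.traverse (n := n) (fun t : (Fin n → ℕ) × R =>
      (dot t.1 s).bind fun d => Timed.pure (d, t.1, t.2)) g).cost.bitOps ≤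
      g.length * ((n + 1) * (4 * unitCost n M) + 1) + 1 :=
    Timed.traverse_bitOps_le fun t ht => by simpa using dot_bitOps_le (hg t ht) hs
  have hb := size_succ_le_unitCost (n := n) (M := M) (x := capacity n M) le_rfl
  have h2 (k : Fin n) := normalize_bitOps_le (n := n) (K := (capacity n M).size)
    (g.map fun t => (∑ j, t.1 j * s j + t.1 k * p, t.2)) (by
      intro t ht
      obtain ⟨y, hy, rfl⟩ := List.mem_map.1 ht
      exact Nat.size_le_size (mul_add_le_capacity (hg y hy k) hp (hsum y hy)))
  have h3 (k : Fin n) : (Timed.traverse (n := n) (fun t : ℕ × (Fin n → ℕ) × R =>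
      (natMul (t.2.1 k) p).bind fun m => (natAdd t.1 m).bind fun d =>
      Timed.pure (d, t.2.2)) (g.map fun t => (∑ j, t.1 j * s j, t.1, t.2))).cost.bitOps ≤
      g.length * (3 * unitCost n M + 1) + 1 := by
    refine (Timed.traverse_bitOps_le (c := 3 * unitCost n M) ?_).trans (by simp)
    intro t ht
    obtain ⟨y, hy, rfl⟩ := List.mem_map.1 ht
    have e1 := mulBits_le_unitCost (n := n) (le_capacity (hg y hy k)) (le_capacity hp)
    have e2 := size_succ_le_unitCost (n := n) (le_capacity (hsum y hy))
    have e3 := size_succ_le_unitCost (n := n) (mul_le_capacity (n := n) (hg y hy k) hp)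
    simp
    omega
  simp only [List.length_map] at h2
  have h4 : (polySubs g s p).cost.bitOps ≤ g.length * ((n + 1) * (4 * unitCost n M) + 1) + 1 +
      (n * ((g.length * (3 * unitCost n M + 1) + 1 +
        (g.length + 1) * (g.length.size + 1) * (4 * (capacity n M).size + 32)) + 1) + 1) := by
    simp only [polySubs, Timed.bind_cost, Cost.add_bitOps, Timed.traverse_val, Timed.bind_val,
      dot_val, Timed.pure_val]
    refine Nat.add_le_add h1 (Timed.tabulate_bitOps_le fun k => ?_)
    refine Nat.add_le_add (h3 k) ?_
    have := h2 k
    simpa [Function.comp_def] using this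
  refine h4.trans ?_
  generalize unitCost n M = w at *
  generalize g.length.size = z at *
  generalize g.length = m at *
  have e1 : (m + 1) * (z + 1) * (4 * (capacity n M).size + 32) ≤ (m + 1) * (z + 1) * (32 * w) := by
    gcongr; omega
  have hw : 1 ≤ w := by omega
  have e2 : m + 1 ≤ (m + 1) * (z + 1) := by nlinarith
  set q := (m + 1) * (z + 1) with hq
  have e3 : m * w ≤ q * w := by gcongr; omega
  have e4 : m ≤ q * w := by nlinarith
  have e5 : 1 ≤ q * w := by nlinarith
  have e6 : m * (3 * w + 1) + 1 + q * (32 * w) + 1 ≤ 38 * (q * w) := by nlinarith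
  have e7 : m * ((n + 1) * (4 * w) + 1) + 1 ≤ (n + 1) * (6 * (q * w)) := by nlinarith
  calc _ ≤ (n + 1) * (6 * (q * w)) + (n * (38 * (q * w)) + 1) := by
        gcongr
        omega
    _ ≤ (n + 1) * (50 * (q * w)) := by nlinarith
    _ = _ := by rw [hq]; ring

theorem polySubs_ringOps_le (g : List ((Fin n → ℕ) × R)) (s : Fin n → ℕ) (p : ℕ) :
    (polySubs g s p).cost.ringOps ≤ n * (2 * g.length) := by
  simp only [polySubs, Timed.bind_cost, Cost.add_ringOps, Timed.traverse_val, Timed.bind_val,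
    dot_val, Timed.pure_val]
  refine le_trans (b := 0 + n * (2 * g.length)) ?_ (by simp)
  refine Nat.add_le_add (by simp) (Timed.tabulate_ringOps_le fun k => ?_)
  have := normalize_ringOps_le (n := n) (g.map fun t => (∑ j, t.1 j * s j + t.1 k * p, t.2))
  simpa [Function.comp_def] using this

@[simp] theorem polySubs_queries (g : List ((Fin n → ℕ) × R)) (s : Fin n → ℕ) (p : ℕ) :
    (polySubs g s p).cost.queries = [] := by
  simp only [polySubs, Timed.bind_cost, Cost.add_queries]
  rw [Timed.tabulate_queries_eq_nil (by simp)]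
  simp

end Substitute


/-! ## Tables of residues -/

section Table

variable {n : ℕ} {R : Type u}

/-- The cell that describes a list of exponents. -/
def Cell.ofList : List ℕ → Cell
  | [] => Cell.none
  | [d] => Cell.one d
  | _ => Cell.many

theorem Cell.ofList_concat_of_ne_nil {L : List ℕ} (h : L ≠ []) (d : ℕ) :
    Cell.ofList (L ++ [d]) = Cell.many := by
  rcases L with _ | ⟨a, _ | ⟨b, L⟩⟩
  · exact absurd rfl h
  · rfl
  · rfl

theorem Cell.ofList_eq_none {L : List ℕ} (h : Cell.ofList L = Cell.none) : L = [] := by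
  rcases L with _ | ⟨a, _ | ⟨b, L⟩⟩
  · rfl
  · cases h
  · cases h

theorem Cell.ofList_eq_one {L : List ℕ} {d : ℕ} (h : Cell.ofList L = Cell.one d) : L = [d] := by
  rcases L with _ | ⟨a, _ | ⟨b, L⟩⟩
  · cases h
  · cases h; rfl
  · cases h

/-- One round of the loop in `residueTable`. -/
def tableStep (p : ℕ) (A : ℕ → Cell) (t : ℕ × R) : Timed n (ℕ → Cell) :=
  (natMod t.1 p).bind fun r => (readCell A r).bind fun c =>
    match c with
    | Cell.none => (Timed.bits t.1.size (Cell.one t.1)).bind fun c' => writeCell A r c'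
    | _ => writeCell A r Cell.many

theorem residueTable_eq (p : ℕ) (F : List (ℕ × R)) : residueTable (n := n) p F =
    (newArray p Cell.none).bind fun A => Timed.foldl (tableStep p) A F := rfl

theorem tableStep_val (p : ℕ) (A : ℕ → Cell) (t : ℕ × R) : (tableStep (n := n) p A t).val =
    Function.update A (t.1 % p) (match A (t.1 % p) with
      | Cell.none => Cell.one t.1
      | _ => Cell.many) := by
  simp only [tableStep, natMod, readCell, Timed.bind_val, Timed.bits_val]
  cases h : A (t.1 % p) <;> simp

/-- The cell of a class depends only on the exponents of that class seen so far. Induction appends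
terms on the right, in the order in which the loop meets them. -/
theorem residueTable_val (p : ℕ) (F : List (ℕ × R)) (r : ℕ) :
    (residueTable (n := n) p F).val r =
      Cell.ofList ((F.map Prod.fst).filter fun d => decide (d % p = r)) := by
  simp only [residueTable_eq, newArray, Timed.bind_val, Timed.bits_val, Timed.foldl_val]
  induction F using List.reverseRecOn generalizing r with
  | nil => rfl
  | append_singleton F t ih =>
    rw [List.foldl_concat, tableStep_val]
    by_cases hr : r = t.1 % p
    · subst hr
      rw [Function.update_self, ih]
      simp only [List.map_append, List.filter_append, List.map_cons, List.map_nil]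
      rw [List.filter_cons_of_pos (by simp), List.filter_nil]
      split
      · next h => rw [Cell.ofList_eq_none h]; rfl
      · next h =>
        rw [Cell.ofList_concat_of_ne_nil]
        intro h'
        rw [h'] at h
        exact h rfl
    · rw [Function.update_of_ne hr, ih]
      simp only [List.map_append, List.filter_append, List.map_cons, List.map_nil]
      rw [List.filter_cons_of_neg (by simpa using Ne.symm hr), List.filter_nil, List.append_nil]

theorem residueTable_eq_one {p : ℕ} {F : List (ℕ × R)} {r d : ℕ}
    (h : (residueTable (n := n) p F).val r = Cell.one d) : d ∈ F.map Prod.fst ∧ d % p = r := by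
  rw [residueTable_val] at h
  have h := Cell.ofList_eq_one h
  have : d ∈ (F.map Prod.fst).filter fun d => decide (d % p = r) := by rw [h]; simp
  rw [List.mem_filter] at this
  exact ⟨this.1, by simpa using this.2⟩

theorem residueTable_of_unique {p : ℕ} {F : List (ℕ × R)} {d : ℕ} (hF : (F.map Prod.fst).Nodup)
    (hd : d ∈ F.map Prod.fst) (h : ∀ d' ∈ F.map Prod.fst, d' % p = d % p → d' = d) :
    (residueTable (n := n) p F).val (d % p) = Cell.one d := by
  rw [residueTable_val]
  have : (F.map Prod.fst).filter (fun d' => decide (d' % p = d % p)) = [d] := by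
    rw [← List.perm_singleton, List.perm_ext_iff_of_nodup (hF.filter _) (by simp)]
    intro a
    rw [List.mem_filter, List.mem_singleton, decide_eq_true_eq]
    exact ⟨fun ⟨h1, h2⟩ => h a h1 h2, by rintro rfl; exact ⟨hd, rfl⟩⟩
  rw [this]; rfl

theorem tableStep_bitOps_le {M p : ℕ} (hp : p ≤ M) (A : ℕ → Cell) (t : ℕ × R) (ht : t.1 ≤ M) :
    (tableStep (n := n) p A t).cost.bitOps ≤ 4 * unitCost n M := by
  have h1 := mulBits_le_unitCost (n := n) (le_capacity ht) (le_capacity hp)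
  have h2 := size_succ_le_unitCost (n := n) (le_capacity ht)
  have h3 := size_succ_le_unitCost (n := n) (le_capacity ((Nat.mod_le t.1 p).trans ht))
  simp only [tableStep, natMod, readCell, Timed.bind_cost, Timed.bits_val]
  cases h : A (t.1 % p) <;> simp <;> omega

theorem residueTable_bitOps_le {M p : ℕ} (hp : p ≤ M) (F : List (ℕ × R)) (hF : ∀ t ∈ F, t.1 ≤ M) :
    (residueTable (n := n) p F).cost.bitOps ≤ p + 3 + F.length * (5 * unitCost n M) := by
  have h := Timed.foldl_bitOps_le' (n := n) (f := tableStep p) (L := F)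
    (fun t ht A => tableStep_bitOps_le hp A t (hF t ht)) (fun _ => Cell.none)
  have hpos : 1 ≤ unitCost n M :=
    (Nat.le_add_left _ _).trans (size_succ_le_unitCost (x := 0) (Nat.zero_le _))
  have : F.length * (4 * unitCost n M + 1) ≤ F.length * (5 * unitCost n M) := by gcongr; omega
  simp only [residueTable_eq, newArray, Timed.bind_cost, Timed.bits_val, Cost.add_bitOps,
    Timed.bits_bitOps]
  omega

@[simp] theorem tableStep_ringOps (p : ℕ) (A : ℕ → Cell) (t : ℕ × R) :
    (tableStep (n := n) p A t).cost.ringOps = 0 := by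
  simp only [tableStep, natMod, readCell, Timed.bind_cost, Timed.bits_val]
  cases h : A (t.1 % p) <;> simp

@[simp] theorem tableStep_queries (p : ℕ) (A : ℕ → Cell) (t : ℕ × R) :
    (tableStep (n := n) p A t).cost.queries = [] := by
  simp only [tableStep, natMod, readCell, Timed.bind_cost, Timed.bits_val]
  cases h : A (t.1 % p) <;> simp

@[simp] theorem residueTable_ringOps (p : ℕ) (F : List (ℕ × R)) :
    (residueTable (n := n) p F).cost.ringOps = 0 := by
  have := Timed.foldl_ringOps_eq (n := n) (c := 0) (f := tableStep (R := R) p) (by simp) F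
    (fun _ => Cell.none)
  simp [residueTable_eq, this]

@[simp] theorem residueTable_queries (p : ℕ) (F : List (ℕ × R)) :
    (residueTable (n := n) p F).cost.queries = [] := by
  have := Timed.foldl_queries_eq_nil (n := n) (f := tableStep (R := R) p) (by simp) F
    (fun _ => Cell.none)
  simp [residueTable_eq, this]

end Table

/-! ## Recovery of terms -/

section Recover

variable {n : ℕ} {R : Type u}

theorem exactQuotient_val (u b p : ℕ) : (exactQuotient (n := n) u b p).val =
    if u ≤ b ∧ (b - u) % p = 0 then some ((b - u) / p) else none := by
  change (if (decide (u ≤ b) && decide ((b - u) % p = 0)) = true then _ else _) = _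
  simp only [Bool.and_eq_true, decide_eq_true_eq]
  rfl

theorem exactQuotient_bitOps_le {u b p M : ℕ} (hu : u ≤ M) (hb : b ≤ M) (hp : p ≤ M) :
    (exactQuotient (n := n) u b p).cost.bitOps ≤ 8 * unitCost n M := by
  have h1 := size_succ_le_unitCost (n := n) (le_capacity hu)
  have h2 := size_succ_le_unitCost (n := n) (le_capacity hb)
  have h3 : b - u ≤ M := (Nat.sub_le _ _).trans hb
  have h4 := mulBits_le_unitCost (n := n) (le_capacity h3) (le_capacity hp)
  have h5 := size_succ_le_unitCost (n := n) (le_capacity ((Nat.mod_le (b - u) p).trans h3))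
  simp [exactQuotient]
  omega

@[simp] theorem exactQuotient_ringOps (u b p : ℕ) :
    (exactQuotient (n := n) u b p).cost.ringOps = 0 := by simp [exactQuotient]

@[simp] theorem exactQuotient_queries (u b p : ℕ) :
    (exactQuotient (n := n) u b p).cost.queries = [] := by simp [exactQuotient]

/-- The exponent `e_k` that is read off from the cell of `f(x^{s + p I_k})`. -/
def quotientCell (u p d : ℕ) (A : ℕ → Cell) : Timed n (Option ℕ) :=
  (readCell A d).bind fun c' =>
    match c' with
    | Cell.one b => exactQuotient u b p
    | _ => Timed.pure none

/-- The last steps of `recoverTerm`. -/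
def checkTerm (s : Fin n → ℕ) (D u : ℕ) (a : R) (q : Fin n → Option ℕ) :
    Timed n (Option ((Fin n → ℕ) × R)) :=
  if ∀ k, (q k).isSome then
    (Timed.bits (n + 1) fun k => (q k).getD 0).bind fun e =>
    (dot e s).bind fun u' => (natEq u u').bind fun okSum =>
    (sumVector e).bind fun deg => (natLe deg D).bind fun okDeg =>
    Timed.pure (if okSum && okDeg then some (e, a) else none)
  else Timed.bits (n + 1) none

theorem recoverTerm_of_one {A : ℕ → Cell} {d u : ℕ} (h : A d = Cell.one u) (As : Fin n → ℕ → Cell)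
    (p : ℕ) (s : Fin n → ℕ) (D : ℕ) (a : R) :
    recoverTerm A As p s D d a = (Timed.bits (d.size + 1) ()).bind fun _ =>
      (Timed.tabulate fun k => quotientCell u p d (As k)).bind (checkTerm s D u a) := by
  simp only [recoverTerm, readCell, Timed.bind, Timed.bits, h]
  rfl

theorem recoverTerm_of_ne {A : ℕ → Cell} {d : ℕ} (h : ∀ u, A d ≠ Cell.one u)
    (As : Fin n → ℕ → Cell) (p : ℕ) (s : Fin n → ℕ) (D : ℕ) (a : R) :
    recoverTerm A As p s D d a = (Timed.bits (d.size + 1) ()).bind fun _ => Timed.pure none := by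
  simp only [recoverTerm, readCell, Timed.bind, Timed.bits]

theorem quotientCell_eq_some {u p d e : ℕ} {A : ℕ → Cell}
    (h : (quotientCell (n := n) u p d A).val = some e) :
    ∃ b, A d = Cell.one b ∧ e = (b - u) / p := by
  simp only [quotientCell, readCell, Timed.bind_val, Timed.bits_val] at h
  rcases hA : A d with _ | b | _
  · simp [hA] at h
  · simp only [hA, exactQuotient_val] at h
    refine ⟨b, rfl, ?_⟩
    split at h
    · exact (Option.some.inj h).symm
    · cases h
  · simp [hA] at h

theorem quotientCell_of_one {u p d e : ℕ} {A : ℕ → Cell} (hp : 0 < p)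
    (h : A d = Cell.one (u + e * p)) : (quotientCell (n := n) u p d A).val = some e := by
  simp only [quotientCell, readCell, Timed.bind_val, Timed.bits_val, h, exactQuotient_val]
  rw [if_pos (by simp), Nat.add_sub_cancel_left, Nat.mul_div_cancel _ hp]

theorem quotientCell_bitOps_le {M u p d : ℕ} {A : ℕ → Cell} (hu : u ≤ M) (hp : p ≤ M) (hd : d ≤ M)
    (hA : ∀ b, A d = Cell.one b → b ≤ M) :
    (quotientCell (n := n) u p d A).cost.bitOps ≤ 9 * unitCost n M := by
  have h1 := size_succ_le_unitCost (n := n) (le_capacity hd)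
  simp only [quotientCell, readCell, Timed.bind_cost, Timed.bits_val, Cost.add_bitOps,
    Timed.bits_bitOps]
  rcases h : A d with _ | b | _
  · simp; omega
  · have := exactQuotient_bitOps_le (n := n) hu (hA b h) hp
    simp only
    omega
  · simp; omega

@[simp] theorem quotientCell_ringOps (u p d : ℕ) (A : ℕ → Cell) :
    (quotientCell (n := n) u p d A).cost.ringOps = 0 := by
  simp only [quotientCell, readCell, Timed.bind_cost, Timed.bits_val]
  rcases h : A d with _ | b | _ <;> simp

@[simp] theorem quotientCell_queries (u p d : ℕ) (A : ℕ → Cell) :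
    (quotientCell (n := n) u p d A).cost.queries = [] := by
  simp only [quotientCell, readCell, Timed.bind_cost, Timed.bits_val]
  rcases h : A d with _ | b | _ <;> simp

theorem checkTerm_eq_some {s : Fin n → ℕ} {D u : ℕ} {a : R} {q : Fin n → Option ℕ}
    {t : (Fin n → ℕ) × R} (h : (checkTerm s D u a q).val = some t) :
    (∀ k, q k = some (t.1 k)) ∧ t.2 = a ∧ u = ∑ k, t.1 k * s k ∧ ∑ k, t.1 k ≤ D := by
  unfold checkTerm at h
  split at h
  · next hq =>
    simp only [Timed.bind_val, Timed.bits_val, dot_val, sumVector_val, natEq, natLe, Timed.pure_val,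
      Bool.and_eq_true, decide_eq_true_eq] at h
    split at h
    · next h' =>
      cases h
      refine ⟨fun k => ?_, rfl, h'⟩
      obtain ⟨x, hx⟩ := Option.isSome_iff_exists.1 (hq k)
      simp [hx]
    · cases h
  · cases h

theorem checkTerm_of_some {s : Fin n → ℕ} {D u : ℕ} (a : R) {q : Fin n → Option ℕ} {e : Fin n → ℕ}
    (hq : ∀ k, q k = some (e k)) (hu : u = ∑ k, e k * s k) (hD : ∑ k, e k ≤ D) :
    (checkTerm s D u a q).val = some (e, a) := by
  obtain rfl : q = fun k => some (e k) := funext hq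
  simp [checkTerm, hu, hD]

theorem checkTerm_bitOps_le {M : ℕ} {s : Fin n → ℕ} {D u : ℕ} (a : R) {q : Fin n → Option ℕ}
    (hs : ∀ k, s k ≤ M) (hD : D ≤ M) (hu : u ≤ M) (hq : ∀ k e, q k = some e → e ≤ M) :
    (checkTerm s D u a q).cost.bitOps ≤ (n + 1) * (13 * unitCost n M) := by
  have h1 := size_succ_le_unitCost (n := n) (le_capacity hD)
  have h2 := size_succ_le_unitCost (n := n) (le_capacity hu)
  have he : ∀ k, (fun k => (q k).getD 0) k ≤ M := fun k => by
    rcases h : q k with _ | e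
    · simp [h]
    · simpa [h] using hq k e h
  have h3 := dot_bitOps_le he hs
  have h4 := sumVector_bitOps_le he
  have h5 := size_succ_le_unitCost (sum_mul_le_capacity he hs)
  have h6 := size_succ_le_unitCost (sum_le_capacity he)
  unfold checkTerm
  split
  · simp at h3 h4 h5 h6 ⊢
    nlinarith
  · simp
    nlinarith

@[simp] theorem checkTerm_ringOps (s : Fin n → ℕ) (D u : ℕ) (a : R) (q : Fin n → Option ℕ) :
    (checkTerm s D u a q).cost.ringOps = 0 := by
  unfold checkTerm
  split <;> simp

@[simp] theorem checkTerm_queries (s : Fin n → ℕ) (D u : ℕ) (a : R) (q : Fin n → Option ℕ) :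
    (checkTerm s D u a q).cost.queries = [] := by
  unfold checkTerm
  split <;> simp

variable {A : ℕ → Cell} {As : Fin n → ℕ → Cell} {p : ℕ} {s : Fin n → ℕ} {D d : ℕ} {a : R}

/-- All that is guaranteed about a possibly wrong term. The equation with the content of the cell
places the term in the residue class it was read from, and the degree test bounds its exponents on
every outcome. -/
theorem recoverTerm_eq_some {t : (Fin n → ℕ) × R} (h : (recoverTerm A As p s D d a).val = some t) :
    t.2 = a ∧ A d = Cell.one (∑ k, t.1 k * s k) ∧ ∑ k, t.1 k ≤ D := by
  by_cases hA : ∃ u, A d = Cell.one u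
  · obtain ⟨u, hA⟩ := hA
    rw [recoverTerm_of_one hA] at h
    obtain ⟨-, h2, h3, h4⟩ := checkTerm_eq_some h
    exact ⟨h2, h3 ▸ hA, h4⟩
  · rw [recoverTerm_of_ne (by simpa using hA)] at h
    cases h

/-- If the cells hold the exponents of one genuine term, their differences are e_k p; the divisions
are then exact and both final tests succeed. -/
theorem recoverTerm_of_unique {e : Fin n → ℕ} (hp : 0 < p) (hA : A d = Cell.one (∑ k, e k * s k))
    (hAs : ∀ k, As k d = Cell.one (∑ j, e j * s j + e k * p)) (hD : ∑ k, e k ≤ D) :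
    (recoverTerm A As p s D d a).val = some (e, a) := by
  rw [recoverTerm_of_one hA]
  exact checkTerm_of_some a (fun k => quotientCell_of_one hp (hAs k)) rfl hD

theorem recoverTerm_bitOps_le {M : ℕ} (hs : ∀ k, s k ≤ M) (hD : D ≤ M) (hp : p ≤ M) (hd : d ≤ M)
    (hA : ∀ u, A d = Cell.one u → u ≤ M) (hAs : ∀ k b, As k d = Cell.one b → b ≤ M) :
    (recoverTerm A As p s D d a).cost.bitOps ≤ (n + 1) * (25 * unitCost n M) := by
  have h1 := size_succ_le_unitCost (n := n) (le_capacity hd)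
  by_cases hA' : ∃ u, A d = Cell.one u
  · obtain ⟨u, hA'⟩ := hA'
    have hu := hA u hA'
    rw [recoverTerm_of_one hA']
    have h2 := Timed.tabulate_bitOps_le (n := n) (g := fun k => quotientCell u p d (As k))
      fun k => quotientCell_bitOps_le hu hp hd (hAs k)
    have h3 := checkTerm_bitOps_le (q := fun k => (quotientCell (n := n) u p d (As k)).val) a hs hD
      hu (by
        intro k e he
        obtain ⟨b, hb, rfl⟩ := quotientCell_eq_some he
        exact (Nat.div_le_self _ _).trans ((Nat.sub_le _ _).trans (hAs k b hb)))
    simp only [Timed.bind_cost, Cost.add_bitOps, Timed.bits_bitOps, Timed.tabulate_val]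
    nlinarith
  · rw [recoverTerm_of_ne (by simpa using hA')]
    simp
    nlinarith

@[simp] theorem recoverTerm_ringOps : (recoverTerm A As p s D d a).cost.ringOps = 0 := by
  by_cases hA' : ∃ u, A d = Cell.one u
  · obtain ⟨u, hA'⟩ := hA'
    rw [recoverTerm_of_one hA']
    have := Timed.tabulate_ringOps_le (n := n) (g := fun k => quotientCell u p d (As k)) (c := 0)
      (by simp)
    simpa using this
  · rw [recoverTerm_of_ne (by simpa using hA')]
    simp

@[simp] theorem recoverTerm_queries : (recoverTerm A As p s D d a).cost.queries = [] := by
  by_cases hA' : ∃ u, A d = Cell.one u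
  · obtain ⟨u, hA'⟩ := hA'
    rw [recoverTerm_of_one hA']
    have := Timed.tabulate_queries_eq_nil (n := n) (g := fun k => quotientCell u p d (As k))
      (by simp)
    simp [this]
  · rw [recoverTerm_of_ne (by simpa using hA')]
    simp

end Recover

/-! ### The list of all recovered terms. -/

section TSTerms

variable {n : ℕ} {R : Type u} (Fmod F : List (ℕ × R)) (G : Fin n → List (ℕ × R))
  (p : ℕ) (s : Fin n → ℕ) (D : ℕ)

theorem tsTerms_val : (tsTerms Fmod F G p s D).val =
    (Fmod.map fun t => (recoverTerm (residueTable (n := n) p F).val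
      (fun k => (residueTable (n := n) p (G k)).val) p s D t.1 t.2).val).reduceOption := by
  simp [tsTerms]

theorem mem_tsTerms (t : (Fin n → ℕ) × R) : t ∈ (tsTerms Fmod F G p s D).val ↔
    ∃ t' ∈ Fmod, (recoverTerm (residueTable (n := n) p F).val
      (fun k => (residueTable (n := n) p (G k)).val) p s D t'.1 t'.2).val = some t := by
  rw [tsTerms_val, List.reduceOption_mem_iff, List.mem_map]

/-- Together with the test #Fmod ≤ T₁ this bounds the growth of the approximation even when the
recovered terms are wrong. -/
theorem tsTerms_length_le : (tsTerms Fmod F G p s D).val.length ≤ Fmod.length := by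
  rw [tsTerms_val]
  exact (List.reduceOption_length_le _).trans (by simp)

theorem tsTerms_sum_le (t : (Fin n → ℕ) × R) (ht : t ∈ (tsTerms Fmod F G p s D).val) :
    ∑ k, t.1 k ≤ D := by
  obtain ⟨t', -, h⟩ := (mem_tsTerms _ _ _ _ _ _ _).1 ht
  exact (recoverTerm_eq_some h).2.2

variable {Fmod F G p s D}

/-- The n + 1 tables have p cells each, and every term of Fmod then costs O(n) integer operations.
-/
theorem tsTerms_bitOps_le {M m : ℕ} (hp : p ≤ M) (hD : D ≤ M) (hs : ∀ k, s k ≤ M)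
    (hFmod : ∀ t ∈ Fmod, t.1 ≤ M) (hF : ∀ t ∈ F, t.1 ≤ M) (hG : ∀ k, ∀ t ∈ G k, t.1 ≤ M)
    (hFmodm : Fmod.length ≤ m) (hFm : F.length ≤ m) (hGm : ∀ k, (G k).length ≤ m) :
    (tsTerms Fmod F G p s D).cost.bitOps ≤ (n + 1) * (p + (m + 1) * (40 * unitCost n M)) := by
  have hw : 1 ≤ unitCost n M :=
    (Nat.le_add_left _ _).trans (size_succ_le_unitCost (x := 0) (Nat.zero_le _))
  have h1 := residueTable_bitOps_le (n := n) hp F hF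
  have h2 := Timed.tabulate_bitOps_le (n := n) (g := fun k => residueTable p (G k))
    (c := p + 3 + m * (5 * unitCost n M)) fun k =>
      (residueTable_bitOps_le (n := n) hp (G k) (hG k)).trans (by gcongr; exact hGm k)
  have h3 := Timed.traverse_bitOps_le (L := Fmod)
    (f := fun t => recoverTerm (residueTable (n := n) p F).val
      (fun k => (residueTable (n := n) p (G k)).val) p s D t.1 t.2)
    (c := (n + 1) * (25 * unitCost n M)) fun t ht => by
      refine recoverTerm_bitOps_le hs hD hp (hFmod t ht) ?_ ?_
      · intro u hu
        obtain ⟨x, hx, e⟩ := List.mem_map.1 (residueTable_eq_one hu).1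
        exact e ▸ hF x hx
      · intro k u hu
        obtain ⟨x, hx, e⟩ := List.mem_map.1 (residueTable_eq_one hu).1
        exact e ▸ hG k x hx
  have h4 : F.length * (5 * unitCost n M) ≤ m * (5 * unitCost n M) := by gcongr
  have h5 : Fmod.length * ((n + 1) * (25 * unitCost n M) + 1) ≤
      m * ((n + 1) * (26 * unitCost n M)) := by
    gcongr; nlinarith
  simp only [tsTerms, Timed.bind_cost, Cost.add_bitOps, Timed.bits_bitOps, Timed.tabulate_val,
    Timed.traverse_val, List.length_map]
  generalize unitCost n M = w at *
  have e : (n + 1) * (p + (m + 1) * (40 * w)) = (p + m * (5 * w)) + n * (p + m * (5 * w)) +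
    m * ((n + 1) * (26 * w)) + (n + 1) * m * (9 * w) + (n + 1) * (40 * w) := by ring
  rw [e]
  have e2 : n * (p + 3 + m * (5 * w) + 1) = n * (p + m * (5 * w)) + 4 * n := by ring
  rw [e2] at h2
  have e3 : m ≤ (n + 1) * m * (9 * w) := by
    have : 1 ≤ (n + 1) * (9 * w) := by nlinarith
    nlinarith
  have e4 : 40 * n + 40 ≤ (n + 1) * (40 * w) := by nlinarith
  omega

@[simp] theorem tsTerms_ringOps : (tsTerms Fmod F G p s D).cost.ringOps = 0 := by
  have := Timed.tabulate_ringOps_le (n := n) (g := fun k => residueTable p (G k)) (c := 0)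
    (by simp)
  simp [tsTerms] at this ⊢
  simp [this]

@[simp] theorem tsTerms_queries : (tsTerms Fmod F G p s D).cost.queries = [] := by
  have := Timed.tabulate_queries_eq_nil (n := n) (g := fun k => residueTable p (G k)) (by simp)
  simp [tsTerms, this]

end TSTerms


/-! ## Polynomials as functions on exponents -/

section Polynomials

variable {n : ℕ} {R : Type u} [CommRing R]

/-- The coefficient function of a multivariate polynomial on exponent vectors. -/
noncomputable def coeffFun (f : MvPolynomial (Fin n) R) : (Fin n → ℕ) →₀ R :=
  Finsupp.onFinset (f.support.map Finsupp.equivFunOnFinite.toEmbedding)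
    (fun e => f.coeff (Finsupp.equivFunOnFinite.symm e)) fun e he => by
      simp only [Finset.mem_map_equiv]
      exact MvPolynomial.mem_support_iff.2 he

@[simp] theorem coeffFun_apply (f : MvPolynomial (Fin n) R) (e : Fin n → ℕ) :
    coeffFun f e = f.coeff (Finsupp.equivFunOnFinite.symm e) := rfl

theorem support_coeffFun (f : MvPolynomial (Fin n) R) :
    (coeffFun f).support = f.support.map Finsupp.equivFunOnFinite.toEmbedding := by
  ext e
  rw [Finset.mem_map_equiv, MvPolynomial.mem_support_iff, Finsupp.mem_support_iff, coeffFun_apply]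

theorem card_support_coeffFun (f : MvPolynomial (Fin n) R) :
    (coeffFun f).support.card = f.support.card := by
  rw [support_coeffFun, Finset.card_map]

theorem sum_le_totalDegree {f : MvPolynomial (Fin n) R} {e : Fin n → ℕ}
    (he : e ∈ (coeffFun f).support) : ∑ k, e k ≤ f.totalDegree := by
  rw [support_coeffFun, Finset.mem_map_equiv] at he
  have := MvPolynomial.le_totalDegree he
  rw [Finsupp.sum_fintype _ _ (by simp)] at this
  simpa using this

theorem isSparseRep_of_represents {L : List ((Fin n → ℕ) × R)} {f : MvPolynomial (Fin n) R}
    (h : Represents L (coeffFun f)) : IsSparseRep L f := by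
  refine ⟨h.nodup, h.ne_zero, ?_⟩
  have key : ∀ L : List ((Fin n → ℕ) × R),
      coeffFun (L.map fun t => MvPolynomial.monomial (Finsupp.equivFunOnFinite.symm t.1) t.2).sum
        = value L := by
    intro L
    induction L with
    | nil => ext e; simp
    | cons t L ih =>
      classical
      rw [value_cons, ← ih]
      ext e
      simp [Finsupp.single_apply, MvPolynomial.coeff_monomial]
  have h2 := (key L).trans h.value_eq
  ext m
  have := DFunLike.congr_fun h2 (Finsupp.equivFunOnFinite m)
  simpa using this

theorem kronecker_eq_sum (f : MvPolynomial (Fin n) R) (v : Fin n → ℕ) :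
    kronecker f v = ∑ m ∈ f.support, monomial (∑ k, m k * v k) (f.coeff m) := by
  rw [kronecker, MvPolynomial.aeval_def, MvPolynomial.eval₂_eq']
  refine Finset.sum_congr rfl fun m _ => ?_
  rw [← C_mul_X_pow_eq_monomial, ← Finset.prod_pow_eq_pow_sum]
  congr 1
  refine Finset.prod_congr rfl fun k _ => ?_
  rw [← pow_mul, mul_comm]

theorem coeff_kronecker (f : MvPolynomial (Fin n) R) (v : Fin n → ℕ) (d : ℕ) :
    (kronecker f v).coeff d = (coeffFun f).mapDomain (fun e => ∑ k, e k * v k) d := by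
  classical
  rw [kronecker_eq_sum, finsetSum_coeff, Finsupp.mapDomain, Finsupp.sum_apply, Finsupp.sum,
    support_coeffFun, Finset.sum_map]
  refine Finset.sum_congr rfl fun m _ => ?_
  simp [coeff_monomial, Finsupp.single_apply]

theorem natDegree_kronecker_le (f : MvPolynomial (Fin n) R) {v : Fin n → ℕ} {S : ℕ}
    (hv : ∀ k, v k ≤ S) : (kronecker f v).natDegree ≤ S * f.totalDegree := by
  rw [kronecker_eq_sum]
  refine natDegree_sum_le_of_forall_le _ _ fun m hm => (natDegree_monomial_le _).trans ?_
  have := MvPolynomial.le_totalDegree hm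
  rw [Finsupp.sum_fintype _ _ (by simp)] at this
  calc ∑ k, m k * v k ≤ ∑ k, m k * S := Finset.sum_le_sum fun k _ => by gcongr; exact hv k
    _ = S * ∑ k, m k := by rw [← Finset.sum_mul, mul_comm]
    _ ≤ _ := by gcongr

theorem termList_represents (g : R[X]) {w : ℕ →₀ R} (h : ∀ d, g.coeff d = w d) :
    Represents (termList g) w := by
  have hnd : ((termList g).map Prod.fst).Nodup := by
    simp [termList, Function.comp_def]
  refine ⟨hnd, ?_, ?_⟩
  · intro t ht
    obtain ⟨d, hd, rfl⟩ := List.mem_map.1 ht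
    rw [Finset.mem_sort, mem_support_iff] at hd
    exact hd
  · ext d
    rw [← h]
    by_cases hd : g.coeff d = 0
    · rw [hd]
      by_contra hv
      obtain ⟨t, ht, e⟩ := exists_mem_of_value_ne_zero hv
      obtain ⟨d', hd', rfl⟩ := List.mem_map.1 ht
      rw [Finset.mem_sort, mem_support_iff] at hd'
      exact hd' ((congrArg g.coeff e).trans hd)
    · exact value_apply_of_nodup hnd (t := (d, g.coeff d))
        (List.mem_map.2 ⟨d, by rwa [Finset.mem_sort, mem_support_iff], rfl⟩)

theorem termList_kronecker_represents (f : MvPolynomial (Fin n) R) (v : Fin n → ℕ) :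
    Represents (termList (kronecker f v)) ((coeffFun f).mapDomain fun e => ∑ k, e k * v k) :=
  termList_represents _ (coeff_kronecker f v)

theorem length_termList (g : R[X]) : (termList g).length = g.support.card := by
  simp [termList]

theorem le_natDegree_of_mem_termList {g : R[X]} {t : ℕ × R} (ht : t ∈ termList g) :
    t.1 ≤ g.natDegree := by
  obtain ⟨d, hd, rfl⟩ := List.mem_map.1 ht
  rw [Finset.mem_sort] at hd
  exact le_natDegree_of_mem_supp _ hd

/-- Terms can merge or cancel under the substitution but never split, so T is a valid term bound for
each univariate image. -/
theorem card_support_kronecker_le (f : MvPolynomial (Fin n) R) (v : Fin n → ℕ) :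
    (kronecker f v).support.card ≤ f.support.card := by
  classical
  rw [← length_termList, (termList_kronecker_represents f v).length_eq, ← card_support_coeffFun f]
  exact (Finset.card_le_card Finsupp.mapDomain_support).trans Finset.card_image_le

/-- The conditions under which a requested interpolation returns the right polynomial. -/
def Query.Correct (f : MvPolynomial (Fin n) R) (T : ℕ) (Δ : ℝ) (q : Query n) : Prop :=
  (q.degBound : ℝ) ≤ Δ ∧ q.termBound ≤ T ∧ (kronecker f q.exps).natDegree ≤ q.degBound ∧
    (kronecker f q.exps).support.card ≤ q.termBound

/-- Evaluating f at (a^{v_1}, …, a^{v_n}) is evaluating its Kronecker image at a, so the function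
passed to the interpolator is a black box for that image. -/
theorem interpolate_val {E : Type v} [CommRing E] [Algebra R E] {f : MvPolynomial (Fin n) R}
    {B : (Fin n → E) → E} {U : UnivInterpolator R E} {T : ℕ} {Δ : ℝ}
    (hB : ∀ a : Fin n → E, B a = MvPolynomial.aeval a f) (hU : U.CorrectUpTo Δ T)
    {v : Fin n → ℕ} {d τ : ℕ} (h : Query.Correct f T Δ ⟨v, d, τ⟩) :
    (interpolate B U v d τ).val = termList (kronecker f v) := by
  obtain ⟨h1, h2, h3, h4⟩ := h
  have : (fun a : E => B fun k => a ^ v k) = fun a => aeval a (kronecker f v) := by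
    funext a
    have hc : aeval a (kronecker f v) =
        ((aeval a : R[X] →ₐ[R] E).comp (MvPolynomial.aeval fun k => (X : R[X]) ^ v k)) f := rfl
    rw [hB, hc, MvPolynomial.comp_aeval]
    simp
  simp only [interpolate, this]
  rw [hU _ d τ h1 h2 h3 h4]

end Polynomials

/-! ## Collisions of exponents -/

section Collisions

variable {κ : Type*} {R : Type u} [CommRing R]

open Classical in
/-- The elements of `S` that share their image under `r` with another element of `S`. -/
noncomputable def colliding (r : κ → ℕ) (S : Finset κ) : Finset κ :=
  S.filter fun e => ∃ e' ∈ S, e' ≠ e ∧ r e' = r e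

theorem mem_colliding {r : κ → ℕ} {S : Finset κ} {e : κ} :
    e ∈ colliding r S ↔ e ∈ S ∧ ∃ e' ∈ S, e' ≠ e ∧ r e' = r e := by
  classical
  simp [colliding]

/-- A residue class that contains a colliding element contains at least two of them. -/
theorem two_mul_card_image_colliding_le (r : κ → ℕ) (S : Finset κ) :
    2 * ((colliding r S).image r).card ≤ (colliding r S).card := by
  classical
  rw [Finset.card_eq_sum_card_image r (colliding r S), mul_comm, ← smul_eq_mul]
  refine Finset.card_nsmul_le_sum _ _ _ fun d hd => ?_
  obtain ⟨e, he, rfl⟩ := Finset.mem_image.1 hd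
  obtain ⟨h1, e', h2, h3, h4⟩ := mem_colliding.1 he
  refine Finset.one_lt_card.2 ⟨e, by simp [he], e', ?_, h3.symm⟩
  exact Finset.mem_filter.2 ⟨mem_colliding.2 ⟨h2, e, h1, h3.symm, h4.symm⟩, h4⟩

/-- A map ψ that identifies e only with elements of equal residue meets nothing at a non-colliding
e. It is applied to the residue itself, to e·s and to e·s + e_k p, so the coefficient survives in
all the univariate images at once. -/
theorem mapDomain_apply_of_notMem_colliding {ι : Type*} {φ : κ →₀ R} {r : κ → ℕ} {e : κ}
    (he : e ∈ φ.support) (he' : e ∉ colliding r φ.support) {ψ : κ → ι}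
    (hψ : ∀ e' ∈ φ.support, ψ e' = ψ e → r e' = r e) : φ.mapDomain ψ (ψ e) = φ e := by
  classical
  rw [Finsupp.mapDomain, Finsupp.sum_apply, Finsupp.sum, Finset.sum_eq_single e]
  · simp
  · intro e' h1 h2
    rw [Finsupp.single_apply, if_neg]
    exact fun h => he' (mem_colliding.2 ⟨he, e', h1, h2, hψ e' h1 h⟩)
  · exact fun h => absurd he h

/-- Every non-colliding term survives the reduction, at an exponent of its own. -/
theorem card_support_le_add_colliding (φ : κ →₀ R) (r : κ → ℕ) :
    φ.support.card ≤ (φ.mapDomain r).support.card + (colliding r φ.support).card := by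
  classical
  have hsub : colliding r φ.support ⊆ φ.support := fun e he => (mem_colliding.1 he).1
  have h1 : (φ.support \ colliding r φ.support).card ≤ (φ.mapDomain r).support.card := by
    refine Finset.card_le_card_of_injOn r (fun e he => ?_) fun e he e' he' h => ?_
    · simp only [Finset.coe_sdiff, Set.mem_sdiff, Finset.mem_coe] at he
      rw [Finset.mem_coe, Finsupp.mem_support_iff,
        mapDomain_apply_of_notMem_colliding he.1 he.2 fun _ _ h => h]
      exact Finsupp.mem_support_iff.1 he.1
    · simp only [Finset.coe_sdiff, Set.mem_sdiff, Finset.mem_coe] at he he'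
      by_contra hne
      exact he.2 (mem_colliding.2 ⟨he.1, e', he'.1, Ne.symm hne, h.symm⟩)
  rw [Finset.card_sdiff_of_subset hsub] at h1
  omega

/-- A class of colliding terms leaves at most one term after reduction, so at least half of the
colliding terms disappear. With the preceding bound, the size of the reduction measures the number
of collisions up to a factor 2. -/
theorem two_mul_card_support_add_colliding_le (φ : κ →₀ R) (r : κ → ℕ) :
    2 * (φ.mapDomain r).support.card + (colliding r φ.support).card ≤ 2 * φ.support.card := by
  classical
  have hsub : colliding r φ.support ⊆ φ.support := fun e he => (mem_colliding.1 he).1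
  have h1 : (φ.mapDomain r).support.card ≤
      ((φ.support \ colliding r φ.support).image r).card +
        ((colliding r φ.support).image r).card := by
    refine (Finset.card_le_card ?_).trans (Finset.card_union_le _ _)
    rw [← Finset.image_union, Finset.sdiff_union_of_subset hsub]
    exact Finsupp.mapDomain_support
  have h2 := two_mul_card_image_colliding_le r φ.support
  have h3 : ((φ.support \ colliding r φ.support).image r).card ≤ _ := Finset.card_image_le
  rw [Finset.card_sdiff_of_subset hsub] at h3
  have := Finset.card_le_card hsub
  omega

end Collisions

/-! ### The error that remains after one recovery. -/

section Recovery

variable {n : ℕ} {R : Type u} [CommRing R]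

/-- Transfers the distinctness of the exponents of Fmod to the residues of the recovered terms. -/
theorem reduceOption_map_sublist {α β γ : Type*} (f : α → Option β) (a : α → γ) (b : β → γ)
    (h : ∀ x y, f x = some y → b y = a x) (L : List α) :
    ((L.map f).reduceOption.map b).Sublist (L.map a) := by
  induction L with
  | nil => simp
  | cons x L ih =>
    rw [List.map_cons, List.map_cons]
    rcases hx : f x with _ | y
    · rw [List.reduceOption_cons_of_none]
      exact ih.cons _
    · rw [List.reduceOption_cons_of_some, List.map_cons, h x y hx]
      exact ih.cons_cons _

/-- The residue modulo `p` of the exponent of the image of `x^e` in `f(x^s)`. -/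
def residue (p : ℕ) (s e : Fin n → ℕ) : ℕ := (∑ k, e k * s k) % p

/-- Only the colliding terms of `φ` are lost by `tsTerms`, and each class of colliding terms gives
rise to at most one wrong term. -/
theorem two_mul_card_support_sub_tsTerms_le {φ : (Fin n → ℕ) →₀ R} {p D : ℕ} {s : Fin n → ℕ}
    {Fmod F : List (ℕ × R)} {G : Fin n → List (ℕ × R)} (hp : 0 < p)
    (hF : Represents F (φ.mapDomain fun e => ∑ k, e k * s k))
    (hFmod : Represents Fmod (φ.mapDomain (residue p s)))
    (hG : ∀ k, Represents (G k) (φ.mapDomain fun e => ∑ j, e j * s j + e k * p))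
    (hD : ∀ e ∈ φ.support, ∑ k, e k ≤ D) :
    2 * (φ - value (tsTerms Fmod F G p s D).val).support.card ≤
      3 * (colliding (residue p s) φ.support).card := by
  classical
  set E := (tsTerms Fmod F G p s D).val with hE
  set C := colliding (residue p s) φ.support with hC
  have hkey : ∀ (x : ℕ × R) (y : (Fin n → ℕ) × R), (recoverTerm (residueTable (n := n) p F).val
      (fun k => (residueTable (n := n) p (G k)).val) p s D x.1 x.2).val = some y →
      residue p s y.1 = x.1 := fun x y h =>
    (residueTable_eq_one (recoverTerm_eq_some h).2.1).2
  have hres : ∀ y ∈ E, ∃ x ∈ Fmod, residue p s y.1 = x.1 ∧ y.2 = x.2 := by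
    intro y hy
    obtain ⟨x, hx, h⟩ := (mem_tsTerms _ _ _ _ _ _ _).1 hy
    exact ⟨x, hx, hkey x y h, (recoverTerm_eq_some h).1⟩
  -- Recovered terms have pairwise different residues, so each class produces at most one of them.
  have hnd : (E.map fun t => residue p s t.1).Nodup := by
    rw [hE, tsTerms_val]
    exact hFmod.nodup.sublist (reduceOption_map_sublist _ Prod.fst _ hkey Fmod)
  have hinj : ∀ x ∈ E, ∀ y ∈ E, residue p s x.1 = residue p s y.1 → x = y := fun x hx y hy h =>
    List.inj_on_of_nodup_map hnd hx hy h
  have hndE : (E.map Prod.fst).Nodup := by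
    refine List.Nodup.of_map (residue p s) ?_
    rw [List.map_map]
    exact hnd
  -- A non-colliding term is alone in its class in each of the tables. Adding e_k p does not change
  -- residues, so the shifted images have the same classes.
  have hgood : ∀ e ∈ φ.support, e ∉ C → (e, φ e) ∈ E := by
    intro e he heC
    have hs1 : ∀ k, ∀ d' ∈ (G k).map Prod.fst, d' % p = (∑ j, e j * s j + e k * p) % p →
        d' = ∑ j, e j * s j + e k * p := by
      intro k d' hd' h
      rw [← (hG k).mem_support_iff] at hd'
      obtain ⟨e', he', rfl⟩ := Finset.mem_image.1 (Finsupp.mapDomain_support hd')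
      rw [Nat.add_mul_mod_self_right, Nat.add_mul_mod_self_right] at h
      by_cases hee : e' = e
      · rw [hee]
      · exact absurd (mem_colliding.2 ⟨he, e', he', hee, h⟩) heC
    have hs2 : ∀ d' ∈ F.map Prod.fst, d' % p = (∑ j, e j * s j) % p → d' = ∑ j, e j * s j := by
      intro d' hd' h
      rw [← hF.mem_support_iff] at hd'
      obtain ⟨e', he', rfl⟩ := Finset.mem_image.1 (Finsupp.mapDomain_support hd')
      by_cases hee : e' = e
      · rw [hee]
      · exact absurd (mem_colliding.2 ⟨he, e', he', hee, h⟩) heC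
    have hφ := Finsupp.mem_support_iff.1 he
    rw [hE, mem_tsTerms]
    refine ⟨(residue p s e, φ e), ?_, ?_⟩
    · rw [hFmod.mem_iff]
      exact ⟨mapDomain_apply_of_notMem_colliding he heC fun _ _ h => h, hφ⟩
    · refine recoverTerm_of_unique hp ?_ (fun k => ?_) (hD e he)
      · refine residueTable_of_unique hF.nodup ?_ hs2
        rw [← hF.mem_support_iff, Finsupp.mem_support_iff,
          mapDomain_apply_of_notMem_colliding (ψ := fun e => ∑ k, e k * s k) he heC
            fun e' _ h => congrArg (· % p) h]
        exact hφ
      · have : residue p s e = (∑ j, e j * s j + e k * p) % p := by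
          rw [Nat.add_mul_mod_self_right]; rfl
        rw [this]
        refine residueTable_of_unique (hG k).nodup ?_ (hs1 k)
        rw [← (hG k).mem_support_iff, Finsupp.mem_support_iff,
          mapDomain_apply_of_notMem_colliding (ψ := fun e => ∑ j, e j * s j + e k * p) he heC
            fun e' _ h => by
              have := congrArg (· % p) h
              simpa only [Nat.add_mul_mod_self_right, residue] using this]
        exact hφ
  -- An error term outside C is not a term of φ, so it was recovered wrongly. Its class contains
  -- some term e' of φ, because Fmod is nonzero there; if e' did not collide it would itself be the
  -- unique recovered term of the class.
  have hsub : (φ - value E).support \ C ⊆ ((φ - value E).support \ C).filter fun e =>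
      residue p s e ∈ C.image (residue p s) ∧ e ∈ E.map Prod.fst := by
    intro e he
    refine Finset.mem_filter.2 ⟨he, ?_⟩
    obtain ⟨he1, heC⟩ := Finset.mem_sdiff.1 he
    rw [Finsupp.mem_support_iff, Finsupp.sub_apply] at he1
    have heS : e ∉ φ.support := by
      intro heS
      have := value_apply_of_nodup hndE (hgood e heS heC)
      exact he1 (by rw [this, sub_self])
    have hv : value E e ≠ 0 := by
      intro h0
      rw [Finsupp.notMem_support_iff.1 heS, h0, sub_zero] at he1
      exact he1 rfl
    obtain ⟨t, ht, rfl⟩ := exists_mem_of_value_ne_zero hv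
    refine ⟨?_, List.mem_map_of_mem ht⟩
    obtain ⟨x, hx, hx1, -⟩ := hres t ht
    have hxs : x.1 ∈ (φ.mapDomain (residue p s)).support :=
      (hFmod.mem_support_iff _).2 (List.mem_map_of_mem hx)
    obtain ⟨e', he', hee⟩ := Finset.mem_image.1 (Finsupp.mapDomain_support hxs)
    by_cases h : e' ∈ C
    · exact Finset.mem_image.2 ⟨e', h, hee.trans hx1.symm⟩
    · have := hinj _ (hgood e' he' h) t ht (hee.trans hx1.symm)
      exact absurd (this ▸ he') heS
  have hcard : ((φ - value E).support \ C).card ≤ (C.image (residue p s)).card := by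
    refine Finset.card_le_card_of_injOn (residue p s) (fun e he => ?_) fun e he e' he' h => ?_
    · exact (Finset.mem_filter.1 (hsub he)).2.1
    · obtain ⟨x, hx, rfl⟩ := List.mem_map.1 (Finset.mem_filter.1 (hsub he)).2.2
      obtain ⟨y, hy, rfl⟩ := List.mem_map.1 (Finset.mem_filter.1 (hsub he')).2.2
      rw [hinj x hx y hy h]
  have h1 := two_mul_card_image_colliding_le (residue p s) φ.support
  rw [← hC] at h1
  have h2 : (φ - value E).support.card ≤ ((φ - value E).support \ C).card + C.card := by
    rw [← Finset.card_union_of_disjoint Finset.sdiff_disjoint]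
    exact Finset.card_le_card fun x hx => by
      by_cases h : x ∈ C
      · exact Finset.mem_union_right _ h
      · exact Finset.mem_union_left _ (Finset.mem_sdiff.2 ⟨hx, h⟩)
  omega

end Recovery


/-! ## Probabilities -/

namespace RComp

open scoped ENNReal

variable {n : ℕ} {α : Type u} {β : Type v}

/-- The probability that the result of a randomized computation satisfies `P`. -/
noncomputable def prob (x : RComp n α) (P : α → Prop) : ℝ≥0∞ :=
  x.toOuterMeasure {t | P t.val}

theorem mem_support_lift {x t : Timed n α} : t ∈ (lift x).support ↔ t = x := by
  simp [lift]

/-- Statements about every outcome are proved by following an element of the support through the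
binds; the costs of the two stages add up. -/
theorem mem_support_bind {x : RComp n α} {f : α → RComp n β} {t : Timed n β} :
    t ∈ (bind x f).support ↔ ∃ a ∈ x.support, ∃ b ∈ (f a.val).support,
      t.val = b.val ∧ t.cost = a.cost + b.cost := by
  simp only [bind, PMF.mem_support_bind_iff, PMF.mem_support_map_iff]
  constructor
  · rintro ⟨a, ha, b, hb, rfl⟩
    exact ⟨a, ha, b, hb, rfl, rfl⟩
  · rintro ⟨a, ha, b, hb, h1, h2⟩
    exact ⟨a, ha, b, hb, by cases t; simp_all⟩

theorem prob_lift (x : Timed n α) (P : α → Prop) [Decidable (P x.val)] :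
    prob (lift x) P = if P x.val then 1 else 0 := by
  classical
  rw [prob, lift, PMF.toOuterMeasure_pure_apply]
  simp

theorem prob_bind (x : RComp n α) (f : α → RComp n β) (P : β → Prop) :
    prob (bind x f) P = ∑' t, x t * prob (f t.val) P := by
  simp only [prob, bind, PMF.toOuterMeasure_bind_apply, PMF.toOuterMeasure_map_apply]
  rfl

@[simp] theorem prob_bind_lift (x : Timed n α) (f : α → RComp n β) (P : β → Prop) :
    prob (bind (lift x) f) P = prob (f x.val) P := by
  rw [prob_bind, tsum_eq_single x]
  · simp [lift]
  · intro t ht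
    simp [lift, PMF.pure_apply, ht]

theorem prob_le_one (x : RComp n α) (P : α → Prop) : prob x P ≤ 1 := by
  rw [prob, PMF.toOuterMeasure_apply, ← x.tsum_coe]
  exact ENNReal.tsum_le_tsum fun t => Set.indicator_le_self _ _ _

theorem prob_add_prob_not (x : RComp n α) (P : α → Prop) :
    prob x P + prob x (fun a => ¬P a) = 1 := by
  classical
  simp only [prob, PMF.toOuterMeasure_apply]
  rw [← ENNReal.tsum_add, ← x.tsum_coe]
  refine tsum_congr fun t => ?_
  by_cases h : P t.val <;> simp [h]

/-- If `Q` fails with probability at most `a`, and `P` has probability at most `b` once `Q` holds,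
then `P` has probability at most `a + b`. -/
theorem prob_bind_le_add {x : RComp n α} {f : α → RComp n β} {P : β → Prop} {Q : α → Prop}
    {a b : ℝ≥0∞} (hx : prob x (fun v => ¬Q v) ≤ a)
    (hf : ∀ t ∈ x.support, Q t.val → prob (f t.val) P ≤ b) : prob (bind x f) P ≤ a + b := by
  classical
  rw [prob_bind]
  calc ∑' t, x t * prob (f t.val) P
      ≤ ∑' t, ({t : Timed n α | ¬Q t.val}.indicator x t + x t * b) := by
        refine ENNReal.tsum_le_tsum fun t => ?_
        by_cases ht : t ∈ x.support
        · by_cases hQ : Q t.val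
          · exact (mul_le_mul_right (hf t ht hQ) _).trans le_add_self
          · rw [Set.indicator_of_mem hQ]
            exact (mul_le_of_le_one_right' (prob_le_one _ _)).trans le_self_add
        · rw [(x.apply_eq_zero_iff t).2 ht]
          simp
    _ = prob x (fun v => ¬Q v) + b := by
        rw [ENNReal.tsum_add, ENNReal.tsum_mul_right, x.tsum_coe, one_mul, prob,
          PMF.toOuterMeasure_apply]
    _ ≤ a + b := by gcongr

/-- Success after the second stage requires Q after the first. This yields the product bound for
independent draws and, with b = 1, the passage from an event to a necessary condition for it. -/
theorem prob_bind_le_mul {x : RComp n α} {f : α → RComp n β} {P : β → Prop} {Q : α → Prop}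
    {b : ℝ≥0∞} (h0 : ∀ v, ¬Q v → prob (f v) P = 0) (hf : ∀ v, prob (f v) P ≤ b) :
    prob (bind x f) P ≤ prob x Q * b := by
  classical
  rw [prob_bind, prob, PMF.toOuterMeasure_apply, ← ENNReal.tsum_mul_right]
  refine ENNReal.tsum_le_tsum fun t => ?_
  by_cases hQ : Q t.val
  · rw [Set.indicator_of_mem (show t ∈ {t : Timed n α | Q t.val} from hQ)]
    gcongr
    exact hf _
  · simp [h0 _ hQ]

theorem prob_repeated_forall_le (x : RComp n α) (P : α → Prop) (l : ℕ) :
    prob (repeated x l) (fun L => ∀ a ∈ L, P a) ≤ prob x P ^ l := by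
  classical
  induction l with
  | zero => simpa using prob_le_one _ _
  | succ l ih =>
    rw [repeated, pow_succ']
    refine prob_bind_le_mul (fun v hv => ?_) fun v => ?_
    · rw [prob_bind]
      simp [prob_lift, hv]
    · have := prob_bind_le_mul (x := repeated x l) (b := 1) (Q := fun L => ∀ a ∈ L, P a)
        (f := fun L => lift (Timed.bits 1 (v :: L))) (P := fun L => ∀ a ∈ L, P a) (fun L hL => by
          rw [prob_lift, if_neg]
          intro h
          exact hL fun a ha => h a (List.mem_cons_of_mem _ ha)) fun L => prob_le_one _ _
      rw [mul_one] at this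
      exact this.trans ih

theorem mem_support_repeated {x : RComp n α} {P : α → Prop} {c : ℕ}
    (hx : ∀ t ∈ x.support, P t.val ∧ t.cost.queries = [] ∧ t.cost.ringOps = 0 ∧ t.cost.bitOps ≤ c)
    (l : ℕ) {t : Timed n (List α)} (ht : t ∈ (repeated x l).support) :
    t.val.length = l ∧ (∀ a ∈ t.val, P a) ∧ t.cost.queries = [] ∧ t.cost.ringOps = 0 ∧
      t.cost.bitOps ≤ l * (c + 1) := by
  induction l generalizing t with
  | zero =>
    rw [repeated, mem_support_lift] at ht
    subst ht
    simp
  | succ l ih =>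
    rw [repeated, mem_support_bind] at ht
    obtain ⟨a, ha, b, hb, h1, h2⟩ := ht
    obtain ⟨c', hc, d, hd, h3, h4⟩ := mem_support_bind.1 hb
    rw [mem_support_lift] at hd
    subst hd
    obtain ⟨i1, i2, i3, i4, i5⟩ := ih hc
    obtain ⟨j1, j2, j3, j4⟩ := hx a ha
    rw [h1, h3, h2, h4]
    refine ⟨by simp [i1], by simpa using ⟨j1, i2⟩, by simp [j2, i3], by simp [j3, i4], ?_⟩
    simp
    nlinarith

end RComp

/-! ## The probability of many collisions -/

section Counting

variable {n : ℕ}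

/-- Overwriting the k-th coordinate with an arbitrary value is injective on A × Fin p, because the
remaining coordinates determine the element of A. -/
theorem card_mul_le_pow {p : ℕ} (k : Fin n) (A : Finset (Fin n → Fin p))
    (h : ∀ s ∈ A, ∀ s' ∈ A, (∀ j, j ≠ k → s j = s' j) → s = s') : A.card * p ≤ p ^ n := by
  classical
  have : (A ×ˢ (Finset.univ : Finset (Fin p))).card ≤
      (Finset.univ : Finset (Fin n → Fin p)).card := by
    refine Finset.card_le_card_of_injOn (fun x => Function.update x.1 k x.2)
      (fun _ _ => Finset.mem_coe.2 (Finset.mem_univ _)) ?_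
    rintro ⟨s, c⟩ hs ⟨s', c'⟩ hs' e
    simp only [Finset.coe_product, Set.mem_prod, Finset.mem_coe] at hs hs'
    have h1 : c = c' := by simpa using congrFun e k
    have h2 : s = s' := h s hs.1 s' hs'.1 fun j hj => by simpa [hj] using congrFun e j
    rw [h1, h2]
  simpa [Finset.card_product] using this

/-- With the other coordinates fixed, the condition is a linear equation for s_k over `ZMod p` whose
coefficient e_k - e'_k is nonzero, hence has at most one solution. A random s thus confuses e and e'
with probability at most 1/p. -/
theorem card_residue_eq_mul_le {p : ℕ} (hp : p.Prime) {e e' : Fin n → ℕ} {k : Fin n}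
    (hk : ¬ e k ≡ e' k [MOD p]) :
    (Finset.univ.filter fun s : Fin n → Fin p =>
      residue p (fun j => (s j : ℕ)) e' = residue p (fun j => (s j : ℕ)) e).card * p ≤ p ^ n := by
  classical
  have := Fact.mk hp
  refine card_mul_le_pow k _ fun s hs s' hs' h => ?_
  simp only [Finset.mem_filter, Finset.mem_univ, true_and, residue] at hs hs'
  rw [← ZMod.natCast_eq_natCast_iff'] at hs hs'
  push_cast at hs hs'
  rw [← Finset.add_sum_erase _ _ (Finset.mem_univ k),
    ← Finset.add_sum_erase _ (fun j => (e j : ZMod p) * _) (Finset.mem_univ k)] at hs hs'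
  have h1 (w : Fin n → ℕ) : ∑ j ∈ Finset.univ.erase k, (w j : ZMod p) * ((s j : ℕ) : ZMod p) =
      ∑ j ∈ Finset.univ.erase k, (w j : ZMod p) * ((s' j : ℕ) : ZMod p) :=
    Finset.sum_congr rfl fun j hj => by rw [h j (Finset.ne_of_mem_erase hj)]
  rw [h1 e, h1 e'] at hs
  have h2 : ((e k : ZMod p) - e' k) * (((s k : ℕ) : ZMod p) - ((s' k : ℕ) : ZMod p)) = 0 := by
    linear_combination hs' - hs
  have h3 : ((e k : ZMod p) - e' k) ≠ 0 := by
    rw [sub_ne_zero, Ne, ZMod.natCast_eq_natCast_iff]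
    exact hk
  have h4 := sub_eq_zero.1 ((mul_eq_zero.1 h2).resolve_left h3)
  rw [ZMod.natCast_eq_natCast_iff', Nat.mod_eq_of_lt (s k).2, Nat.mod_eq_of_lt (s' k).2] at h4
  funext j
  by_cases hj : j = k
  · rw [hj]; exact Fin.ext h4
  · exact h j hj

/-- `p` does not separate `e` from the other elements of `S`. -/
def BadPrime (S : Finset (Fin n → ℕ)) (e : Fin n → ℕ) (p : ℕ) : Prop :=
  ∃ e' ∈ S, e' ≠ e ∧ ∀ k, e k ≡ e' k [MOD p]

-- Union bound over the at most T₁ - 1 other exponents, each contributing probability at most 1/p.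
-- Since p ≥ 32(T₁ - 1), the total is at most 1/32.
open Classical in
theorem card_mem_colliding_le {p T₁ : ℕ} (hp : p.Prime) (hpT : 32 * (T₁ - 1) ≤ p)
    {S : Finset (Fin n → ℕ)} (hS : S.card ≤ T₁) {e : Fin n → ℕ} (he : e ∈ S)
    (hbad : ¬BadPrime S e p) :
    32 * (Finset.univ.filter fun s : Fin n → Fin p =>
      e ∈ colliding (residue p fun j => (s j : ℕ)) S).card ≤ p ^ n := by
  have h1 : (Finset.univ.filter fun s : Fin n → Fin p =>
      e ∈ colliding (residue p fun j => (s j : ℕ)) S) ⊆ (S.erase e).biUnion fun e' =>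
        Finset.univ.filter fun s : Fin n → Fin p =>
          residue p (fun j => (s j : ℕ)) e' = residue p (fun j => (s j : ℕ)) e := by
    intro s hs
    obtain ⟨-, e', h2, h3, h4⟩ := mem_colliding.1 (Finset.mem_filter.1 hs).2
    refine Finset.mem_biUnion.2 ⟨e', Finset.mem_erase.2 ⟨h3, h2⟩, ?_⟩
    simpa using h4
  have h2 := (Finset.card_le_card h1).trans Finset.card_biUnion_le
  have h3 : (∑ e' ∈ S.erase e, (Finset.univ.filter fun s : Fin n → Fin p =>
      residue p (fun j => (s j : ℕ)) e' = residue p (fun j => (s j : ℕ)) e).card) * p ≤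
      (T₁ - 1) * p ^ n := by
    rw [Finset.sum_mul]
    calc _ ≤ ∑ e' ∈ S.erase e, p ^ n := by
          refine Finset.sum_le_sum fun e' he' => ?_
          obtain ⟨h4, h5⟩ := Finset.mem_erase.1 he'
          have : ∃ k, ¬ e k ≡ e' k [MOD p] := by
            by_contra! H
            exact hbad ⟨e', h5, h4, H⟩
          obtain ⟨k, hk⟩ := this
          exact card_residue_eq_mul_le hp hk
      _ = (S.card - 1) * p ^ n := by rw [Finset.sum_const, smul_eq_mul, Finset.card_erase_of_mem he]
      _ ≤ _ := by gcongr
  refine Nat.le_of_mul_le_mul_right ?_ hp.pos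
  calc _ ≤ 32 * ((T₁ - 1) * p ^ n) := by nlinarith
    _ = (32 * (T₁ - 1)) * p ^ n := by ring
    _ ≤ p * p ^ n := by gcongr
    _ = _ := by ring

/-- The product of the distinct prime factors divides m, and each factor is at least 2. -/
theorem card_primeFactors_le_log {m : ℕ} (hm : m ≠ 0) : m.primeFactors.card ≤ Nat.log 2 m := by
  refine Nat.le_log_of_pow_le one_lt_two ?_
  calc 2 ^ m.primeFactors.card ≤ ∏ p ∈ m.primeFactors, p :=
        Finset.pow_card_le_prod _ _ _ fun p hp => (Nat.prime_of_mem_primeFactors hp).two_le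
    _ ≤ m := Nat.le_of_dvd (Nat.pos_of_ne_zero hm) (Nat.prod_primeFactors_dvd m)

-- For every other e' choose a coordinate in which it differs from e. A prime that does not separate
-- e from e' divides that difference, a nonzero number of absolute value at most D, which has at
-- most log₂ D prime factors.
open Classical in
theorem card_badPrime_le {D T₁ : ℕ} {S : Finset (Fin n → ℕ)} (hS : S.card ≤ T₁)
    (hD : ∀ e ∈ S, ∀ k, e k ≤ D) {e : Fin n → ℕ} (he : e ∈ S) (P : Finset ℕ)
    (hP : ∀ p ∈ P, p.Prime) : (P.filter (BadPrime S e)).card ≤ (T₁ - 1) * Nat.log 2 D := by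
  have hex : ∀ e' ∈ S.erase e, ∃ m, ∃ k, e k ≠ e' k ∧ m = Nat.dist (e k) (e' k) := fun e' he' => by
    by_contra! H
    exact Finset.ne_of_mem_erase he' (funext fun k => by
      by_contra h
      exact H _ k (Ne.symm h) rfl)
  choose! m hm using hex
  have h1 : P.filter (BadPrime S e) ⊆ (S.erase e).biUnion fun e' =>
      (m e').primeFactors := by
    intro p hp
    obtain ⟨hp1, e', h2, h3, h4⟩ := Finset.mem_filter.1 hp
    have he' := Finset.mem_erase.2 ⟨h3, h2⟩
    obtain ⟨k, hne, hk⟩ := hm e' he'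
    refine Finset.mem_biUnion.2 ⟨e', he', ?_⟩
    rw [Nat.mem_primeFactors, hk]
    refine ⟨hP p hp1, ?_, fun h => hne (Nat.eq_of_dist_eq_zero h)⟩
    rcases le_total (e k) (e' k) with h | h
    · rw [Nat.dist_eq_sub_of_le h]
      exact (Nat.modEq_iff_dvd' h).1 (h4 _)
    · rw [Nat.dist_eq_sub_of_le_right h]
      exact (Nat.modEq_iff_dvd' h).1 (h4 _).symm
  refine ((Finset.card_le_card h1).trans Finset.card_biUnion_le).trans ?_
  calc _ ≤ ∑ e' ∈ S.erase e, Nat.log 2 D := by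
        refine Finset.sum_le_sum fun e' he' => ?_
        obtain ⟨k, hne, hk⟩ := hm e' he'
        rw [hk]
        refine (card_primeFactors_le_log fun h => hne (Nat.eq_of_dist_eq_zero h)).trans
          (Nat.log_mono_right ?_)
        have h1 := hD e he k
        have h2 := hD e' (Finset.mem_of_mem_erase he') k
        unfold Nat.dist
        omega
    _ = (S.card - 1) * Nat.log 2 D := by
        rw [Finset.sum_const, smul_eq_mul, Finset.card_erase_of_mem he]
    _ ≤ _ := by gcongr

-- Markov's inequality. Each exponent collides with probability at most 1/31 (bad primes) plus 1/32
-- (bad vectors), so the expected number of collisions is at most (1/31 + 1/32) T₁.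
open Classical in
theorem sum_card_colliding_le {D T₁ N : ℕ} {S : Finset (Fin n → ℕ)} (hS : S.card ≤ T₁)
    (hD : ∀ e ∈ S, ∀ k, e k ≤ D) (hN : 31 * ((T₁ - 1) * Nat.log 2 D) ≤ N) (p : Fin N → ℕ)
    (hinj : Function.Injective p) (hp : ∀ i, (p i).Prime ∧ 32 * (T₁ - 1) ≤ p i) :
    ∑ i, ((Finset.univ.filter fun s : Fin n → Fin (p i) =>
        T₁ < 6 * (colliding (residue (p i) fun j => (s j : ℕ)) S).card).card : ℝ) / (p i : ℝ) ^ n ≤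
      2 / 5 * N := by
  -- Markov's inequality divides by T₁; for T₁ = 0 the set S is empty and nothing can collide.
  rcases Nat.eq_zero_or_pos T₁ with rfl | hT
  · have hS0 : S = ∅ := by simpa using hS
    subst hS0
    simp [colliding]
  have hTr : (0 : ℝ) < T₁ := by exact_mod_cast hT
  have hpr (i : Fin N) : (0 : ℝ) < (p i : ℝ) ^ n := by
    have : 0 < p i := (hp i).1.pos
    positivity
  set c : (Fin n → ℕ) → Fin N → ℕ := fun e i => (Finset.univ.filter fun s : Fin n → Fin (p i) =>
      e ∈ colliding (residue (p i) fun j => (s j : ℕ)) S).card with hc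
  -- Markov for one prime, by counting the pairs of a vector and a colliding exponent in both
  -- orders.
  have h1 (i : Fin N) : T₁ * (Finset.univ.filter fun s : Fin n → Fin (p i) =>
      T₁ < 6 * (colliding (residue (p i) fun j => (s j : ℕ)) S).card).card ≤
      6 * ∑ e ∈ S, c e i := by
    have hdc : ∑ e ∈ S, c e i = ∑ s : Fin n → Fin (p i),
        (colliding (residue (p i) fun j => (s j : ℕ)) S).card := by
      simp only [hc, Finset.card_filter]
      rw [Finset.sum_comm]
      refine Finset.sum_congr rfl fun s _ => ?_
      rw [← Finset.card_filter]
      congr 1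
      ext e
      simp [mem_colliding]
    rw [hdc, mul_comm, Finset.mul_sum, ← smul_eq_mul]
    refine (Finset.card_nsmul_le_sum _ (fun s => 6 * (colliding (residue (p i)
      fun j => (s j : ℕ)) S).card) _ fun s hs => (Finset.mem_filter.1 hs).2.le).trans ?_
    exact Finset.sum_le_sum_of_subset (Finset.filter_subset _ _)
  have h2 (e : Fin n → ℕ) (he : e ∈ S) :
      ∑ i, (c e i : ℝ) / (p i : ℝ) ^ n ≤ (1 / 31 + 1 / 32) * N := by
    -- A bad prime is charged the whole probability 1, any other prime only 1/32.
    have h3 (i : Fin N) : (c e i : ℝ) / (p i : ℝ) ^ n ≤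
        (if BadPrime S e (p i) then 1 else 0) + 1 / 32 := by
      split_ifs with hb
      · have : c e i ≤ p i ^ n := (Finset.card_filter_le _ _).trans (by simp)
        have : (c e i : ℝ) / (p i : ℝ) ^ n ≤ 1 := by
          rw [div_le_one (hpr i)]
          exact_mod_cast this
        linarith
      · have := card_mem_colliding_le (hp i).1 (hp i).2 hS he hb
        have h4 : (32 * c e i : ℝ) ≤ (p i : ℝ) ^ n := by exact_mod_cast this
        rw [zero_add, div_le_div_iff₀ (hpr i) (by norm_num)]
        linarith
    have h5 : (Finset.univ.filter fun i => BadPrime S e (p i)).card ≤ (T₁ - 1) * Nat.log 2 D := by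
      refine le_trans (le_of_eq ?_) (card_badPrime_le hS hD he (Finset.univ.image p) (by
        simpa using fun i => (hp i).1))
      rw [Finset.filter_image, Finset.card_image_of_injective _ hinj]
    have h6 : (31 * (Finset.univ.filter fun i => BadPrime S e (p i)).card : ℝ) ≤ N := by
      exact_mod_cast (Nat.mul_le_mul_left 31 h5).trans hN
    calc _ ≤ ∑ i, ((if BadPrime S e (p i) then 1 else 0) + 1 / 32 : ℝ) :=
          Finset.sum_le_sum fun i _ => h3 i
      _ = (Finset.univ.filter fun i => BadPrime S e (p i)).card + N * (1 / 32) := by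
          rw [Finset.sum_add_distrib, Finset.sum_boole]
          simp
      _ ≤ _ := by linarith
  refine le_of_mul_le_mul_left ?_ hTr
  calc _ = ∑ i, ((T₁ * (Finset.univ.filter fun s : Fin n → Fin (p i) =>
        T₁ < 6 * (colliding (residue (p i) fun j => (s j : ℕ)) S).card).card : ℕ) : ℝ) /
          (p i : ℝ) ^ n := by
        rw [Finset.mul_sum]
        refine Finset.sum_congr rfl fun i _ => ?_
        push_cast
        ring
    _ ≤ ∑ i, ((6 * ∑ e ∈ S, c e i : ℕ) : ℝ) / (p i : ℝ) ^ n := by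
        refine Finset.sum_le_sum fun i _ => ?_
        exact div_le_div_of_nonneg_right (by exact_mod_cast h1 i) (hpr i).le
    _ = 6 * ∑ e ∈ S, ∑ i, (c e i : ℝ) / (p i : ℝ) ^ n := by
        rw [Finset.sum_comm, Finset.mul_sum]
        refine Finset.sum_congr rfl fun i _ => ?_
        push_cast
        rw [← Finset.sum_div]
        ring
    _ ≤ 6 * ∑ _e ∈ S, (1 / 31 + 1 / 32 : ℝ) * N := by
        gcongr with e he
        exact h2 e he
    _ = 6 * (S.card * ((1 / 31 + 1 / 32) * N)) := by rw [Finset.sum_const, nsmul_eq_mul]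
    _ ≤ 6 * (T₁ * ((1 / 31 + 1 / 32) * N)) := by gcongr
    -- Numerically 6 (1/31 + 1/32) = 189/496, just below 2/5.
    _ ≤ _ := by
        have : (0 : ℝ) ≤ T₁ * N := by positivity
        nlinarith

end Counting

/-! ### The distribution and the support of a random pair. -/

section Draw

open RComp
open scoped ENNReal

variable {n : ℕ}

theorem prob_drawVector {p : ℕ} (hp : 0 < p) (P : (Fin n → ℕ) → Prop)
    [DecidablePred fun s : Fin n → Fin p => P fun k => (s k : ℕ)] :
    prob (drawVector (n := n) p) P = ENNReal.ofReal
      (((Finset.univ.filter fun s : Fin n → Fin p => P fun k => (s k : ℕ)).card : ℝ) /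
        (p : ℝ) ^ n) := by
  classical
  obtain ⟨q, rfl⟩ : ∃ q, p = q + 1 := ⟨p - 1, by omega⟩
  rw [prob, drawVector, PMF.toOuterMeasure_map_apply, PMF.toOuterMeasure_uniformOfFintype_apply,
    ENNReal.ofReal_div_of_pos (by positivity), ENNReal.ofReal_natCast]
  congr 1
  · rw [← Set.toFinset_card]
    congr 2
    ext s
    rw [Set.mem_toFinset, Finset.mem_filter]
    exact ⟨fun h => ⟨Finset.mem_univ _, h⟩, fun h => h.2⟩
  · rw [ENNReal.ofReal_pow (by positivity), ENNReal.ofReal_natCast]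
    simp

theorem drawBelow_succ (q : ℕ) : drawBelow (n := n) (q + 1) =
    PMF.map (fun i : Fin (q + 1) => (Timed.bits (q + 1).size (i : ℕ) : Timed n ℕ))
      (PMF.uniformOfFintype (Fin (q + 1))) :=
  PMF.map_comp (fun i : Fin (q + 1) => (i : ℕ)) (PMF.uniformOfFintype (Fin (q + 1))) _

theorem prob_bind_drawBelow {β : Type v} {N : ℕ} (hN : 0 < N) (f : ℕ → RComp n β) (P : β → Prop) :
    prob (RComp.bind (drawBelow N) f) P = ∑ i : Fin N, (N : ℝ≥0∞)⁻¹ * prob (f i) P := by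
  obtain ⟨q, rfl⟩ : ∃ q, N = q + 1 := ⟨N - 1, by omega⟩
  simp only [drawBelow_succ, RComp.bind, PMF.bind_map, prob, PMF.toOuterMeasure_bind_apply,
    PMF.toOuterMeasure_map_apply, Function.comp_apply]
  rw [tsum_fintype]
  refine Finset.sum_congr rfl fun i _ => ?_
  rw [PMF.uniformOfFintype_apply, Fintype.card_fin]
  rfl

/-- A random pair has few collisions with probability at least `3/5`. -/
theorem prob_drawPair_le {D T₁ N : ℕ} {primes : List ℕ} {S : Finset (Fin n → ℕ)}
    (hS : S.card ≤ T₁) (hD : ∀ e ∈ S, ∀ k, e k ≤ D) (hN : 31 * ((T₁ - 1) * Nat.log 2 D) ≤ N)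
    (hN1 : 0 < N) (hlen : primes.length = N) (hnd : primes.Nodup)
    (hp : ∀ p ∈ primes, p.Prime ∧ 32 * (T₁ - 1) ≤ p) :
    prob (drawPair (n := n) primes N)
      (fun ps => T₁ < 6 * (colliding (residue ps.1 ps.2) S).card) ≤ ENNReal.ofReal (2 / 5) := by
  classical
  set p : Fin N → ℕ := fun i => primes[(i : ℕ)]'(by rw [hlen]; exact i.2) with hpdef
  have hpi (i : Fin N) : primes.getD i 2 = p i := by
    rw [List.getD_eq_getElem]
  have hinj : Function.Injective p := fun i j h => by
    have := (List.Nodup.getElem_inj_iff hnd).1 h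
    exact Fin.ext this
  have hpp (i : Fin N) : (p i).Prime ∧ 32 * (T₁ - 1) ≤ p i := hp _ (List.getElem_mem _)
  have h := sum_card_colliding_le hS hD hN p hinj hpp
  have hpr (i : Fin N) : (0 : ℝ) < (p i : ℝ) ^ n := by
    have : 0 < p i := (hpp i).1.pos
    positivity
  have h1 (i : Fin N) : prob (RComp.bind (RComp.lift (readCell (fun j => primes.getD j 2) (i : ℕ)))
      fun p => RComp.bind (drawVector p) fun s => RComp.lift (Timed.pure (p, s)))
      (fun ps => T₁ < 6 * (colliding (residue (n := n) ps.1 ps.2) S).card) ≤ ENNReal.ofReal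
      (((Finset.univ.filter fun s : Fin n → Fin (p i) =>
        T₁ < 6 * (colliding (residue (p i) fun j => (s j : ℕ)) S).card).card : ℝ) /
        (p i : ℝ) ^ n) := by
    rw [prob_bind_lift]
    simp only [readCell, Timed.bits_val, hpi]
    rw [← prob_drawVector (hpp i).1.pos (fun s => T₁ < 6 * (colliding (residue (p i) s) S).card)]
    have := prob_bind_le_mul (x := drawVector (n := n) (p i)) (b := 1)
      (f := fun s => RComp.lift (Timed.pure (p i, s)))
      (P := fun ps => T₁ < 6 * (colliding (residue (n := n) ps.1 ps.2) S).card)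
      (Q := fun s => T₁ < 6 * (colliding (residue (p i) s) S).card)
      (fun s hs => by rw [prob_lift]; exact if_neg hs) fun s => prob_le_one _ _
    rwa [mul_one] at this
  rw [drawPair, prob_bind_drawBelow hN1]
  have hNr : (0 : ℝ) < N := by exact_mod_cast hN1
  calc _ ≤ ∑ i : Fin N, (N : ℝ≥0∞)⁻¹ * ENNReal.ofReal
          (((Finset.univ.filter fun s : Fin n → Fin (p i) =>
            T₁ < 6 * (colliding (residue (p i) fun j => (s j : ℕ)) S).card).card : ℝ) /
            (p i : ℝ) ^ n) := Finset.sum_le_sum fun i _ => by gcongr; exact h1 i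
    _ = ENNReal.ofReal ((N : ℝ)⁻¹ * ∑ i : Fin N,
          (((Finset.univ.filter fun s : Fin n → Fin (p i) =>
            T₁ < 6 * (colliding (residue (p i) fun j => (s j : ℕ)) S).card).card : ℝ) /
            (p i : ℝ) ^ n)) := by
        rw [← Finset.mul_sum, ENNReal.ofReal_mul (by positivity), ENNReal.ofReal_inv_of_pos hNr,
          ENNReal.ofReal_natCast, ENNReal.ofReal_sum_of_nonneg]
        exact fun i _ => div_nonneg (by positivity) (hpr i).le
    _ ≤ _ := by
        refine ENNReal.ofReal_le_ofReal ?_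
        calc _ ≤ (N : ℝ)⁻¹ * (2 / 5 * N) := by gcongr
          _ = 2 / 5 := by field_simp

theorem mem_support_drawBelow {N : ℕ} (hN : 0 < N) {t : Timed n ℕ}
    (ht : t ∈ (drawBelow (n := n) N).support) :
    t.val < N ∧ t.cost = ⟨[], 0, N.size⟩ := by
  obtain ⟨q, rfl⟩ : ∃ q, N = q + 1 := ⟨N - 1, by omega⟩
  rw [drawBelow_succ, PMF.mem_support_map_iff] at ht
  obtain ⟨i, -, rfl⟩ := ht
  exact ⟨i.2, rfl⟩

theorem mem_support_drawVector {p : ℕ} (hp : 0 < p) {t : Timed n (Fin n → ℕ)}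
    (ht : t ∈ (drawVector (n := n) p).support) :
    (∀ k, t.val k < p) ∧ t.cost = ⟨[], 0, n * p.size⟩ := by
  obtain ⟨q, rfl⟩ : ∃ q, p = q + 1 := ⟨p - 1, by omega⟩
  rw [drawVector, PMF.mem_support_map_iff] at ht
  obtain ⟨s, -, rfl⟩ := ht
  exact ⟨fun k => (s k).2, rfl⟩

theorem mem_support_drawPair {N M : ℕ} {primes : List ℕ} (hN : 0 < N) (hlen : primes.length = N)
    (hp : ∀ p ∈ primes, 0 < p ∧ p ≤ M) {t : Timed n (ℕ × (Fin n → ℕ))}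
    (ht : t ∈ (drawPair primes N).support) :
    (t.val.1 ∈ primes ∧ ∀ k, t.val.2 k < t.val.1) ∧ t.cost.queries = [] ∧ t.cost.ringOps = 0 ∧
      t.cost.bitOps ≤ 2 * N.size + 1 + n * M.size := by
  obtain ⟨a, ha, b, hb, h1, h2⟩ := mem_support_bind.1 ht
  obtain ⟨c, hc, d, hd, h3, h4⟩ := mem_support_bind.1 hb
  obtain ⟨e, he, g, hg, h5, h6⟩ := mem_support_bind.1 hd
  rw [mem_support_lift] at hc hg
  subst hc hg
  obtain ⟨ha1, ha2⟩ := mem_support_drawBelow hN ha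
  have hmem : primes.getD a.val 2 ∈ primes := by
    rw [List.getD_eq_getElem _ _ (by omega)]
    exact List.getElem_mem _
  simp only [readCell, Timed.bits_val] at he h5 h6
  obtain ⟨he1, he2⟩ := mem_support_drawVector (hp _ hmem).1 he
  rw [h1, h3, h5, h2, h4, h6, ha2, he2]
  refine ⟨⟨hmem, he1⟩, by simp, by simp, ?_⟩
  have s1 := Nat.size_le_size ha1.le
  have s2 : n * (primes.getD a.val 2).size ≤ n * M.size :=
    Nat.mul_le_mul_left _ (Nat.size_le_size (hp _ hmem).2)
  simp only [readCell, Cost.add_bitOps, Timed.bits_bitOps, Timed.pure_cost, Cost.zero_bitOps]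
  omega

end Draw


/-! ## The samples -/

section RemoveRepeated

variable {n : ℕ}

theorem found_val {α : Type u} {f : Bool → α → Timed n Bool} {q : α → Bool}
    (h : ∀ b a, (f b a).val = (b || q a)) (L : List α) (b : Bool) :
    (Timed.foldl f b L).val = (b || L.any q) := by
  rw [Timed.foldl_val]
  induction L generalizing b with
  | nil => simp
  | cons a L ih => rw [List.foldl_cons, ih, h, List.any_cons, Bool.or_assoc]

theorem removeRepeated_cons_val (x : ℕ × (Fin n → ℕ)) (L : List (ℕ × (Fin n → ℕ))) :
    (removeRepeated (x :: L)).val = if x ∈ (removeRepeated L).val then (removeRepeated L).val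
      else x :: (removeRepeated L).val := by
  simp only [removeRepeated, Timed.bind_val, Timed.bits_val]
  rw [found_val (q := fun y => decide (x = y)) (fun b y => by simp [Prod.ext_iff])]
  simp

theorem mem_removeRepeated (L : List (ℕ × (Fin n → ℕ))) (x : ℕ × (Fin n → ℕ)) :
    x ∈ (removeRepeated L).val ↔ x ∈ L := by
  induction L with
  | nil => simp [removeRepeated]
  | cons a L ih =>
    rw [removeRepeated_cons_val, List.mem_cons, ← ih]
    split
    · next h => exact ⟨Or.inr, by rintro (rfl | h'); exacts [h, h']⟩
    · rw [List.mem_cons]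

theorem removeRepeated_length_le (L : List (ℕ × (Fin n → ℕ))) :
    (removeRepeated L).val.length ≤ L.length := by
  induction L with
  | nil => simp [removeRepeated]
  | cons a L ih =>
    rw [removeRepeated_cons_val]
    split <;> simp <;> omega

theorem key_size_vector_le {M : ℕ} {s : Fin n → ℕ} (hs : ∀ k, s k ≤ M) :
    Key.size s ≤ n * unitCost n M := by
  have : ∑ k, ((s k).size + 1) ≤ ∑ _k : Fin n, unitCost n M :=
    Finset.sum_le_sum fun k _ => size_succ_le_unitCost (le_capacity (hs k))
  rwa [Finset.sum_const, Finset.card_univ, Fintype.card_fin, smul_eq_mul] at this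

/-- The comparison of all pairs is quadratic in their number, which is harmless because only O(log
T) pairs are drawn. -/
theorem removeRepeated_bitOps_le {M : ℕ} (L : List (ℕ × (Fin n → ℕ)))
    (hL : ∀ x ∈ L, x.1 ≤ M ∧ ∀ k, x.2 k ≤ M) :
    (removeRepeated L).cost.bitOps ≤ (L.length + 1) ^ 2 * ((n + 1) * (4 * unitCost n M)) := by
  have hw : 1 ≤ unitCost n M :=
    (Nat.le_add_left _ _).trans (size_succ_le_unitCost (x := 0) (Nat.zero_le _))
  have hnw : 1 ≤ (n + 1) * unitCost n M := by nlinarith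
  induction L with
  | nil => simp [removeRepeated]; nlinarith
  | cons a L ih =>
    have ih := ih fun x hx => hL x (by simp [hx])
    have ha := hL a (by simp)
    have h1 := Timed.foldl_bitOps_le' (n := n) (L := (removeRepeated L).val) (f := fun found y =>
        (keyEq a.1 y.1).bind fun b => (keyEq a.2 y.2).bind fun c =>
        Timed.pure (found || (b && c))) (c := (n + 1) * (3 * unitCost n M)) (by
      intro y hy found
      rw [mem_removeRepeated] at hy
      have hy := hL y (by simp [hy])
      have e1 := size_succ_le_unitCost (n := n) (le_capacity ha.1)
      have e2 := size_succ_le_unitCost (n := n) (le_capacity hy.1)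
      have e3 := key_size_vector_le ha.2
      have e4 := key_size_vector_le hy.2
      have e5 : ∀ x : ℕ, Key.size x = x.size := fun _ => rfl
      simp [e5]
      nlinarith) false
    have h2 := removeRepeated_length_le L
    simp only [removeRepeated, Timed.bind_cost, Cost.add_bitOps, Timed.bits_bitOps,
      List.length_cons]
    have h3 : (removeRepeated L).val.length * ((n + 1) * (3 * unitCost n M) + 1) ≤
        L.length * ((n + 1) * (4 * unitCost n M)) := by
      gcongr; nlinarith
    nlinarith

@[simp] theorem removeRepeated_ringOps (L : List (ℕ × (Fin n → ℕ))) :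
    (removeRepeated L).cost.ringOps = 0 := by
  induction L with
  | nil => simp [removeRepeated]
  | cons a L ih =>
    have h1 := Timed.foldl_ringOps_eq (n := n) (c := 0) (f := fun found (y : ℕ × (Fin n → ℕ)) =>
        (keyEq a.1 y.1).bind fun b => (keyEq a.2 y.2).bind fun c =>
        Timed.pure (found || (b && c))) (by simp) (removeRepeated L).val false
    simp only [removeRepeated, Timed.bind_cost, Cost.add_ringOps, Timed.bits_ringOps, ih, h1,
      mul_zero, add_zero]

@[simp] theorem removeRepeated_queries (L : List (ℕ × (Fin n → ℕ))) :
    (removeRepeated L).cost.queries = [] := by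
  induction L with
  | nil => simp [removeRepeated]
  | cons a L ih =>
    have h1 := Timed.foldl_queries_eq_nil (n := n) (f := fun found (y : ℕ × (Fin n → ℕ)) =>
        (keyEq a.1 y.1).bind fun b => (keyEq a.2 y.2).bind fun c =>
        Timed.pure (found || (b && c))) (by simp) (removeRepeated L).val false
    simp only [removeRepeated, Timed.bind_cost, Cost.add_queries, Timed.bits_queries, ih, h1,
      List.append_nil]

end RemoveRepeated

/-! ### The sample with the largest reduction. -/

section BestSample

variable {n : ℕ} {R : Type u}

/-- One round of the loop in `bestSample`. -/
def bestStep (best : Option (Sample n R)) (y : Sample n R) : Timed n (Option (Sample n R)) :=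
  match best with
  | none => Timed.pure (some y)
  | some x => (natLe y.count x.count).bind fun b => Timed.pure (some (if b then x else y))

theorem bestSample_eq (L : List (Sample n R)) : bestSample L = Timed.foldl bestStep none L := rfl

theorem foldl_bestStep_some (L : List (Sample n R)) (x : Sample n R) :
    ∃ y, (Timed.foldl bestStep (some x) L).val = some y ∧ (y = x ∨ y ∈ L) ∧
      x.count ≤ y.count ∧ ∀ z ∈ L, z.count ≤ y.count := by
  induction L generalizing x with
  | nil => exact ⟨x, rfl, by simp⟩
  | cons a L ih =>
    have hstep : (bestStep (some x) a).val = some (if a.count ≤ x.count then x else a) := by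
      simp [bestStep]
    obtain ⟨y, h1, h2, h3, h4⟩ := ih (if a.count ≤ x.count then x else a)
    refine ⟨y, ?_, ?_, ?_, ?_⟩
    · rw [← h1, Timed.foldl_val, Timed.foldl_val, List.foldl_cons, hstep]
    · rcases h2 with h2 | h2
      · split_ifs at h2 <;> simp [h2]
      · simp [h2]
    · split_ifs at h3 <;> omega
    · intro z hz
      rcases List.mem_cons.1 hz with rfl | hz
      · split_ifs at h3 <;> omega
      · exact h4 z hz

theorem bestSample_val {L : List (Sample n R)} (hL : L ≠ []) :
    ∃ y ∈ L, (bestSample L).val = some y ∧ ∀ z ∈ L, z.count ≤ y.count := by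
  obtain ⟨x, L, rfl⟩ := List.exists_cons_of_ne_nil hL
  obtain ⟨y, h1, h2, h3, h4⟩ := foldl_bestStep_some L x
  refine ⟨y, ?_, ?_, ?_⟩
  · rcases h2 with rfl | h2 <;> simp [*]
  · rw [← h1, bestSample_eq, Timed.foldl_val, Timed.foldl_val, List.foldl_cons]
    rfl
  · intro z hz
    rcases List.mem_cons.1 hz with rfl | hz
    exacts [h3, h4 z hz]

theorem bestSample_bitOps_le {M : ℕ} (L : List (Sample n R)) (hL : ∀ x ∈ L, x.count ≤ M) :
    (bestSample L).cost.bitOps ≤ L.length * (3 * unitCost n M) + 1 := by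
  have hw : 1 ≤ unitCost n M :=
    (Nat.le_add_left _ _).trans (size_succ_le_unitCost (x := 0) (Nat.zero_le _))
  have := Timed.foldl_bitOps_le (n := n) (f := bestStep) (c := 2 * unitCost n M)
    (fun K s => (∀ x ∈ K, x.count ≤ M) ∧ ∀ x : Sample n R, s = some x → x.count ≤ M) (by
      rintro a K s ⟨h1, h2⟩
      have ha := h1 a (by simp)
      have e1 := size_succ_le_unitCost (n := n) (le_capacity ha)
      refine ⟨?_, fun x hx => h1 x (by simp [hx]), ?_⟩
      · rcases s with _ | x
        · simp [bestStep]
        · have e2 := size_succ_le_unitCost (n := n) (le_capacity (h2 x rfl))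
          simp [bestStep]
          omega
      · rcases s with _ | x
        · intro y hy
          cases hy
          exact ha
        · intro y hy
          have hstep : (bestStep (some x) a).val = some (if a.count ≤ x.count then x else a) := by
            simp [bestStep]
          rw [hstep] at hy
          cases hy
          split_ifs
          exacts [h2 x rfl, ha]) L none ⟨hL, by simp⟩
  rw [← bestSample_eq] at this
  refine this.trans ?_
  have : L.length * (2 * unitCost n M + 1) ≤ L.length * (3 * unitCost n M) := by gcongr; omega
  omega

theorem bestStep_ringOps (a : Sample n R) (s : Option (Sample n R)) :
    (bestStep s a).cost.ringOps = 0 := by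
  rcases s with _ | x <;> simp [bestStep]

theorem bestStep_queries (a : Sample n R) (s : Option (Sample n R)) :
    (bestStep s a).cost.queries = [] := by
  rcases s with _ | x <;> simp [bestStep]

@[simp] theorem bestSample_ringOps (L : List (Sample n R)) : (bestSample L).cost.ringOps = 0 := by
  rw [bestSample_eq, Timed.foldl_ringOps_eq bestStep_ringOps, mul_zero]

@[simp] theorem bestSample_queries (L : List (Sample n R)) : (bestSample L).cost.queries = [] := by
  rw [bestSample_eq, Timed.foldl_queries_eq_nil bestStep_queries]

end BestSample

/-- The standing assumptions on the input of the algorithm. -/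
structure Setting {n : ℕ} {R : Type u} {E : Type v} [CommRing R] [CommRing E] [Algebra R E]
    (f : MvPolynomial (Fin n) R) (B : (Fin n → E) → E) (U : UnivInterpolator R E) (T D : ℕ)
    (Δ : ℝ) : Prop where
  one_le_T : 1 ≤ T
  one_le_D : 1 ≤ D
  card_le : f.support.card ≤ T
  degree_le : f.totalDegree ≤ D
  eval : ∀ a : Fin n → E, B a = MvPolynomial.aeval a f
  correct : U.CorrectUpTo Δ T

/-- The properties of the current approximation that control the cost. -/
structure Bounded {n : ℕ} {R : Type u} (g : List ((Fin n → ℕ) × R)) (T D : ℕ) : Prop where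
  length_le : g.length ≤ 2 * T
  sum_le : ∀ t ∈ g, ∑ k, t.1 k ≤ D

/-- A bound for all integers in one run of `halfPoly`, if the primes are at most `P`. -/
def integerBound (T D P : ℕ) : ℕ := 2 * P * D + 3 * T

/-- The cost of an arithmetic operation in one run of `halfPoly`. -/
def stepCost (n T D P : ℕ) : ℕ := unitCost n (integerBound T D P)

/-- The properties of the data computed for one pair `(p, s)`. -/
structure Sample.Valid {n : ℕ} {R : Type u} [CommRing R] (x : Sample n R)
    (f : MvPolynomial (Fin n) R) (g : List ((Fin n → ℕ) × R)) (T D P : ℕ) : Prop where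
  p_pos : 0 < x.p
  p_le : x.p ≤ P
  s_lt : ∀ k, x.s k < x.p
  s_le_sup : ∀ k, x.s k ≤ x.sup
  sup_le : x.sup ≤ P
  represents : Represents x.F ((coeffFun f - value g).mapDomain fun e => ∑ k, e k * x.s k)
  represents_mod : Represents x.Fmod ((coeffFun f - value g).mapDomain (residue x.p x.s))
  length_le : x.F.length ≤ 3 * T
  length_mod_le : x.Fmod.length ≤ 3 * T
  exp_le : ∀ t ∈ x.F, t.1 ≤ integerBound T D P
  exp_mod_le : ∀ t ∈ x.Fmod, t.1 ≤ integerBound T D P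
  count_eq : x.count = x.Fmod.length

/-! ### The data and the cost of one sample. -/

section TakeSample

variable {n : ℕ} {R : Type u} {E : Type v} [CommRing R] [CommRing E]
  {f : MvPolynomial (Fin n) R} {B : (Fin n → E) → E} {U : UnivInterpolator R E} {T D P : ℕ}
  {Δ : ℝ} {g : List ((Fin n → ℕ) × R)}

theorem sum_mul_le_mul {e s : Fin n → ℕ} {D S : ℕ} (he : ∑ k, e k ≤ D) (hs : ∀ k, s k ≤ S) :
    ∑ k, e k * s k ≤ S * D :=
  calc _ ≤ ∑ k, e k * S := Finset.sum_le_sum fun k _ => Nat.mul_le_mul_left _ (hs k)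
    _ = S * ∑ k, e k := by rw [← Finset.sum_mul, mul_comm]
    _ ≤ _ := Nat.mul_le_mul_left _ he

theorem apply_le_of_sum_le {e : Fin n → ℕ} {D : ℕ} (he : ∑ k, e k ≤ D) (k : Fin n) : e k ≤ D :=
  (Finset.single_le_sum (fun _ _ => Nat.zero_le _) (Finset.mem_univ k)).trans he

variable {ps : ℕ × (Fin n → ℕ)}

/-- The difference `F - g(x^s)`. -/
noncomputable def diffSubst (F : List (ℕ × R)) (g : List ((Fin n → ℕ) × R)) (s : Fin n → ℕ) :
    List (ℕ × R) :=
  (subTerms (n := n) F (substitute g s).val).val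

theorem takeSample_val_eq {F : List (ℕ × R)}
    (hF : (interpolate B U ps.2 ((maxVector ps.2).val * D) T).val = F) :
    (takeSample B U g T D ps).val = ⟨ps.1, ps.2, (maxVector ps.2).val, diffSubst F g ps.2,
      (reduceMod (n := n) ps.1 (diffSubst F g ps.2)).val,
      (reduceMod (n := n) ps.1 (diffSubst F g ps.2)).val.length⟩ := by
  subst hF
  simp only [takeSample, Timed.bind_val, natMul, Timed.bits_val, listLength, Timed.pure_val,
    diffSubst]

theorem takeSample_ringOps_eq {F : List (ℕ × R)}
    (hF : (interpolate B U ps.2 ((maxVector ps.2).val * D) T).val = F) :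
    (takeSample B U g T D ps).cost.ringOps = (substitute g ps.2).cost.ringOps +
      (subTerms (n := n) F (substitute g ps.2).val).cost.ringOps +
      (reduceMod (n := n) ps.1 (diffSubst F g ps.2)).cost.ringOps := by
  subst hF
  simp [takeSample, diffSubst, interpolate, add_assoc]

theorem takeSample_bitOps_eq {F : List (ℕ × R)}
    (hF : (interpolate B U ps.2 ((maxVector ps.2).val * D) T).val = F) :
    (takeSample B U g T D ps).cost.bitOps = (maxVector ps.2).cost.bitOps +
      mulBits (maxVector ps.2).val D + (substitute g ps.2).cost.bitOps +
      (subTerms (n := n) F (substitute g ps.2).val).cost.bitOps +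
      (reduceMod (n := n) ps.1 (diffSubst F g ps.2)).cost.bitOps +
      ((reduceMod (n := n) ps.1 (diffSubst F g ps.2)).val.length + 1) := by
  subst hF
  simp [takeSample, diffSubst, interpolate, add_assoc]

theorem takeSample_queries_eq : (takeSample B U g T D ps).cost.queries =
    [⟨ps.2, (maxVector ps.2).val * D, T⟩] := by
  simp [takeSample, interpolate]

theorem diffSubst_length_le (F : List (ℕ × R)) (g : List ((Fin n → ℕ) × R)) (s : Fin n → ℕ) :
    (diffSubst F g s).length ≤ F.length + g.length :=
  (subTerms_length_le F _).trans (Nat.add_le_add_left (substitute_length_le g s) _)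

theorem diffSubst_exp_le {F : List (ℕ × R)} {g : List ((Fin n → ℕ) × R)} {s : Fin n → ℕ} {M : ℕ}
    (hF : ∀ t ∈ F, t.1 ≤ M) (hg : ∀ t ∈ g, ∑ k, t.1 k * s k ≤ M) :
    ∀ t ∈ diffSubst F g s, t.1 ≤ M := by
  intro t ht
  obtain ⟨t', ht', e⟩ := subTerms_mem _ _ _ ht
  rw [← e]
  rcases List.mem_append.1 ht' with h | h
  · exact hF _ h
  · obtain ⟨x, hx, e⟩ := substitute_mem _ _ _ h
    exact e ▸ hg x hx

theorem mapDomain_sub {κ ι : Type*} (ψ : κ → ι) (v w : κ →₀ R) :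
    (v - w).mapDomain ψ = v.mapDomain ψ - w.mapDomain ψ :=
  map_sub (Finsupp.mapDomain.addMonoidHom ψ) v w

theorem diffSubst_represents (g : List ((Fin n → ℕ) × R)) (s : Fin n → ℕ) :
    Represents (diffSubst (termList (kronecker f s)) g s)
      ((coeffFun f - value g).mapDomain fun e => ∑ k, e k * s k) := by
  have h := subTerms_represents (n := n) (termList (kronecker f s)) (substitute g s).val
  rw [(substitute_represents g s).value_eq, (termList_kronecker_represents f s).value_eq] at h
  rwa [mapDomain_sub]

/-- Every term list in a round has at most 3T entries, T from f and 2T from the approximation, so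
one quantity bounds the length factor of all the sorting costs. -/
theorem succ_mul_size_succ_le {T x : ℕ} (h : x ≤ 3 * T) :
    (x + 1) * (x.size + 1) ≤ (3 * T + 1) * ((3 * T).size + 1) :=
  Nat.mul_le_mul (by omega) (Nat.succ_le_succ (Nat.size_le_size h))

variable [Algebra R E]

/-- The requested polynomial is an image of f alone. The bounds handed to the interpolator are
therefore valid however wrong the current approximation may be. -/
theorem Setting.query_correct (H : Setting f B U T D Δ) {v : Fin n → ℕ} {S : ℕ}
    (hv : ∀ k, v k ≤ S) (hS : ((S * D : ℕ) : ℝ) ≤ Δ) :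
    Query.Correct f T Δ ⟨v, S * D, T⟩ :=
  ⟨hS, le_rfl, (natDegree_kronecker_le f hv).trans (Nat.mul_le_mul_left _ H.degree_le),
    (card_support_kronecker_le f v).trans H.card_le⟩

theorem Setting.interpolate_val (H : Setting f B U T D Δ) {v : Fin n → ℕ} {S : ℕ}
    (hv : ∀ k, v k ≤ S) (hS : ((S * D : ℕ) : ℝ) ≤ Δ) :
    (interpolate B U v (S * D) T).val = termList (kronecker f v) :=
  SparseInterp.interpolate_val H.eval H.correct (H.query_correct hv hS)

theorem Setting.length_termList_le (H : Setting f B U T D Δ) (v : Fin n → ℕ) :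
    (termList (kronecker f v)).length ≤ T := by
  rw [length_termList]
  exact (card_support_kronecker_le f v).trans H.card_le

theorem Setting.exp_le (H : Setting f B U T D Δ) {v : Fin n → ℕ} {S : ℕ} (hv : ∀ k, v k ≤ S)
    {t : ℕ × R} (ht : t ∈ termList (kronecker f v)) : t.1 ≤ S * D :=
  (le_natDegree_of_mem_termList ht).trans
    ((natDegree_kronecker_le f hv).trans (Nat.mul_le_mul_left _ H.degree_le))

theorem takeSample_val (H : Setting f B U T D Δ) (hg : Bounded g T D)
    (hΔ : ((2 * P * D : ℕ) : ℝ) ≤ Δ) (hp : 0 < ps.1) (hpP : ps.1 ≤ P) (hs : ∀ k, ps.2 k < ps.1) :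
    (takeSample B U g T D ps).val.p = ps.1 ∧ (takeSample B U g T D ps).val.s = ps.2 ∧
      (takeSample B U g T D ps).val.Valid f g T D P := by
  have hsP : ∀ k, ps.2 k ≤ P := fun k => (hs k).le.trans hpP
  have hsup : (maxVector ps.2).val ≤ P := maxVector_le hsP
  have hΔ' : (((maxVector ps.2).val * D : ℕ) : ℝ) ≤ Δ := by
    refine le_trans ?_ hΔ
    exact_mod_cast Nat.mul_le_mul_right _ (by omega)
  have hF := H.interpolate_val (le_maxVector ps.2) hΔ'
  have hFlen := H.length_termList_le ps.2
  have hFexp : ∀ t ∈ termList (kronecker f ps.2), t.1 ≤ P * D := fun t ht =>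
    (H.exp_le (le_maxVector ps.2) ht).trans (Nat.mul_le_mul_right _ hsup)
  have hHrep := diffSubst_represents (f := f) g ps.2
  have hHlen := diffSubst_length_le (termList (kronecker f ps.2)) g ps.2
  have hHexp : ∀ t ∈ diffSubst (termList (kronecker f ps.2)) g ps.2, t.1 ≤ integerBound T D P := by
    intro t ht
    have := diffSubst_exp_le hFexp (fun t ht => sum_mul_le_mul (hg.sum_le t ht) hsP) t ht
    unfold integerBound
    nlinarith
  have hmod := reduceMod_represents (n := n) ps.1 (diffSubst (termList (kronecker f ps.2)) g ps.2)
  -- Substitution followed by reduction modulo p is a single relabelling of exponents, which is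
  -- `residue` by definition.
  rw [hHrep.value_eq, ← Finsupp.mapDomain_comp] at hmod
  have hglen := hg.length_le
  have hmodlen := reduceMod_length_le (n := n) ps.1
    (diffSubst (termList (kronecker f ps.2)) g ps.2)
  have hmodexp : ∀ t ∈ (reduceMod (n := n) ps.1
      (diffSubst (termList (kronecker f ps.2)) g ps.2)).val, t.1 ≤ integerBound T D P := by
    intro t ht
    obtain ⟨t', ht', e⟩ := reduceMod_mem _ _ _ ht
    rw [← e]
    exact (Nat.mod_le _ _).trans (hHexp t' ht')
  have e := takeSample_val_eq (g := g) hF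
  generalize (takeSample B U g T D ps).val = x at *
  generalize (reduceMod (n := n) ps.1 (diffSubst (termList (kronecker f ps.2)) g ps.2)).val = m at *
  generalize diffSubst (termList (kronecker f ps.2)) g ps.2 = d at *
  subst e
  exact ⟨rfl, rfl, hp, hpP, hs, le_maxVector ps.2, hsup, hHrep, hmod, by dsimp only; omega,
    by dsimp only; omega, hHexp, hmodexp, rfl⟩

theorem takeSample_cost (H : Setting f B U T D Δ) (hg : Bounded g T D)
    (hΔ : ((2 * P * D : ℕ) : ℝ) ≤ Δ) (hp : 0 < ps.1) (hpP : ps.1 ≤ P) (hs : ∀ k, ps.2 k < ps.1) :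
    (∃ q, (takeSample B U g T D ps).cost.queries = [q] ∧ Query.Correct f T Δ q) ∧
      (takeSample B U g T D ps).cost.ringOps ≤ 19 * T ∧
      (takeSample B U g T D ps).cost.bitOps ≤
        (n + 1) * ((3 * T + 1) * ((3 * T).size + 1)) * (150 * stepCost n T D P) := by
  have hsP : ∀ k, ps.2 k ≤ P := fun k => (hs k).le.trans hpP
  have hsup : (maxVector ps.2).val ≤ P := maxVector_le hsP
  have hΔ' : (((maxVector ps.2).val * D : ℕ) : ℝ) ≤ Δ := by
    refine le_trans ?_ hΔ
    exact_mod_cast Nat.mul_le_mul_right _ (by omega)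
  have hPM : P ≤ integerBound T D P := by
    have := H.one_le_D
    unfold integerBound
    nlinarith
  have hPDM : P * D ≤ integerBound T D P := by unfold integerBound; nlinarith
  have hDM : D ≤ integerBound T D P := by
    have : 1 ≤ P := by omega
    nlinarith
  have hF := H.interpolate_val (le_maxVector ps.2) hΔ'
  have hFlen := H.length_termList_le ps.2
  have hFexp : ∀ t ∈ termList (kronecker f ps.2), t.1 ≤ integerBound T D P := fun t ht =>
    ((H.exp_le (le_maxVector ps.2) ht).trans (Nat.mul_le_mul_right _ hsup)).trans hPDM
  have hGlen := (substitute_length_le g ps.2).trans hg.length_le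
  have hGexp : ∀ t ∈ (substitute g ps.2).val, t.1 ≤ integerBound T D P := fun t ht => by
    obtain ⟨t', ht', e⟩ := substitute_mem _ _ _ ht
    exact e ▸ (sum_mul_le_mul (hg.sum_le t' ht') hsP).trans hPDM
  have hQ := H.query_correct (le_maxVector ps.2) hΔ'
  have hglen := hg.length_le
  have hHlen := diffSubst_length_le (termList (kronecker f ps.2)) g ps.2
  have hmlen := reduceMod_length_le (n := n) ps.1 (diffSubst (termList (kronecker f ps.2)) g ps.2)
  refine ⟨⟨_, takeSample_queries_eq, hQ⟩, ?_, ?_⟩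
  -- The constant 19 is 4 + 9 + 6: a substitution into 2T terms, a subtraction of lists with 3T
  -- terms in total, and a reduction of 3T terms.
  · rw [takeSample_ringOps_eq hF]
    have r3 := substitute_ringOps_le g ps.2
    have r4 := subTerms_ringOps_le (n := n) (termList (kronecker f ps.2)) (substitute g ps.2).val
    have r5 := reduceMod_ringOps_le (n := n) ps.1 (diffSubst (termList (kronecker f ps.2)) g ps.2)
    omega
  · rw [takeSample_bitOps_eq hF]
    have hK : ∀ {t : ℕ × R}, t.1 ≤ integerBound T D P →
        Key.size t.1 ≤ (capacity n (integerBound T D P)).size := fun h =>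
      Nat.size_le_size (le_capacity h)
    have hHexp := diffSubst_exp_le hFexp
      fun t ht => (sum_mul_le_mul (hg.sum_le t ht) hsP).trans hPDM
    have b1 := maxVector_bitOps_le fun k => (hsP k).trans hPM
    have b2 : mulBits (maxVector ps.2).val D ≤ unitCost n (integerBound T D P) :=
      mulBits_le_unitCost (le_capacity (hsup.trans hPM)) (le_capacity hDM)
    have b3 := substitute_bitOps_le g
      (fun t ht k => (apply_le_of_sum_le (hg.sum_le t ht) k).trans hDM) fun k => (hsP k).trans hPM
    have b4 := subTerms_bitOps_le (n := n) (termList (kronecker f ps.2)) (substitute g ps.2).val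
      (fun t ht => hK (hFexp t ht)) fun t ht => hK (hGexp t ht)
    have b5 := reduceMod_bitOps_le (n := n) _ (hpP.trans hPM) hHexp
    have hw := size_succ_le_unitCost (le_refl (capacity n (integerBound T D P)))
    have d3 := succ_mul_size_succ_le (T := T) (x := g.length) (by omega)
    have d4 := succ_mul_size_succ_le (T := T)
      (x := (termList (kronecker f ps.2)).length + (substitute g ps.2).val.length) (by omega)
    have d5 := succ_mul_size_succ_le (T := T)
      (x := (diffSubst (termList (kronecker f ps.2)) g ps.2).length) (by omega)
    have hq1 : 3 * T + 1 ≤ (3 * T + 1) * ((3 * T).size + 1) := Nat.le_mul_of_pos_right _ (by omega)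
    have d6 : (reduceMod (n := n) ps.1 (diffSubst (termList (kronecker f ps.2)) g ps.2)).val.length
        + 1 ≤ (3 * T + 1) * ((3 * T).size + 1) := by omega
    unfold stepCost
    generalize unitCost n (integerBound T D P) = w at *
    generalize (3 * T + 1) * ((3 * T).size + 1) = q at *
    rw [mul_assoc (n + 1)] at b3
    have c3 := b3.trans (Nat.mul_le_mul_right _ (Nat.mul_le_mul_left _ d3))
    have c4 := b4.trans (Nat.mul_le_mul d4
      (show 4 * (capacity n (integerBound T D P)).size + 34 ≤ 38 * w by omega))
    have c5 := b5.trans (Nat.mul_le_mul_right _ d5)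
    have hq : 1 ≤ q := by omega
    clear b3 b4 b5 d3 d4 d5 hK hHexp hQ hF hFexp hGexp
    have hqw : w ≤ q * w := Nat.le_mul_of_pos_left _ hq
    have hqw' : q ≤ q * w := Nat.le_mul_of_pos_right _ (by omega)
    have c6 : q * w ≤ (n + 1) * (q * w) := Nat.le_mul_of_pos_left _ (by omega)
    have c7 : (n + 1) * (4 * w) ≤ (n + 1) * (4 * (q * w)) := by gcongr
    have x1 : (n + 1) * (4 * (q * w)) = 4 * ((n + 1) * (q * w)) := by ring
    have x3 : (n + 1) * q * (40 * w) = 40 * ((n + 1) * (q * w)) := by ring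
    have x4 : q * (38 * w) = 38 * (q * w) := by ring
    have x5 : q * (40 * w) = 40 * (q * w) := by ring
    have x6 : (n + 1) * q * (150 * w) = 150 * ((n + 1) * (q * w)) := by ring
    rw [x1] at c7
    rw [x3] at c3
    rw [x4] at c4
    rw [x5] at c5
    rw [x6]
    generalize (n + 1) * (q * w) = X at *
    generalize q * w = Y at *
    omega

end TakeSample


/-! ## The second half of `halfPoly` -/

section Recover

variable {n : ℕ} {R : Type u} {E : Type v} [CommRing R] [CommRing E]
  {f : MvPolynomial (Fin n) R} {B : (Fin n → E) → E} {U : UnivInterpolator R E} {T D P : ℕ}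
  {Δ : ℝ} {g : List ((Fin n → ℕ) × R)} {x : Sample n R}

/-- The polynomial `(f - g)(x^{s + p I_k})`, where `G` is `g(x^{s + p I_k})`. -/
noncomputable def shiftedDiff (B : (Fin n → E) → E) (U : UnivInterpolator R E) (T D : ℕ)
    (x : Sample n R) (k : Fin n) (G : List (ℕ × R)) : Timed n (List (ℕ × R)) :=
  (natAdd (x.s k) x.p).bind fun sk => (natMax x.sup sk).bind fun sup =>
  (natMul sup D).bind fun d =>
  (interpolate B U (Function.update x.s k sk) d T).bind fun F => subTerms F G

/-- The last two steps of `halfPoly`, for the sample `x`. -/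
noncomputable def recover (B : (Fin n → E) → E) (U : UnivInterpolator R E)
    (g : List ((Fin n → ℕ) × R)) (T D : ℕ) (x : Sample n R) :
    Timed n (List ((Fin n → ℕ) × R)) :=
  (polySubs g x.s x.p).bind fun gs =>
  (Timed.tabulate fun k => shiftedDiff B U T D x k (gs k)).bind fun G =>
  tsTerms x.Fmod x.F G x.p x.s D

@[simp] theorem interpolate_bitOps (v : Fin n → ℕ) (d τ : ℕ) :
    (interpolate B U v d τ).cost.bitOps = 0 := rfl

@[simp] theorem interpolate_ringOps (v : Fin n → ℕ) (d τ : ℕ) :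
    (interpolate B U v d τ).cost.ringOps = 0 := rfl

/-- The reason for the shift by p: the residue of the exponent is unchanged while its value grows by
p e_k, from which e_k can be read off. -/
theorem sum_mul_update_add (e s : Fin n → ℕ) (k : Fin n) (p : ℕ) :
    ∑ j, e j * Function.update s k (s k + p) j = ∑ j, e j * s j + e k * p := by
  have : Function.update s k (s k + p) = s + Pi.single k p := by
    ext j
    rcases eq_or_ne j k with rfl | h <;> simp [*]
  simp [this, mul_add, Finset.sum_add_distrib, Pi.single_apply]

theorem recover_val (B : (Fin n → E) → E) (U : UnivInterpolator R E) : (recover B U g T D x).val =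
    (tsTerms x.Fmod x.F
      (fun k => (shiftedDiff B U T D x k ((polySubs g x.s x.p).val k)).val) x.p x.s D).val := by
  simp only [recover, Timed.bind_val, Timed.tabulate_val]

theorem recover_bounded (B : (Fin n → E) → E) (U : UnivInterpolator R E) :
    (recover B U g T D x).val.length ≤ x.Fmod.length ∧
      ∀ t ∈ (recover B U g T D x).val, ∑ k, t.1 k ≤ D := by
  rw [recover_val]
  exact ⟨tsTerms_length_le _ _ _ _ _ _, tsTerms_sum_le _ _ _ _ _ _⟩

variable [Algebra R E]

/-- A shifted coordinate is below 2p, which explains the factor 2 in the degree bound 2PD. The bound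
passed on uses max(‖s‖, s_k + p), which dominates all coordinates of the shifted vector. -/
theorem shiftedDiff_query (hΔ : ((2 * P * D : ℕ) : ℝ) ≤ Δ)
    (hx : x.Valid f g T D P) (k : Fin n) :
    (∀ j, Function.update x.s k (x.s k + x.p) j ≤ max x.sup (x.s k + x.p)) ∧
      ((max x.sup (x.s k + x.p) * D : ℕ) : ℝ) ≤ Δ := by
  have hp := hx.p_le
  have hs := hx.s_lt k
  have hsup := hx.sup_le
  refine ⟨fun j => ?_, le_trans ?_ hΔ⟩
  · rcases eq_or_ne j k with rfl | h
    · simp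
    · rw [Function.update_of_ne h]
      exact (hx.s_le_sup j).trans (le_max_left _ _)
  · exact_mod_cast Nat.mul_le_mul_right _ (by omega)

theorem shiftedDiff_spec (H : Setting f B U T D Δ) (hg : Bounded g T D)
    (hΔ : ((2 * P * D : ℕ) : ℝ) ≤ Δ) (hx : x.Valid f g T D P) (k : Fin n) :
    Represents (shiftedDiff B U T D x k ((polySubs g x.s x.p).val k)).val
        ((coeffFun f - value g).mapDomain fun e => ∑ j, e j * x.s j + e k * x.p) ∧
      (shiftedDiff B U T D x k ((polySubs g x.s x.p).val k)).val.length ≤ 3 * T ∧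
      (∀ t ∈ (shiftedDiff B U T D x k ((polySubs g x.s x.p).val k)).val,
        t.1 ≤ integerBound T D P) ∧
      (∃ q, (shiftedDiff B U T D x k ((polySubs g x.s x.p).val k)).cost.queries = [q] ∧
        Query.Correct f T Δ q) ∧
      (shiftedDiff B U T D x k ((polySubs g x.s x.p).val k)).cost.ringOps ≤ 9 * T ∧
      (shiftedDiff B U T D x k ((polySubs g x.s x.p).val k)).cost.bitOps ≤
        (3 * T + 1) * ((3 * T).size + 1) * (43 * stepCost n T D P) := by
  obtain ⟨hv, hS⟩ := shiftedDiff_query hΔ hx k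
  have hF := H.interpolate_val hv hS
  have hQ := H.query_correct hv hS
  have hp := hx.p_le
  have hs := hx.s_lt k
  have hsup := hx.sup_le
  have hm : max x.sup (x.s k + x.p) ≤ 2 * P := by omega
  have hFlen := H.length_termList_le (Function.update x.s k (x.s k + x.p))
  have h2PD : 2 * P * D ≤ integerBound T D P := Nat.le_add_right _ _
  have hFexp : ∀ t ∈ termList (kronecker f (Function.update x.s k (x.s k + x.p))),
      t.1 ≤ integerBound T D P := fun t ht =>
    ((H.exp_le hv ht).trans (Nat.mul_le_mul_right _ hm)).trans h2PD
  have hFrep := termList_kronecker_represents f (Function.update x.s k (x.s k + x.p))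
  simp only [sum_mul_update_add] at hFrep
  have hGrep := polySubs_represents g x.s x.p k
  have hGlen := (polySubs_length_le g x.s x.p k).trans hg.length_le
  have hGexp : ∀ t ∈ (polySubs g x.s x.p).val k, t.1 ≤ integerBound T D P := by
    intro t ht
    obtain ⟨t', ht', e⟩ := polySubs_mem _ _ _ _ _ ht
    have h1 := sum_mul_le_mul (hg.sum_le t' ht') fun j => (hx.s_lt j).le.trans hp
    have h2 := Nat.mul_le_mul (apply_le_of_sum_le (hg.sum_le t' ht') k) hp
    rw [← e]
    refine le_trans ?_ h2PD
    have : 2 * P * D = P * D + D * P := by ring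
    omega
  have hD : max x.sup (x.s k + x.p) ≤ integerBound T D P := by
    have : 2 * P ≤ 2 * P * D := Nat.le_mul_of_pos_right _ H.one_le_D
    omega
  have hDM : D ≤ integerBound T D P := by
    have : 1 ≤ 2 * P := by have := hx.p_pos; omega
    have : D ≤ 2 * P * D := Nat.le_mul_of_pos_left _ this
    omega
  unfold stepCost
  generalize (polySubs g x.s x.p).val k = G at *
  have hval : (shiftedDiff B U T D x k G).val = (subTerms (n := n)
      (termList (kronecker f (Function.update x.s k (x.s k + x.p)))) G).val := by
    simp only [shiftedDiff, natAdd, natMax, natMul, Timed.bind_val, Timed.bits_val, hF]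
  have hbits : (shiftedDiff B U T D x k G).cost.bitOps = ((x.s k).size + x.p.size + 1) +
      ((x.sup.size + (x.s k + x.p).size + 1) + (mulBits (max x.sup (x.s k + x.p)) D +
        (0 + (subTerms (n := n)
          (termList (kronecker f (Function.update x.s k (x.s k + x.p)))) G).cost.bitOps))) := by
    simp only [shiftedDiff, natAdd, natMax, natMul, Timed.bits_val, Timed.bind_cost, Cost.add_bitOps,
      Timed.bits_bitOps, hF, interpolate_bitOps]
  have hring : (shiftedDiff B U T D x k G).cost.ringOps = 0 + (0 + (0 + (0 + (subTerms (n := n)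
      (termList (kronecker f (Function.update x.s k (x.s k + x.p)))) G).cost.ringOps))) := by
    simp only [shiftedDiff, natAdd, natMax, natMul, Timed.bits_val, Timed.bind_cost, Cost.add_ringOps,
      Timed.bits_ringOps, hF, interpolate_ringOps]
  have hquery : (shiftedDiff B U T D x k G).cost.queries =
      [⟨Function.update x.s k (x.s k + x.p), max x.sup (x.s k + x.p) * D, T⟩] := by
    simp [shiftedDiff, interpolate]
  rw [hval, hbits, hring, hquery]
  have e1 := subTerms_represents (n := n)
    (termList (kronecker f (Function.update x.s k (x.s k + x.p)))) G
  have e2 := subTerms_length_le (n := n)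
    (termList (kronecker f (Function.update x.s k (x.s k + x.p)))) G
  have e3 := subTerms_mem (n := n)
    (termList (kronecker f (Function.update x.s k (x.s k + x.p)))) G
  have e4 := subTerms_ringOps_le (n := n)
    (termList (kronecker f (Function.update x.s k (x.s k + x.p)))) G
  have hK : ∀ {t : ℕ × R}, t.1 ≤ integerBound T D P →
      Key.size t.1 ≤ (capacity n (integerBound T D P)).size := fun h =>
    Nat.size_le_size (le_capacity h)
  have e5 := subTerms_bitOps_le (n := n) _ G (fun t ht => hK (hFexp t ht))
    fun t ht => hK (hGexp t ht)
  have d1 := succ_mul_size_succ_le (T := T) (x := (termList (kronecker f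
    (Function.update x.s k (x.s k + x.p)))).length + G.length) (by omega)
  have hw := size_succ_le_unitCost (le_refl (capacity n (integerBound T D P)))
  have w1 := size_succ_le_unitCost (n := n)
    (le_capacity (((hs.le.trans hp).trans (Nat.le_mul_of_pos_left P two_pos)).trans
      ((Nat.le_mul_of_pos_right _ H.one_le_D).trans h2PD)))
  have w2 := size_succ_le_unitCost (n := n)
    (le_capacity ((hp.trans (Nat.le_mul_of_pos_left P two_pos)).trans
      ((Nat.le_mul_of_pos_right _ H.one_le_D).trans h2PD)))
  have w3 := size_succ_le_unitCost (n := n) (le_capacity ((le_max_left _ _).trans hD))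
  have w4 := size_succ_le_unitCost (n := n) (le_capacity ((le_max_right _ _).trans hD))
  have w5 : mulBits (max x.sup (x.s k + x.p)) D ≤ unitCost n (integerBound T D P) :=
    mulBits_le_unitCost (le_capacity hD) (le_capacity hDM)
  rw [hFrep.value_eq, hGrep.value_eq, ← mapDomain_sub] at e1
  clear hval hbits hring hquery hF
  generalize termList (kronecker f (Function.update x.s k (x.s k + x.p))) = F at *
  generalize subTerms (n := n) F G = S at *
  refine ⟨e1, by omega, ?_, ⟨_, rfl, hQ⟩, by omega, ?_⟩
  · intro t ht
    obtain ⟨t', ht', e⟩ := e3 t ht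
    rw [← e]
    exact (List.mem_append.1 ht').elim (hFexp t') (hGexp t')
  · clear hFexp hGexp hK hΔ hS hQ e1 e3
    have hq1 : 1 ≤ (3 * T + 1) * ((3 * T).size + 1) := Nat.mul_pos (by omega) (by omega)
    generalize unitCost n (integerBound T D P) = w at *
    generalize (3 * T + 1) * ((3 * T).size + 1) = q at *
    have c5 := e5.trans (Nat.mul_le_mul d1
      (show 4 * (capacity n (integerBound T D P)).size + 34 ≤ 38 * w by omega))
    have x1 : q * (38 * w) = 38 * (q * w) := by ring
    have x2 : q * (43 * w) = 43 * (q * w) := by ring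
    have hqw : w ≤ q * w := Nat.le_mul_of_pos_left _ hq1
    rw [x1] at c5
    rw [x2]
    omega

theorem two_mul_card_support_sub_recover_le (H : Setting f B U T D Δ) (hg : Bounded g T D)
    (hΔ : ((2 * P * D : ℕ) : ℝ) ≤ Δ) (hx : x.Valid f g T D P)
    (hD : ∀ e ∈ (coeffFun f - value g).support, ∑ k, e k ≤ D) :
    2 * (coeffFun f - value g - value (recover B U g T D x).val).support.card ≤
      3 * (colliding (residue x.p x.s) (coeffFun f - value g).support).card := by
  rw [recover_val]
  exact two_mul_card_support_sub_tsTerms_le hx.p_pos hx.represents hx.represents_mod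
    (fun k => (shiftedDiff_spec H hg hΔ hx k).1) hD

theorem recover_cost (H : Setting f B U T D Δ) (hg : Bounded g T D)
    (hΔ : ((2 * P * D : ℕ) : ℝ) ≤ Δ) (hx : x.Valid f g T D P) :
    (recover B U g T D x).cost.queries.length = n ∧
      (∀ q ∈ (recover B U g T D x).cost.queries, Query.Correct f T Δ q) ∧
      (recover B U g T D x).cost.ringOps ≤ n * (13 * T) ∧
      (recover B U g T D x).cost.bitOps ≤
        (n + 1) * (P + (3 * T + 1) * ((3 * T).size + 1) * (150 * stepCost n T D P)) := by
  have hspec := shiftedDiff_spec H hg hΔ hx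
  have hPM : P ≤ integerBound T D P := by
    have : 2 * P ≤ 2 * P * D := Nat.le_mul_of_pos_right _ H.one_le_D
    unfold integerBound
    omega
  have hPDM : P * D ≤ integerBound T D P := by
    unfold integerBound
    rw [mul_assoc]
    omega
  have hDM : D ≤ integerBound T D P :=
    (Nat.le_mul_of_pos_left D (hx.p_pos.trans_le hx.p_le)).trans hPDM
  have hsM : ∀ k, x.s k ≤ integerBound T D P := fun k => ((hx.s_lt k).le.trans hx.p_le).trans hPM
  have hpM := hx.p_le.trans hPM
  have b1 := polySubs_bitOps_le (M := integerBound T D P) (p := x.p) (s := x.s) g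
    (fun t ht k => (apply_le_of_sum_le (hg.sum_le t ht) k).trans hDM) hsM hpM
    fun t ht => (sum_mul_le_mul (hg.sum_le t ht) fun j => (hx.s_lt j).le.trans hx.p_le).trans hPDM
  have r1 := polySubs_ringOps_le g x.s x.p
  have q1 := polySubs_queries g x.s x.p
  have hglen := hg.length_le
  have d1 := succ_mul_size_succ_le (T := T) (x := g.length) (by omega)
  have hq1 : 3 * T + 1 ≤ (3 * T + 1) * ((3 * T).size + 1) := Nat.le_mul_of_pos_right _ (by omega)
  have hw := size_succ_le_unitCost (le_refl (capacity n (integerBound T D P)))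
  unfold recover
  unfold stepCost at hspec ⊢
  simp only [Timed.bind_cost, Cost.add_queries, Cost.add_ringOps, Cost.add_bitOps,
    Timed.tabulate_val, tsTerms_queries, tsTerms_ringOps, q1, List.nil_append, List.append_nil,
    add_zero]
  have b2 := Timed.tabulate_bitOps_le fun k => (hspec k).2.2.2.2.2
  have r2 := Timed.tabulate_ringOps_le fun k => (hspec k).2.2.2.2.1
  have b3 := tsTerms_bitOps_le (Fmod := x.Fmod) (F := x.F)
    (G := fun k => (shiftedDiff B U T D x k ((polySubs g x.s x.p).val k)).val) hpM hDM hsM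
    hx.exp_mod_le hx.exp_le (fun k => (hspec k).2.2.1) hx.length_mod_le hx.length_le
    fun k => (hspec k).2.1
  have q2 : ∀ k, (shiftedDiff B U T D x k ((polySubs g x.s x.p).val k)).cost.queries.length = 1 ∧
      ∀ q ∈ (shiftedDiff B U T D x k ((polySubs g x.s x.p).val k)).cost.queries,
        Query.Correct f T Δ q := by
    intro k
    obtain ⟨q, hq, hq'⟩ := (hspec k).2.2.2.1
    rw [hq]
    simpa using hq'
  clear hspec
  have hpP := hx.p_le
  generalize (polySubs g x.s x.p).val = gs at *
  refine ⟨?_, ?_, ?_, ?_⟩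
  · rw [Timed.tabulate_queries, List.length_flatten, List.map_ofFn]
    simp [Function.comp_def, q2]
  · rw [Timed.tabulate_queries]
    intro q hq
    obtain ⟨l, hl, hq⟩ := List.mem_flatten.1 hq
    obtain ⟨k, rfl⟩ := (List.mem_ofFn' _ _).1 hl
    exact (q2 k).2 q hq
  -- For each k, 4T operations go into the substitution into the approximation and 9T into the
  -- subtraction.
  · have : n * (2 * g.length) ≤ n * (4 * T) := Nat.mul_le_mul_left _ (by omega)
    have x1 : n * (4 * T) + n * (9 * T) = n * (13 * T) := by ring
    omega
  · clear q2
    generalize unitCost n (integerBound T D P) = w at *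
    generalize (3 * T + 1) * ((3 * T).size + 1) = q at *
    rw [mul_assoc (n + 1)] at b1
    have c1 := b1.trans (Nat.mul_le_mul_right _ (Nat.mul_le_mul_left _ d1))
    have c3 := b3.trans (Nat.mul_le_mul_left _ (Nat.add_le_add hpP (Nat.mul_le_mul_right _ hq1)))
    have hqw : 1 ≤ q * w := Nat.mul_pos (by omega) (by omega)
    have x1 : (n + 1) * q * (50 * w) = 50 * (n * (q * w)) + 50 * (q * w) := by ring
    have x2 : n * (q * (43 * w) + 1) = 43 * (n * (q * w)) + n := by ring
    have x3 : (n + 1) * (P + q * (40 * w)) = n * P + P + 40 * (n * (q * w)) + 40 * (q * w) := by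
      ring
    have x4 : (n + 1) * (P + q * (150 * w)) =
        n * P + P + 150 * (n * (q * w)) + 150 * (q * w) := by ring
    have x5 : n ≤ n * (q * w) := Nat.le_mul_of_pos_right _ hqw
    rw [x1] at c1
    rw [x2] at b2
    rw [x3] at c3
    rw [x4]
    omega

end Recover


/-! ## One run of `halfPoly` -/

theorem Timed.bind_assoc {n : ℕ} {α : Type*} {β : Type*} {γ : Type*} (x : Timed n α)
    (y : α → Timed n β) (z : β → Timed n γ) :
    (x.bind y).bind z = x.bind fun a => (y a).bind z := by
  unfold Timed.bind
  congr 1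
  change Cost.mk _ _ _ = Cost.mk _ _ _
  simp [add_assoc]

section Finish

variable {n : ℕ} {R : Type u} {E : Type v} [CommRing R] [CommRing E]
  {f : MvPolynomial (Fin n) R} {B : (Fin n → E) → E} {U : UnivInterpolator R E} {T D P : ℕ}
  {Δ : ℝ} {g : List ((Fin n → ℕ) × R)} {x : Sample n R} {T₁ : ℕ}

/-- The steps of `halfPoly` after the choice of the sample `x`. -/
noncomputable def finishWith (B : (Fin n → E) → E) (U : UnivInterpolator R E)
    (g : List ((Fin n → ℕ) × R)) (T T₁ D : ℕ) (x : Sample n R) :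
    Timed n (Option (List ((Fin n → ℕ) × R))) :=
  (natLe x.count T₁).bind fun ok =>
    if ok then (recover B U g T D x).bind fun TS => Timed.pure (some TS) else Timed.pure none

/-- The steps of `halfPoly` after the choice of the pairs. -/
noncomputable def finish (B : (Fin n → E) → E) (U : UnivInterpolator R E)
    (g : List ((Fin n → ℕ) × R)) (T T₁ D : ℕ) (pairs : List (ℕ × (Fin n → ℕ))) :
    Timed n (Option (List ((Fin n → ℕ) × R))) :=
  (removeRepeated pairs).bind fun pairs' =>
  (Timed.traverse (takeSample B U g T D) pairs').bind fun samples =>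
  (bestSample samples).bind fun best =>
  best.elim (Timed.pure none) (finishWith B U g T T₁ D)

/-- The first steps of `halfPoly`: the number of pairs, the number of primes and the primes. -/
noncomputable def setup (n T T₁ D : ℕ) (ν : ℝ) : Timed n (ℕ × ℕ × List ℕ) :=
  (evalFormula (T.size + T₁.size) (sampleCount T₁ ν)).bind fun l =>
  (evalFormula (T₁.size + D.size) (primeCount T₁ D)).bind fun N =>
  (natSub T₁ 1).bind fun T₀ => (natMul 32 T₀).bind fun lo =>
  (firstPrimes lo N).bind fun primes => Timed.pure (l, N, primes)

/-- Isolates the randomness: a deterministic setup, the independent draws, and a deterministic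
conclusion from the drawn pairs. -/
theorem halfPoly_eq (B : (Fin n → E) → E) (U : UnivInterpolator R E)
    (g : List ((Fin n → ℕ) × R)) (T T₁ D : ℕ) (ν : ℝ) : halfPoly B U g T T₁ D ν =
    RComp.bind (RComp.lift (setup n T T₁ D ν)) fun par =>
    RComp.bind (RComp.repeated (drawPair par.2.2 par.2.1) par.1) fun pairs =>
    RComp.lift (finish B U g T T₁ D pairs) := by
  unfold halfPoly setup
  congr 1
  funext par
  congr 1
  funext pairs
  congr 1
  unfold finish
  congr 1
  funext pairs'
  congr 1
  funext samples
  congr 1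
  funext best
  rcases best with _ | x
  · rfl
  · simp only [Option.elim, finishWith, recover, shiftedDiff, Timed.bind_assoc]

theorem finishWith_val (B : (Fin n → E) → E) (U : UnivInterpolator R E) :
    (finishWith B U g T T₁ D x).val =
      if x.count ≤ T₁ then some (recover B U g T D x).val else none := by
  simp only [finishWith, Timed.bind_val, natLe, Timed.bits_val, decide_eq_true_eq]
  split <;> rfl

theorem finishWith_cost (B : (Fin n → E) → E) (U : UnivInterpolator R E) :
    ((finishWith B U g T T₁ D x).cost.queries = (recover B U g T D x).cost.queries ∨
      (finishWith B U g T T₁ D x).cost.queries = []) ∧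
    (finishWith B U g T T₁ D x).cost.ringOps ≤ (recover B U g T D x).cost.ringOps ∧
    (finishWith B U g T T₁ D x).cost.bitOps ≤
      x.count.size + T₁.size + 1 + (recover B U g T D x).cost.bitOps := by
  simp only [finishWith, Timed.bind_cost, natLe, Timed.bits_val, decide_eq_true_eq]
  split <;> simp

variable [Algebra R E]

/-- Removing repetitions keeps the set of pairs, so the chosen sample is maximal among all drawn
pairs. Its validity does not depend on how many collisions it has. -/
theorem exists_best_sample (H : Setting f B U T D Δ) (hg : Bounded g T D)
    (hΔ : ((2 * P * D : ℕ) : ℝ) ≤ Δ) {pairs : List (ℕ × (Fin n → ℕ))} (hne : pairs ≠ [])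
    (hpairs : ∀ ps ∈ pairs, 0 < ps.1 ∧ ps.1 ≤ P ∧ ∀ k, ps.2 k < ps.1) :
    ∃ x : Sample n R, (bestSample
        (Timed.traverse (takeSample B U g T D) (removeRepeated pairs).val).val).val = some x ∧
      x.Valid f g T D P ∧ ∀ ps ∈ pairs,
        ((coeffFun f - value g).mapDomain (residue ps.1 ps.2)).support.card ≤ x.count := by
  rw [Timed.traverse_val]
  have hmem : ∀ ps, ps ∈ (removeRepeated pairs).val ↔ ps ∈ pairs := mem_removeRepeated pairs
  have hne' : ((removeRepeated pairs).val.map fun ps => (takeSample B U g T D ps).val) ≠ [] := by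
    rw [Ne, List.map_eq_nil_iff]
    intro h
    obtain ⟨ps, hps⟩ := List.exists_mem_of_ne_nil _ hne
    rw [← hmem, h] at hps
    cases hps
  have hval : ∀ ps ∈ pairs, (takeSample B U g T D ps).val.p = ps.1 ∧
      (takeSample B U g T D ps).val.s = ps.2 ∧
      (takeSample B U g T D ps).val.Valid f g T D P := fun ps hps =>
    takeSample_val H hg hΔ (hpairs ps hps).1 (hpairs ps hps).2.1 (hpairs ps hps).2.2
  obtain ⟨x, hx, e, hmax⟩ := bestSample_val hne'
  refine ⟨x, e, ?_, fun ps hps => ?_⟩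
  · obtain ⟨ps, hps, rfl⟩ := List.mem_map.1 hx
    exact (hval ps ((hmem ps).1 hps)).2.2
  · have h1 := hmax _ (List.mem_map.2 ⟨ps, (hmem ps).2 hps, rfl⟩)
    obtain ⟨e1, e2, h2⟩ := hval ps hps
    rw [← e1, ← e2, ← h2.represents_mod.length_eq, ← h2.count_eq]
    exact h1

/-- Bound for the bit operations of `finish`, with `l` pairs. -/
def finishBits (n T D P l : ℕ) : ℕ :=
  (n + 1) * ((l + 1) ^ 2 * (P + (3 * T + 1) * ((3 * T).size + 1) * (170 * stepCost n T D P)))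

theorem finish_cost (H : Setting f B U T D Δ) (hg : Bounded g T D)
    (hΔ : ((2 * P * D : ℕ) : ℝ) ≤ Δ) (hT₁ : T₁ ≤ T) {pairs : List (ℕ × (Fin n → ℕ))}
    (hne : pairs ≠ []) (hpairs : ∀ ps ∈ pairs, 0 < ps.1 ∧ ps.1 ≤ P ∧ ∀ k, ps.2 k < ps.1) :
    (finish B U g T T₁ D pairs).cost.queries.length ≤ pairs.length + n ∧
      (∀ q ∈ (finish B U g T T₁ D pairs).cost.queries, Query.Correct f T Δ q) ∧
      (finish B U g T T₁ D pairs).cost.ringOps ≤ pairs.length * (19 * T) + n * (13 * T) ∧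
      (finish B U g T T₁ D pairs).cost.bitOps ≤ finishBits n T D P pairs.length := by
  obtain ⟨x, hx, hxv, -⟩ := exists_best_sample H hg hΔ hne hpairs
  obtain ⟨ps₀, hps₀⟩ := List.exists_mem_of_ne_nil _ hne
  have hP : 0 < P := (hpairs _ hps₀).1.trans_le (hpairs _ hps₀).2.1
  have hPM : P ≤ integerBound T D P := by
    have : 2 * P ≤ 2 * P * D := Nat.le_mul_of_pos_right _ H.one_le_D
    unfold integerBound
    omega
  have hTM : 3 * T ≤ integerBound T D P := Nat.le_add_left _ _
  have hmem : ∀ ps ∈ (removeRepeated pairs).val, ps ∈ pairs := fun ps =>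
    (mem_removeRepeated pairs ps).1
  have hlen := removeRepeated_length_le pairs
  have htake : ∀ ps ∈ (removeRepeated pairs).val, _ := fun ps hps =>
    takeSample_cost H hg hΔ (hpairs ps (hmem ps hps)).1 (hpairs ps (hmem ps hps)).2.1
      (hpairs ps (hmem ps hps)).2.2
  have hcount : ∀ z ∈ (Timed.traverse (takeSample B U g T D) (removeRepeated pairs).val).val,
      z.count ≤ integerBound T D P := by
    rw [Timed.traverse_val]
    intro z hz
    obtain ⟨ps, hps, rfl⟩ := List.mem_map.1 hz
    have hp := hpairs ps (hmem ps hps)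
    have := (takeSample_val H hg hΔ hp.1 hp.2.1 hp.2.2).2.2
    rw [this.count_eq]
    exact this.length_mod_le.trans hTM
  have b1 := removeRepeated_bitOps_le pairs (M := integerBound T D P) fun ps hps =>
    ⟨(hpairs ps hps).2.1.trans hPM, fun k =>
      (((hpairs ps hps).2.2 k).le.trans (hpairs ps hps).2.1).trans hPM⟩
  have b2 := Timed.traverse_bitOps_le fun ps hps => (htake ps hps).2.2
  have r2 := Timed.traverse_ringOps_le fun ps hps => (htake ps hps).2.1
  have b3 := bestSample_bitOps_le (n := n) _ hcount
  have hl3 : (Timed.traverse (takeSample B U g T D) (removeRepeated pairs).val).val.length =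
      (removeRepeated pairs).val.length := by rw [Timed.traverse_val, List.length_map]
  rw [hl3] at b3
  obtain ⟨q4, r4, b4⟩ := finishWith_cost (g := g) (T := T) (T₁ := T₁) (D := D) (x := x) B U
  obtain ⟨q5, q5', r5, b5⟩ := recover_cost H hg hΔ hxv
  have hq4 : (finishWith B U g T T₁ D x).cost.queries.length ≤ n ∧
      ∀ q ∈ (finishWith B U g T T₁ D x).cost.queries, Query.Correct f T Δ q := by
    rcases q4 with q4 | q4 <;> rw [q4]
    · exact ⟨q5.le, q5'⟩
    · simp
  have w1 : x.count.size + 1 ≤ unitCost n (integerBound T D P) :=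
    size_succ_le_unitCost (le_capacity (by rw [hxv.count_eq]; exact hxv.length_mod_le.trans hTM))
  have w2 : T₁.size + 1 ≤ unitCost n (integerBound T D P) :=
    size_succ_le_unitCost (le_capacity (by omega))
  have q2 : (Timed.traverse (takeSample B U g T D) (removeRepeated pairs).val).cost.queries.length
      = (removeRepeated pairs).val.length ∧
      ∀ q ∈ (Timed.traverse (takeSample B U g T D) (removeRepeated pairs).val).cost.queries,
        Query.Correct f T Δ q := by
    rw [Timed.traverse_queries, List.length_flatMap]
    constructor
    · rw [List.map_congr_left (g := fun _ => 1), List.map_const', List.sum_replicate, smul_eq_mul,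
        mul_one]
      intro ps hps
      obtain ⟨q, hq, -⟩ := (htake ps hps).1
      rw [hq]
      rfl
    · intro q hq
      obtain ⟨ps, hps, hq⟩ := List.mem_flatMap.1 hq
      obtain ⟨q', hq', h⟩ := (htake ps hps).1
      rw [hq', List.mem_singleton] at hq
      exact hq ▸ h
  clear htake hcount
  have hq1 : 1 ≤ (3 * T + 1) * ((3 * T).size + 1) := Nat.mul_pos (by omega) (by omega)
  unfold finish finishBits
  unfold stepCost at *
  simp only [Timed.bind_cost, Cost.add_queries, Cost.add_ringOps, Cost.add_bitOps, hx,
    removeRepeated_queries, removeRepeated_ringOps, bestSample_queries, bestSample_ringOps,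
    List.nil_append, Option.elim, List.length_append, List.mem_append]
  refine ⟨by omega, fun q hq => hq.elim (q2.2 q) (hq4.2 q), ?_, ?_⟩
  · have := Nat.mul_le_mul_right (19 * T) hlen
    omega
  · clear q2 q4 q5 hq4 q5' hx
    generalize unitCost n (integerBound T D P) = w at *
    generalize (3 * T + 1) * ((3 * T).size + 1) = q at *
    generalize (removeRepeated pairs).val = L at *
    generalize pairs.length = l at *
    have hqw : w ≤ q * w := Nat.le_mul_of_pos_left _ hq1
    have hl1 : l + 1 ≤ (l + 1) ^ 2 := Nat.le_self_pow two_ne_zero _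
    have x1 : (l + 1) ^ 2 * ((n + 1) * (4 * w)) = 4 * ((n + 1) * ((l + 1) ^ 2 * w)) := by ring
    have c1 : (n + 1) * ((l + 1) ^ 2 * w) ≤ (n + 1) * ((l + 1) ^ 2 * (q * w)) := by gcongr
    have c2 : L.length * ((n + 1) * q * (150 * w) + 1) ≤ l * ((n + 1) * q * (150 * w) + 1) :=
      Nat.mul_le_mul_right _ hlen
    have c3 : L.length * (3 * w) ≤ l * (3 * w) := Nat.mul_le_mul_right _ hlen
    have x2 : l * ((n + 1) * q * (150 * w) + 1) = 150 * ((n + 1) * (l * (q * w))) + l := by ring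
    have x3 : l * (3 * w) = 3 * (l * w) := by ring
    have c4 : l * w ≤ (n + 1) * (l * (q * w)) :=
      (Nat.mul_le_mul_left l hqw).trans (Nat.le_mul_of_pos_left _ (by omega))
    have c4' : l ≤ l * w := Nat.le_mul_of_pos_right _ (by omega)
    have x5 : (n + 1) * (P + q * (150 * w)) = (n + 1) * P + 150 * ((n + 1) * (q * w)) := by ring
    have c5 : w ≤ (n + 1) * (q * w) := hqw.trans (Nat.le_mul_of_pos_left _ (by omega))
    have x6 : (n + 1) * ((l + 1) ^ 2 * (P + q * (170 * w))) =
        (n + 1) * ((l + 1) ^ 2 * P) + 170 * ((n + 1) * ((l + 1) ^ 2 * (q * w))) := by ring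
    have c6 : (n + 1) * P ≤ (n + 1) * ((l + 1) ^ 2 * P) :=
      Nat.mul_le_mul_left _ (Nat.le_mul_of_pos_left _ (by positivity))
    have c7 : (n + 1) * (l * (q * w)) + (n + 1) * (q * w) ≤
        (n + 1) * ((l + 1) ^ 2 * (q * w)) := by
      rw [← mul_add, ← Nat.succ_mul]
      exact Nat.mul_le_mul_left _ (Nat.mul_le_mul_right _ hl1)
    rw [x1] at b1
    rw [x2] at c2
    rw [x3] at c3
    rw [x5] at b5
    rw [x6]
    omega

/-- The first part holds on every outcome and controls the cost of later rounds; the second shows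
that a single good pair among the draws suffices to halve the error. -/
theorem finish_val (H : Setting f B U T D Δ) (hg : Bounded g T D)
    (hΔ : ((2 * P * D : ℕ) : ℝ) ≤ Δ) {pairs : List (ℕ × (Fin n → ℕ))}
    (hne : pairs ≠ []) (hpairs : ∀ ps ∈ pairs, 0 < ps.1 ∧ ps.1 ≤ P ∧ ∀ k, ps.2 k < ps.1) :
    (∀ g', (finish B U g T T₁ D pairs).val = some g' →
        g'.length ≤ T₁ ∧ ∀ t ∈ g', ∑ k, t.1 k ≤ D) ∧
      ((coeffFun f - value g).support.card ≤ T₁ →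
        (∀ e ∈ (coeffFun f - value g).support, ∑ k, e k ≤ D) →
        (∃ ps ∈ pairs,
          6 * (colliding (residue ps.1 ps.2) (coeffFun f - value g).support).card ≤ T₁) →
        ∃ g', (finish B U g T T₁ D pairs).val = some g' ∧
          2 * (coeffFun f - value g - value g').support.card ≤ T₁) := by
  obtain ⟨x, hx, hxv, hmax⟩ := exists_best_sample H hg hΔ hne hpairs
  have e : (finish B U g T T₁ D pairs).val =
      if x.count ≤ T₁ then some (recover B U g T D x).val else none := by
    rw [← finishWith_val]
    simp only [finish, Timed.bind_val, hx, Option.elim]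
  rw [e]
  constructor
  · intro g' h
    split_ifs at h with hc
    have := recover_bounded (g := g) (T := T) (D := D) (x := x) B U
    rw [← Option.some_injective _ h]
    rw [hxv.count_eq] at hc
    exact ⟨this.1.trans hc, this.2⟩
  · rintro hφ hD ⟨ps, hps, hcoll⟩
    -- Let c belong to the chosen pair and c' to the good one. Maximality gives #φ - c' ≤ #Fmod ≤ #φ
    -- - c/2, so c ≤ 2c' ≤ T₁/3 and the error is at most 3c/2 ≤ T₁/2. Also #Fmod ≤ #φ ≤ T₁, so the
    -- test passes.
    have h1 := two_mul_card_support_add_colliding_le (coeffFun f - value g) (residue x.p x.s)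
    rw [← hxv.represents_mod.length_eq, ← hxv.count_eq] at h1
    have h2 := card_support_le_add_colliding (coeffFun f - value g) (residue ps.1 ps.2)
    have h3 := hmax ps hps
    have h4 := two_mul_card_support_sub_recover_le H hg hΔ hxv hD
    exact ⟨_, if_pos (by omega), by omega⟩

end Finish


/-! ### What the formulas for the numbers of primes and of samples guarantee. -/

section Parameters

/-- The count of bad primes involves the integer part of log₂ D, and an integer below (T₁ - 1) log₂
D is also below its floor. Bad primes are thus at most 1/31 of the list. -/
theorem mul_log_le_primeCount {T₁ D : ℕ} (hT₁ : 1 ≤ T₁) (hD : 1 ≤ D) :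
    31 * ((T₁ - 1) * Nat.log 2 D) ≤ primeCount T₁ D := by
  refine le_trans (Nat.mul_le_mul_left _ (Nat.le_floor ?_)) (le_max_left _ _)
  push_cast [Nat.cast_sub hT₁]
  have h : (Nat.log 2 D : ℝ) ≤ Real.logb 2 D := by
    rw [← Real.natFloor_logb_natCast]
    exact Nat.floor_le (Real.logb_nonneg one_lt_two (by exact_mod_cast hD))
  have : (1 : ℝ) ≤ T₁ := by exact_mod_cast hT₁
  exact mul_le_mul_of_nonneg_left h (by linarith)

/-- At least one pair is drawn, so that a best sample exists. -/
theorem one_le_sampleCount {T₁ : ℕ} {ν : ℝ} (hT₁ : 1 ≤ T₁) (hν : 0 < ν) (hν1 : ν < 1) :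
    1 ≤ sampleCount T₁ ν := by
  have h1 : (1 : ℝ) ≤ T₁ := by exact_mod_cast hT₁
  have h2 : 1 < ν⁻¹ := (one_lt_inv₀ hν).2 hν1
  exact Nat.ceil_pos.2 (mul_pos (by norm_num) (Real.log_pos (by nlinarith)))

/-- Since 2/5 = 1 - 3/5 ≤ exp(-3/5), about (5/3) log(1/ν) draws are enough; the prescribed 32
log(T₁/ν) is generous. -/
theorem pow_sampleCount_le {T₁ : ℕ} {ν : ℝ} (hT₁ : 1 ≤ T₁) (hν : 0 < ν) (hν1 : ν < 1) :
    (2 / 5 : ℝ) ^ sampleCount T₁ ν ≤ ν := by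
  have h1 : (1 : ℝ) ≤ T₁ := by exact_mod_cast hT₁
  have h2 : 1 < ν⁻¹ := (one_lt_inv₀ hν).2 hν1
  have h3 : 32 * Real.log (T₁ * ν⁻¹) ≤ sampleCount T₁ ν := Nat.le_ceil _
  have h4 : Real.log ν⁻¹ ≤ Real.log (T₁ * ν⁻¹) := Real.log_le_log (by positivity) (by nlinarith)
  have h5 : 0 < Real.log ν⁻¹ := Real.log_pos h2
  have h6 : (2 / 5 : ℝ) ≤ Real.exp (-(3 / 5)) := by
    have := Real.add_one_le_exp (-(3 / 5) : ℝ)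
    linarith
  calc (2 / 5 : ℝ) ^ sampleCount T₁ ν ≤ Real.exp (-(3 / 5)) ^ sampleCount T₁ ν := by gcongr
    _ = Real.exp (-(3 / 5) * sampleCount T₁ ν) := by rw [← Real.exp_nat_mul]; ring_nf
    _ ≤ Real.exp (Real.log ν) := by
      rw [Real.log_inv] at h4 h5
      exact Real.exp_le_exp.2 (by linarith)
    _ = ν := Real.exp_log hν

end Parameters

/-! ### Cost and failure probability of one round. -/

section HalfPoly

variable {n : ℕ} {R : Type u} {E : Type v} [CommRing R] [CommRing E]
  {f : MvPolynomial (Fin n) R} {B : (Fin n → E) → E} {U : UnivInterpolator R E} {T D P : ℕ}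
  {Δ : ℝ} {g : List ((Fin n → ℕ) × R)} {T₁ : ℕ} {ν : ℝ}

/-- Upper end of the range in which `halfPoly` looks for primes. -/
noncomputable def primeBound (T₁ D : ℕ) : ℕ := sieveBound (32 * (T₁ - 1)) (primeCount T₁ D)

theorem one_le_primeCount (T₁ D : ℕ) : 1 ≤ primeCount T₁ D := le_max_right _ _

/-- Bound for the bit operations of `setup`, with at most `l` pairs and primes up to `P`. -/
def setupBits (n T D P l : ℕ) : ℕ :=
  mulCost l + mulCost P + (P + 1) * (3 * P.size + 20) * mulCost P.size + 8 * stepCost n T D P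

@[simp] theorem setup_val : (setup n T T₁ D ν).val = (sampleCount T₁ ν, primeCount T₁ D,
    (firstPrimes (n := n) (32 * (T₁ - 1)) (primeCount T₁ D)).val) := by
  simp only [setup, evalFormula, natSub, natMul, Timed.bind_val, Timed.bits_val, Timed.pure_val]

@[simp] theorem setup_queries : (setup n T T₁ D ν).cost.queries = [] := by
  simp [setup]

@[simp] theorem setup_ringOps : (setup n T T₁ D ν).cost.ringOps = 0 := by
  simp [setup]

theorem primeCount_le_primeBound (T₁ D : ℕ) :
    32 * (T₁ - 1) + primeCount T₁ D ≤ primeBound T₁ D ∧ 16 ≤ primeBound T₁ D := by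
  have h1 := one_le_primeCount T₁ D
  have h2 : 1 ≤ (32 * (T₁ - 1) + primeCount T₁ D).size := Nat.size_pos.2 (by omega)
  have h3 : 32 * (T₁ - 1) + primeCount T₁ D ≤
      (32 * (T₁ - 1) + primeCount T₁ D) * (32 * (T₁ - 1) + primeCount T₁ D).size :=
    Nat.le_mul_of_pos_right _ h2
  unfold primeBound sieveBound
  omega

theorem setup_bitOps_le (hT : 1 ≤ T) (hD : 1 ≤ D) (hT₁ : T₁ ≤ T) (hP : primeBound T₁ D ≤ P)
    {l : ℕ} (hl : sampleCount T₁ ν ≤ l) :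
    (setup n T T₁ D ν).cost.bitOps ≤ setupBits n T D P l := by
  have h1 := firstPrimes_bitOps_le (n := n) (lo := 32 * (T₁ - 1)) (one_le_primeCount T₁ D)
  obtain ⟨h2, h3⟩ := primeCount_le_primeBound T₁ D
  have h4 : primeCount T₁ D ≤ P := by omega
  have hM : 2 * P ≤ integerBound T D P := by
    have : 2 * P ≤ 2 * P * D := Nat.le_mul_of_pos_right _ hD
    unfold integerBound
    omega
  have hTM : 3 * T ≤ integerBound T D P := Nat.le_add_left _ _
  have hDM : D ≤ integerBound T D P := by
    have : D ≤ 2 * P * D := Nat.le_mul_of_pos_left _ (by omega)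
    unfold integerBound
    omega
  have w1 : T.size + 1 ≤ stepCost n T D P := size_succ_le_unitCost (le_capacity (by omega))
  have w2 : T₁.size + 1 ≤ stepCost n T D P := size_succ_le_unitCost (le_capacity (by omega))
  have w3 : D.size + 1 ≤ stepCost n T D P := size_succ_le_unitCost (le_capacity hDM)
  have w4 : (1 : ℕ).size + 1 ≤ stepCost n T D P :=
    size_succ_le_unitCost (le_capacity (by omega))
  have w5 : mulBits 32 (T₁ - 1) ≤ stepCost n T D P :=
    mulBits_le_unitCost (le_capacity (by omega)) (le_capacity (by omega))
  have c1 := mulCost_mono hl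
  have c2 := mulCost_mono h4
  have hs : (primeBound T₁ D).size ≤ P.size := Nat.size_le_size hP
  have c3 : (primeBound T₁ D + 1) * (3 * (primeBound T₁ D).size + 20) *
      mulCost (primeBound T₁ D).size ≤ (P + 1) * (3 * P.size + 20) * mulCost P.size :=
    Nat.mul_le_mul (Nat.mul_le_mul (by omega) (by omega)) (mulCost_mono hs)
  have e : (setup n T T₁ D ν).cost.bitOps = (T.size + T₁.size + mulCost (sampleCount T₁ ν)) +
      ((T₁.size + D.size + mulCost (primeCount T₁ D)) + ((T₁.size + (1 : ℕ).size + 1) +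
      (mulBits 32 (T₁ - 1) +
        ((firstPrimes (n := n) (32 * (T₁ - 1)) (primeCount T₁ D)).cost.bitOps + 0)))) := by
    simp only [setup, evalFormula, natSub, natMul, Timed.bits_val, Timed.bind_cost,
      Cost.add_bitOps, Timed.bits_bitOps, Timed.pure_cost, Cost.zero_bitOps, mulCost]
  have h1' := h1.trans c3
  rw [e]
  unfold setupBits
  omega

theorem mem_support_repeated_drawPair {N l : ℕ} {primes : List ℕ} (hN : 0 < N)
    (hlen : primes.length = N) (hp : ∀ p ∈ primes, 0 < p ∧ p ≤ P)
    {t : Timed n (List (ℕ × (Fin n → ℕ)))}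
    (ht : t ∈ (RComp.repeated (drawPair (n := n) primes N) l).support) :
    t.val.length = l ∧ (∀ ps ∈ t.val, 0 < ps.1 ∧ ps.1 ≤ P ∧ ∀ k, ps.2 k < ps.1) ∧
      t.cost.queries = [] ∧ t.cost.ringOps = 0 ∧
      t.cost.bitOps ≤ l * (2 * N.size + 1 + n * P.size + 1) :=
  RComp.mem_support_repeated (fun t ht => by
    obtain ⟨⟨h1, h1'⟩, h2⟩ := mem_support_drawPair hN hlen hp ht
    exact ⟨⟨(hp _ h1).1, (hp _ h1).2, h1'⟩, h2⟩) l ht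

theorem prob_repeated_drawPair_le {N l : ℕ} {primes : List ℕ} {S : Finset (Fin n → ℕ)}
    (hS : S.card ≤ T₁) (hD : ∀ e ∈ S, ∀ k, e k ≤ D) (hN : 31 * ((T₁ - 1) * Nat.log 2 D) ≤ N)
    (hN1 : 0 < N) (hlen : primes.length = N) (hnd : primes.Nodup)
    (hp : ∀ p ∈ primes, p.Prime ∧ 32 * (T₁ - 1) ≤ p) :
    RComp.prob (RComp.repeated (drawPair (n := n) primes N) l)
      (fun L => ¬∃ ps ∈ L, 6 * (colliding (residue ps.1 ps.2) S).card ≤ T₁) ≤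
      ENNReal.ofReal ((2 / 5) ^ l) := by
  push Not
  rw [ENNReal.ofReal_pow (by norm_num)]
  exact (RComp.prob_repeated_forall_le _ _ _).trans
    (pow_le_pow_left' (prob_drawPair_le hS hD hN hN1 hlen hnd hp) _)

variable [Algebra R E]

theorem mem_support_halfPoly (H : Setting f B U T D Δ) (hg : Bounded g T D)
    (hΔ : ((2 * P * D : ℕ) : ℝ) ≤ Δ) (h1T₁ : 1 ≤ T₁) (hT₁ : T₁ ≤ T) (hν : 0 < ν) (hν1 : ν < 1)
    (hP : primeBound T₁ D ≤ P) {l : ℕ} (hl : sampleCount T₁ ν ≤ l)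
    {t : Timed n (Option (List ((Fin n → ℕ) × R)))}
    (ht : t ∈ (halfPoly B U g T T₁ D ν).support) :
    (∀ g', t.val = some g' → g'.length ≤ T₁ ∧ ∀ t ∈ g', ∑ k, t.1 k ≤ D) ∧
      t.cost.queries.length ≤ l + n ∧ (∀ q ∈ t.cost.queries, Query.Correct f T Δ q) ∧
      t.cost.ringOps ≤ l * (19 * T) + n * (13 * T) ∧
      t.cost.bitOps ≤ setupBits n T D P l + l * ((n + 1) * (4 * stepCost n T D P)) +
        finishBits n T D P l := by
  rw [halfPoly_eq, RComp.mem_support_bind] at ht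
  obtain ⟨a, ha, b, hb, hbv, hbc⟩ := ht
  rw [RComp.mem_support_lift] at ha
  subst ha
  rw [setup_val, RComp.mem_support_bind] at hb
  obtain ⟨pairs, hpairs, c, hc, hcv, hcc⟩ := hb
  rw [RComp.mem_support_lift] at hc
  subst hc
  have hN := one_le_primeCount T₁ D
  have hlen := firstPrimes_length (n := n) (lo := 32 * (T₁ - 1)) hN
  obtain ⟨hN', hP16⟩ := primeCount_le_primeBound T₁ D
  have hPM : P ≤ integerBound T D P := by
    have : 2 * P ≤ 2 * P * D := Nat.le_mul_of_pos_right _ H.one_le_D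
    unfold integerBound
    omega
  have hprimes : ∀ p ∈ (firstPrimes (n := n) (32 * (T₁ - 1)) (primeCount T₁ D)).val,
      0 < p ∧ p ≤ P := fun p hp =>
    ⟨(firstPrimes_mem hp).1.pos, (firstPrimes_mem hp).2.2.trans hP⟩
  dsimp only at hpairs
  generalize (firstPrimes (n := n) (32 * (T₁ - 1)) (primeCount T₁ D)).val = primes at *
  obtain ⟨e1, e2, e3, e4, e5⟩ := mem_support_repeated_drawPair hN hlen hprimes hpairs
  have hl1 := one_le_sampleCount h1T₁ hν hν1
  have hne : pairs.val ≠ [] := by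
    rw [← List.length_pos_iff]
    omega
  obtain ⟨c1, c2, c3, c4⟩ := finish_cost (g := g) H hg hΔ hT₁ hne e2
  have v := (finish_val (g := g) (T₁ := T₁) H hg hΔ hne e2).1
  have s1 := setup_bitOps_le (n := n) H.one_le_T H.one_le_D hT₁ hP hl
  generalize finish B U g T T₁ D pairs.val = r at *
  have hlen' : pairs.val.length ≤ l := by omega
  rw [hbv, hcv, hbc, hcc]
  simp only [Cost.add_queries, Cost.add_ringOps, Cost.add_bitOps, setup_queries, setup_ringOps, e3,
    e4, List.nil_append]
  refine ⟨v, by omega, c2, ?_, ?_⟩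
  · have := Nat.mul_le_mul_right (19 * T) hlen'
    omega
  · have f1 : finishBits n T D P pairs.val.length ≤ finishBits n T D P l := by
      unfold finishBits
      gcongr
    have hw : 1 ≤ stepCost n T D P :=
      (Nat.le_add_left _ _).trans (size_succ_le_unitCost (x := 0) (Nat.zero_le _))
    have w1 : (primeCount T₁ D).size + 1 ≤ stepCost n T D P :=
      size_succ_le_unitCost (le_capacity (by omega))
    have w2 : P.size + 1 ≤ stepCost n T D P := size_succ_le_unitCost (le_capacity hPM)
    generalize stepCost n T D P = w at *
    have f2 : sampleCount T₁ ν * (2 * (primeCount T₁ D).size + 1 + n * P.size + 1) ≤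
        l * ((n + 1) * (4 * w)) := by
      refine Nat.mul_le_mul hl ?_
      have : n * P.size ≤ n * w := Nat.mul_le_mul_left _ (by omega)
      have y : (n + 1) * (4 * w) = 4 * (n * w) + 4 * w := by ring
      omega
    omega

/-- The only unlucky event is that no drawn pair has at most T₁/6 collisions. -/
theorem prob_halfPoly_le (H : Setting f B U T D Δ) (hg : Bounded g T D)
    (hΔ : ((2 * primeBound T₁ D * D : ℕ) : ℝ) ≤ Δ) (h1T₁ : 1 ≤ T₁) (hν : 0 < ν) (hν1 : ν < 1)
    (hφ : (coeffFun f - value g).support.card ≤ T₁)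
    (hD : ∀ e ∈ (coeffFun f - value g).support, ∑ k, e k ≤ D) :
    RComp.prob (halfPoly B U g T T₁ D ν) (fun r => ¬∃ g', r = some g' ∧
      2 * (coeffFun f - value g - value g').support.card ≤ T₁) ≤ ENNReal.ofReal ν := by
  rw [halfPoly_eq, RComp.prob_bind_lift, setup_val]
  have hN := one_le_primeCount T₁ D
  have hlen := firstPrimes_length (n := n) (lo := 32 * (T₁ - 1)) hN
  have hprimes : ∀ p ∈ (firstPrimes (n := n) (32 * (T₁ - 1)) (primeCount T₁ D)).val,
      0 < p ∧ p ≤ primeBound T₁ D := fun p hp =>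
    ⟨(firstPrimes_mem hp).1.pos, (firstPrimes_mem hp).2.2⟩
  have hbound := (prob_repeated_drawPair_le (l := sampleCount T₁ ν) hφ
    (fun e he k => apply_le_of_sum_le (hD e he) k) (mul_log_le_primeCount h1T₁ H.one_le_D) hN hlen
    (firstPrimes_nodup _ _) fun p hp => ⟨(firstPrimes_mem hp).1, (firstPrimes_mem hp).2.1⟩).trans
    (ENNReal.ofReal_le_ofReal (pow_sampleCount_le h1T₁ hν hν1))
  dsimp only
  generalize (firstPrimes (n := n) (32 * (T₁ - 1)) (primeCount T₁ D)).val = primes at *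
  -- Once a good pair is among the draws the remaining steps are deterministic and succeed, hence b
  -- = 0.
  refine (RComp.prob_bind_le_add hbound (b := 0) ?_).trans (by rw [add_zero])
  intro pairs hpairs hQ
  obtain ⟨e1, e2, -⟩ := mem_support_repeated_drawPair hN hlen hprimes hpairs
  have hl1 := one_le_sampleCount h1T₁ hν hν1
  have hne : pairs.val ≠ [] := by
    rw [← List.length_pos_iff]
    omega
  classical
  rw [RComp.prob_lift, if_neg]
  rw [not_not]
  exact (finish_val H hg hΔ hne e2).2 hφ hD hQ

end HalfPoly


/-! ## The loop of `mulPolySI` -/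

/-- Halving removes a bit, so the bit length of T₁ bounds the number of rounds still to come. -/
theorem size_div_two_lt {m : ℕ} (hm : m ≠ 0) : (m / 2).size + 1 ≤ m.size := by
  have h0 : 0 < m.size := Nat.size_pos.2 (Nat.pos_of_ne_zero hm)
  have h : m < 2 ^ m.size := Nat.lt_size_self m
  have h2 : m.size = m.size - 1 + 1 := by omega
  rw [h2, pow_succ] at h
  have : (m / 2).size ≤ m.size - 1 := Nat.size_le.2 (by omega)
  omega

section Loop

variable {n : ℕ} {R : Type u} {E : Type v} [CommRing R] [CommRing E]
  {f : MvPolynomial (Fin n) R} {B : (Fin n → E) → E} {U : UnivInterpolator R E} {T D P : ℕ}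
  {Δ : ℝ} {h : List ((Fin n → ℕ) × R)} {T₁ : ℕ} {ν : ℝ}

theorem mulPolyLoop_zero (B : (Fin n → E) → E) (U : UnivInterpolator R E) :
    mulPolyLoop B U T D ν 0 h = RComp.lift (Timed.bits 1 (some h)) := by
  rw [mulPolyLoop, if_pos rfl]

theorem mulPolyLoop_of_ne_zero (B : (Fin n → E) → E) (U : UnivInterpolator R E) (hT₁ : T₁ ≠ 0) :
    mulPolyLoop B U T D ν T₁ h = RComp.bind (halfPoly B U h T T₁ D ν) fun r =>
      r.elim (RComp.lift (Timed.pure none)) fun g =>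
      RComp.bind (RComp.lift (addTerms h g)) fun h' =>
      RComp.bind (RComp.lift (Timed.bits (T₁.size + 1) ())) fun _ =>
      mulPolyLoop B U T D ν (T₁ / 2) h' := by
  rw [mulPolyLoop, if_neg hT₁]
  congr 1
  funext r
  rcases r with _ | g <;> rfl

/-- Bound for the bit operations in one round of the loop. -/
def roundBits (n T D P l : ℕ) : ℕ :=
  setupBits n T D P l + l * ((n + 1) * (4 * stepCost n T D P)) + finishBits n T D P l +
    (n + 1) * ((3 * T + 1) * ((3 * T).size + 1) * (40 * stepCost n T D P))

theorem addTerms_cost {g : List ((Fin n → ℕ) × R)} (hD : 1 ≤ D) (hP : 1 ≤ P) (hT : 1 ≤ T)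
    (hlen : h.length + g.length ≤ 2 * T) (hT₁ : T₁ ≤ T)
    (hh : ∀ t ∈ h, ∑ k, t.1 k ≤ D) (hg : ∀ t ∈ g, ∑ k, t.1 k ≤ D) :
    (addTerms (n := n) h g).cost.bitOps + (T₁.size + 1) ≤
      (n + 1) * ((3 * T + 1) * ((3 * T).size + 1) * (40 * stepCost n T D P)) := by
  have hDM : D ≤ integerBound T D P := by
    have : D ≤ 2 * P * D := Nat.le_mul_of_pos_left _ (by omega)
    unfold integerBound
    omega
  have hTM : 3 * T ≤ integerBound T D P := Nat.le_add_left _ _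
  have hkey : ∀ e : Fin n → ℕ, ∑ k, e k ≤ D → Key.size e ≤ n * stepCost n T D P := fun e he =>
    key_size_vector_le fun k => (apply_le_of_sum_le he k).trans hDM
  have h1 := addTerms_bitOps_le (n := n) h g (fun t ht => hkey t.1 (hh t ht))
    fun t ht => hkey t.1 (hg t ht)
  have d := succ_mul_size_succ_le (T := T) (x := h.length + g.length) (by omega)
  have w1 : T₁.size + 1 ≤ stepCost n T D P := size_succ_le_unitCost (le_capacity (by omega))
  have hq1 : 1 ≤ (3 * T + 1) * ((3 * T).size + 1) := Nat.mul_pos (by omega) (by omega)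
  generalize stepCost n T D P = w at *
  generalize (3 * T + 1) * ((3 * T).size + 1) = q at *
  have h2 := h1.trans (Nat.mul_le_mul d
    (show 4 * (n * w) + 33 ≤ 4 * (n * w) + 33 * w by omega))
  have x1 : q * (4 * (n * w) + 33 * w) = 4 * (n * (q * w)) + 33 * (q * w) := by ring
  have x2 : (n + 1) * (q * (40 * w)) = 40 * (n * (q * w)) + 40 * (q * w) := by ring
  have hqw : w ≤ q * w := Nat.le_mul_of_pos_left _ hq1
  rw [x1] at h2
  rw [x2]
  omega

variable [Algebra R E]

/-- The hypothesis #h + 2T₁ ≤ 2T is the loop invariant: a round adds at most T₁ terms and 2⌊T₁/2⌋ ≤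
T₁. It makes no reference to the correctness of h, so the bounds cover unlucky runs as well. -/
theorem mem_support_mulPolyLoop (H : Setting f B U T D Δ) (hΔ : ((2 * P * D : ℕ) : ℝ) ≤ Δ)
    (hν : 0 < ν) (hν1 : ν < 1) (hP : ∀ T' ≤ T, primeBound T' D ≤ P) {l : ℕ}
    (hl : ∀ T' ≤ T, sampleCount T' ν ≤ l) {t : Timed n (Option (List ((Fin n → ℕ) × R)))}
    (hlen : h.length + 2 * T₁ ≤ 2 * T) (hh : ∀ t ∈ h, ∑ k, t.1 k ≤ D)
    (ht : t ∈ (mulPolyLoop B U T D ν T₁ h).support) :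
    t.cost.queries.length ≤ T₁.size * (l + n) ∧ (∀ q ∈ t.cost.queries, Query.Correct f T Δ q) ∧
      t.cost.ringOps ≤ T₁.size * (l * (19 * T) + n * (13 * T) + 4 * T) ∧
      t.cost.bitOps ≤ T₁.size * roundBits n T D P l + 1 := by
  induction T₁ using Nat.strong_induction_on generalizing h t with
  | _ T₁ ih =>
  rcases eq_or_ne T₁ 0 with rfl | hT₁
  · rw [mulPolyLoop_zero, RComp.mem_support_lift] at ht
    subst ht
    simp
  rw [mulPolyLoop_of_ne_zero B U hT₁, RComp.mem_support_bind] at ht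
  obtain ⟨a, ha, b, hb, -, hbc⟩ := ht
  have hP1 : 1 ≤ P := by
    have := (primeCount_le_primeBound T₁ D).2.trans (hP T₁ (by omega))
    omega
  obtain ⟨a1, a2, a3, a4, a5⟩ := mem_support_halfPoly H ⟨by omega, hh⟩ hΔ
    (Nat.pos_of_ne_zero hT₁) (by omega) hν hν1 (hP T₁ (by omega)) (hl T₁ (by omega)) ha
  rw [hbc]
  simp only [Cost.add_queries, Cost.add_ringOps, Cost.add_bitOps, List.length_append,
    List.mem_append]
  have hs := size_div_two_lt hT₁
  rcases hr : a.val with _ | g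
  · rw [hr, Option.elim_none, RComp.mem_support_lift] at hb
    subst hb
    have hs1 : 1 ≤ T₁.size := by omega
    have m1 := Nat.mul_le_mul_right (l + n) hs1
    have m2 := Nat.mul_le_mul_right (l * (19 * T) + n * (13 * T) + 4 * T) hs1
    have m3 := Nat.mul_le_mul_right (roundBits n T D P l) hs1
    rw [one_mul] at m1 m2 m3
    simp only [Timed.pure_cost, Cost.zero_queries, Cost.zero_ringOps, Cost.zero_bitOps,
      List.length_nil, List.not_mem_nil, or_false]
    refine ⟨by omega, a3, by omega, le_trans ?_ (Nat.le_succ_of_le m3)⟩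
    unfold roundBits
    omega
  · rw [hr, Option.elim_some, RComp.mem_support_bind] at hb
    obtain ⟨c, hc, d, hd, -, hdc⟩ := hb
    rw [RComp.mem_support_lift] at hc
    subst hc
    rw [RComp.mem_support_bind] at hd
    obtain ⟨c, hc, e, he, -, hec⟩ := hd
    rw [RComp.mem_support_lift] at hc
    subst hc
    obtain ⟨g1, g2⟩ := a1 g hr
    have h'len := addTerms_length_le (n := n) h g
    have h'mem : ∀ t ∈ (addTerms (n := n) h g).val, ∑ k, t.1 k ≤ D := by
      intro t ht
      obtain ⟨t', ht', e⟩ := addTerms_mem _ _ _ ht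
      rw [← e]
      exact (List.mem_append.1 ht').elim (hh t') (g2 t')
    have hb' := addTerms_cost (P := P) (T₁ := T₁) H.one_le_D hP1 H.one_le_T (by omega) (by omega)
      hh g2
    have hr' := addTerms_ringOps_le (n := n) h g
    obtain ⟨i1, i2, i3, i4⟩ := ih (T₁ / 2) (by omega) (by omega) h'mem he
    rw [hdc, hec]
    simp only [Cost.add_queries, Cost.add_ringOps, Cost.add_bitOps, Timed.bits_queries,
      Timed.bits_ringOps, Timed.bits_bitOps, addTerms_queries, List.nil_append]
    have m1 := Nat.mul_le_mul_right (l + n) hs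
    have m2 := Nat.mul_le_mul_right (l * (19 * T) + n * (13 * T) + 4 * T) hs
    have m3 := Nat.mul_le_mul_right (roundBits n T D P l) hs
    rw [Nat.succ_mul] at m1 m2 m3
    refine ⟨by omega, fun q hq => hq.elim (a3 q) (i2 q), by omega,
      le_trans ?_ (Nat.succ_le_succ m3)⟩
    have : setupBits n T D P l + l * ((n + 1) * (4 * stepCost n T D P)) + finishBits n T D P l +
      (n + 1) * ((3 * T + 1) * ((3 * T).size + 1) * (40 * stepCost n T D P)) =
        roundBits n T D P l := rfl
    omega

/-- Union bound over the rounds: as long as all have succeeded, the current T₁ bounds the number of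
terms of f - h. -/
theorem prob_mulPolyLoop_le (H : Setting f B U T D Δ) (hΔ : ((2 * P * D : ℕ) : ℝ) ≤ Δ)
    (hν : 0 < ν) (hν1 : ν < 1) (hP : ∀ T' ≤ T, primeBound T' D ≤ P)
    (hlen : h.length + 2 * T₁ ≤ 2 * T) (hh : ∀ t ∈ h, ∑ k, t.1 k ≤ D)
    (hrep : Represents h (value h)) (hcard : (coeffFun f - value h).support.card ≤ T₁) :
    RComp.prob (mulPolyLoop B U T D ν T₁ h) (fun r => ¬∃ L, r = some L ∧ IsSparseRep L f) ≤
      T₁.size * ENNReal.ofReal ν := by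
  classical
  induction T₁ using Nat.strong_induction_on generalizing h with
  | _ T₁ ih =>
  rcases eq_or_ne T₁ 0 with rfl | hT₁
  · rw [mulPolyLoop_zero, RComp.prob_lift, if_neg]
    · exact zero_le
    rw [not_not]
    -- When T₁ has reached 0 the difference has no terms left, so h represents f.
    rw [Nat.le_zero, Finset.card_eq_zero, Finsupp.support_eq_empty, sub_eq_zero] at hcard
    rw [← hcard] at hrep
    exact ⟨h, rfl, isSparseRep_of_represents hrep⟩
  rw [mulPolyLoop_of_ne_zero B U hT₁]
  have hg : Bounded h T D := ⟨by omega, hh⟩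
  -- Wrong terms in h must also obey the degree bound; this is what the degree test during recovery
  -- is for.
  have hDφ : ∀ e ∈ (coeffFun f - value h).support, ∑ k, e k ≤ D := by
    intro e he
    rcases Finset.mem_union.1 (Finsupp.support_sub he) with he | he
    · exact (sum_le_totalDegree he).trans H.degree_le
    · obtain ⟨t, ht, rfl⟩ := exists_mem_of_value_ne_zero (Finsupp.mem_support_iff.1 he)
      exact hh t ht
  have h1T₁ := Nat.pos_of_ne_zero hT₁
  have hP' := hP T₁ (by omega)
  have hΔ' : ((2 * primeBound T₁ D * D : ℕ) : ℝ) ≤ Δ := by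
    refine le_trans ?_ hΔ
    exact_mod_cast Nat.mul_le_mul_right _ (by omega)
  have hs := size_div_two_lt hT₁
  have h1 := prob_halfPoly_le H hg hΔ' h1T₁ hν hν1 hcard hDφ
  refine (RComp.prob_bind_le_add (b := (T₁ / 2).size * ENNReal.ofReal ν) h1 ?_).trans ?_
  · rintro t ht ⟨g, hgv, hg'⟩
    obtain ⟨a1, -⟩ := mem_support_halfPoly H hg hΔ h1T₁ (by omega) hν hν1 hP' le_rfl ht
    obtain ⟨g1, g2⟩ := a1 g hgv
    rw [hgv, Option.elim_some, RComp.prob_bind_lift, RComp.prob_bind_lift]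
    have h'len := addTerms_length_le (n := n) h g
    have h'rep := addTerms_represents (n := n) h g
    refine ih (T₁ / 2) (by omega) (by omega) ?_ ?_ ?_
    · intro t ht
      obtain ⟨t', ht', e⟩ := addTerms_mem _ _ _ ht
      rw [← e]
      exact (List.mem_append.1 ht').elim (hh t') (g2 t')
    · rwa [h'rep.value_eq]
    · rw [h'rep.value_eq, ← sub_sub]
      omega
  · calc ENNReal.ofReal ν + (T₁ / 2).size * ENNReal.ofReal ν
        = (((T₁ / 2).size + 1 : ℕ) : ENNReal) * ENNReal.ofReal ν := by push_cast; ring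
      _ ≤ _ := by gcongr

end Loop


/-! ## Bounds for the parameters -/

theorem floor_mul_logb_le {T' T D : ℕ} (hT : T' ≤ T) (hD : 1 ≤ D) :
    ⌊((T' : ℝ) - 1) * Real.logb 2 D⌋₊ ≤ T * D.size := by
  have h0 : 0 ≤ Real.logb 2 (D : ℝ) := Real.logb_nonneg one_lt_two (by exact_mod_cast hD)
  have h1 : Real.logb 2 (D : ℝ) ≤ D.size := by
    rw [Real.logb_le_iff_le_rpow one_lt_two (by exact_mod_cast hD), Real.rpow_natCast]
    exact_mod_cast (Nat.lt_size_self D).le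
  have h2 : (T' : ℝ) - 1 ≤ T := by
    have : (T' : ℝ) ≤ T := by exact_mod_cast hT
    linarith
  have h3 : ((T' : ℝ) - 1) * Real.logb 2 D ≤ ((T * D.size : ℕ) : ℝ) := by
    push_cast
    calc ((T' : ℝ) - 1) * Real.logb 2 D ≤ T * Real.logb 2 D := by gcongr
      _ ≤ T * D.size := by gcongr
  exact (Nat.floor_le_floor h3).trans (Nat.floor_natCast _).le

/-- An upper bound for the primes in the run of the algorithm. -/
def primeLimit (T D : ℕ) : ℕ := 8192 * (T * D.size * (T * D.size).size)

theorem primeBound_le {T' T D : ℕ} (hT' : T' ≤ T) (hT : 1 ≤ T) (hD : 1 ≤ D) :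
    primeBound T' D ≤ primeLimit T D := by
  have hd : 1 ≤ D.size := Nat.size_pos.2 hD
  have hV : T ≤ T * D.size := Nat.le_mul_of_pos_right _ hd
  have h1 := floor_mul_logb_le hT' hD
  -- Contributions 32 and 31, rounded up to 64; the limit 8192 is 16 · 64 · 8, the 8 coming from the
  -- bit length of 64V.
  have h2 : 32 * (T' - 1) + primeCount T' D ≤ 64 * (T * D.size) := by
    unfold primeCount
    omega
  unfold primeBound sieveBound primeLimit
  generalize T * D.size = V at *
  have hs : 1 ≤ V.size := Nat.size_pos.2 (by omega)
  have h3 : (64 * V).size ≤ 8 * V.size := by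
    have := size_mul_le 64 V
    have h64 : (64 : ℕ).size ≤ 7 := Nat.size_le.2 (by norm_num)
    omega
  calc 16 * ((32 * (T' - 1) + primeCount T' D) * (32 * (T' - 1) + primeCount T' D).size)
      ≤ 16 * (64 * V * (8 * V.size)) := by
        refine Nat.mul_le_mul_left _ (Nat.mul_le_mul h2 ?_)
        exact (Nat.size_le_size h2).trans h3
    _ = _ := by ring

theorem log_le_size (T : ℕ) : Real.log (T + 1) ≤ T.size := by
  have h : (T + 1 : ℝ) ≤ 2 ^ T.size := by exact_mod_cast Nat.lt_size_self T
  calc Real.log (T + 1) ≤ Real.log (2 ^ T.size) := Real.log_le_log (by positivity) h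
    _ = T.size * Real.log 2 := by rw [Real.log_pow]
    _ ≤ T.size * 1 := by
      gcongr
      linarith [Real.log_two_lt_d9]
    _ = T.size := mul_one _

/-- Both T.size - 1 and 1 are at most log(T + 1) / log 2, and 2 / log 2 < 3. The shift to T + 1
keeps the logarithm positive for T = 1. -/
theorem size_le_log {T : ℕ} (hT : 1 ≤ T) : (T.size : ℝ) ≤ 3 * Real.log (T + 1) := by
  have h0 : 1 ≤ T.size := Nat.size_pos.2 hT
  have h1 : (2 : ℝ) ^ (T.size - 1) ≤ T := by
    exact_mod_cast Nat.lt_size.1 (show T.size - 1 < T.size by omega)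
  have h2 : ((T.size - 1 : ℕ) : ℝ) * Real.log 2 ≤ Real.log (T + 1) := by
    rw [← Real.log_pow]
    exact Real.log_le_log (by positivity) (by linarith)
  have h3 : Real.log 2 ≤ Real.log (T + 1) := by
    have : (1 : ℝ) ≤ T := by exact_mod_cast hT
    exact Real.log_le_log two_pos (by linarith)
  push_cast [h0] at h2
  have h4 := Real.log_two_gt_d9
  nlinarith

/-- The tolerance `ν` of one round, for the tolerance `1 / 4`. -/
noncomputable def roundTolerance (T : ℕ) : ℝ := 1 / 4 / (⌈Real.logb 2 T⌉₊ + 1)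

theorem roundTolerance_pos (T : ℕ) : 0 < roundTolerance T := by
  unfold roundTolerance; positivity

theorem roundTolerance_lt_one (T : ℕ) : roundTolerance T < 1 := by
  unfold roundTolerance
  rw [div_lt_one (by positivity)]
  have : (0 : ℝ) ≤ ⌈Real.logb 2 T⌉₊ := Nat.cast_nonneg _
  linarith

/-- The number of rounds is at most the denominator in ν, so the failure probabilities of all rounds
add up to at most 1/4. -/
theorem size_le_ceil_logb (T : ℕ) : T.size ≤ ⌈Real.logb 2 T⌉₊ + 1 := by
  rcases Nat.eq_zero_or_pos T with rfl | hT
  · simp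
  rw [Nat.size_le, pow_succ]
  have h : (T : ℝ) ≤ 2 ^ ⌈Real.logb 2 T⌉₊ := by
    rw [← Real.rpow_natCast, ← Real.logb_le_iff_le_rpow one_lt_two (by exact_mod_cast hT)]
    exact Nat.le_ceil _
  have : T ≤ 2 ^ ⌈Real.logb 2 T⌉₊ := by exact_mod_cast h
  omega

theorem size_mul_roundTolerance_le (T : ℕ) : T.size * roundTolerance T ≤ 1 / 4 := by
  have h : (T.size : ℝ) ≤ ⌈Real.logb 2 T⌉₊ + 1 := by exact_mod_cast size_le_ceil_logb T
  unfold roundTolerance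
  rw [← mul_div_assoc, div_le_iff₀ (by positivity)]
  linarith

/-- Here T'/ν ≤ 4T(T + 1) ≤ (2(T + 1))², so its logarithm is at most 2 (log 2 + T.size); multiplied
by 32 this stays below 130 times the bit length. -/
theorem sampleCount_le {T' T : ℕ} (hT' : T' ≤ T) (hT : 1 ≤ T) :
    sampleCount T' (roundTolerance T) ≤ 130 * T.size := by
  have hs : 1 ≤ T.size := Nat.size_pos.2 hT
  rcases Nat.eq_zero_or_pos T' with rfl | h0
  · simp [sampleCount]
  refine Nat.ceil_le.2 ?_
  have hT1 : (1 : ℝ) ≤ T := by exact_mod_cast hT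
  have h1 : (⌈Real.logb 2 T⌉₊ : ℝ) ≤ T := by
    have : ⌈Real.logb 2 (T : ℝ)⌉₊ ≤ T := by
      refine Nat.ceil_le.2 ?_
      rw [Real.logb_le_iff_le_rpow one_lt_two (by linarith), Real.rpow_natCast]
      exact_mod_cast Nat.lt_two_pow_self.le
    exact_mod_cast this
  have h2 : (T' : ℝ) * (roundTolerance T)⁻¹ ≤ (2 * (T + 1)) ^ 2 := by
    have h3 : (T' : ℝ) ≤ T := by exact_mod_cast hT'
    have h4 : (roundTolerance T)⁻¹ = 4 * (⌈Real.logb 2 T⌉₊ + 1) := by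
      unfold roundTolerance
      field_simp
    rw [h4]
    calc (T' : ℝ) * (4 * (⌈Real.logb 2 T⌉₊ + 1)) ≤ T * (4 * (T + 1)) := by gcongr
      _ ≤ _ := by nlinarith
  have hpos : 0 < (T' : ℝ) * (roundTolerance T)⁻¹ :=
    mul_pos (by exact_mod_cast h0) (inv_pos.2 (roundTolerance_pos T))
  have h5 := Real.log_le_log hpos h2
  rw [Real.log_pow, Real.log_mul two_ne_zero (by positivity)] at h5
  have h6 := log_le_size T
  have h7 := Real.log_two_lt_d9
  have h8 : (1 : ℝ) ≤ T.size := by exact_mod_cast hs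
  push_cast at h5 ⊢
  linarith

/-! ## The algorithm `mulPolySI` -/

section Algorithm

variable {n : ℕ} {R : Type u} {E : Type v} [CommRing R] [CommRing E] [Algebra R E]
  {f : MvPolynomial (Fin n) R} {B : (Fin n → E) → E} {U : UnivInterpolator R E} {T D : ℕ} {Δ : ℝ}

theorem prob_mulPolySI_ge (H : Setting f B U T D Δ)
    (hΔ : ((2 * primeLimit T D * D : ℕ) : ℝ) ≤ Δ) :
    3 / 4 ≤ RComp.prob (mulPolySI B U T D (1 / 4)) fun r => ∃ L, r = some L ∧ IsSparseRep L f := by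
  have h1 : RComp.prob (mulPolySI B U T D (1 / 4))
      (fun r => ¬∃ L, r = some L ∧ IsSparseRep L f) ≤ 1 / 4 := by
    unfold mulPolySI
    rw [RComp.prob_bind_lift]
    refine (prob_mulPolyLoop_le (h := []) (T₁ := T) (ν := roundTolerance T) H hΔ
      (roundTolerance_pos T) (roundTolerance_lt_one T)
      (fun T' hT' => primeBound_le hT' H.one_le_T H.one_le_D) (by simp) (by simp)
      ⟨by simp, by simp, rfl⟩ ?_).trans ?_
    · have : value ([] : List ((Fin n → ℕ) × R)) = 0 := by simp [value]
      rw [this, sub_zero, card_support_coeffFun]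
      exact H.card_le
    · rw [← ENNReal.ofReal_natCast, ← ENNReal.ofReal_mul (by positivity)]
      refine (ENNReal.ofReal_le_ofReal (size_mul_roundTolerance_le T)).trans ?_
      rw [ENNReal.ofReal_div_of_pos (by norm_num)]
      simp
  have h2 := RComp.prob_add_prob_not (mulPolySI B U T D (1 / 4))
    fun r => ∃ L, r = some L ∧ IsSparseRep L f
  have h3 : (3 / 4 : ENNReal) + 1 / 4 = 1 := by
    rw [← ENNReal.add_div]
    norm_num
    exact ENNReal.div_self (by norm_num) (by norm_num)
  have h4 : (3 / 4 : ENNReal) + 1 / 4 ≤ RComp.prob (mulPolySI B U T D (1 / 4))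
      (fun r => ∃ L, r = some L ∧ IsSparseRep L f) + 1 / 4 :=
    (h3.trans h2.symm).le.trans (add_le_add le_rfl h1)
  exact (ENNReal.add_le_add_iff_right (by simp)).1 h4

theorem mem_support_mulPolySI (H : Setting f B U T D Δ)
    (hΔ : ((2 * primeLimit T D * D : ℕ) : ℝ) ≤ Δ)
    {t : Timed n (Option (List ((Fin n → ℕ) × R)))}
    (ht : t ∈ (mulPolySI B U T D (1 / 4)).support) :
    t.cost.queries.length ≤ T.size * (130 * T.size + n) ∧
      (∀ q ∈ t.cost.queries, Query.Correct f T Δ q) ∧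
      t.cost.ringOps ≤ T.size * (130 * T.size * (19 * T) + n * (13 * T) + 4 * T) ∧
      t.cost.bitOps ≤ T.size * roundBits n T D (primeLimit T D) (130 * T.size) + (T.size + 2) := by
  unfold mulPolySI at ht
  rw [RComp.mem_support_bind] at ht
  obtain ⟨a, ha, b, hb, -, hbc⟩ := ht
  rw [RComp.mem_support_lift] at ha
  subst ha
  obtain ⟨h1, h2, h3, h4⟩ := mem_support_mulPolyLoop (ν := roundTolerance T) H hΔ
    (roundTolerance_pos T) (roundTolerance_lt_one T)
    (fun T' hT' => primeBound_le hT' H.one_le_T H.one_le_D)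
    (fun T' hT' => sampleCount_le hT' H.one_le_T) (by simp) (by simp) hb
  rw [hbc]
  simp only [Cost.add_queries, Cost.add_ringOps, Cost.add_bitOps, Timed.bits_queries,
    Timed.bits_ringOps, Timed.bits_bitOps, List.nil_append, zero_add]
  exact ⟨h1, h2, h3, by omega⟩

end Algorithm


/-! ## Asymptotics -/

theorem le_pow_of_le_two_pow {c k Z : ℕ} (hZ : 2 ≤ Z) (h : c ≤ 2 ^ k) : c ≤ Z ^ k :=
  h.trans (Nat.pow_le_pow_left hZ k)

/-- The calculus behind the asymptotics: Z ≥ 2 dominates all logarithmic quantities, and constants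
and sums are paid for with extra powers of Z. -/
theorem add_le_mul_pow_succ {a b X Z k : ℕ} (hZ : 2 ≤ Z) (ha : a ≤ X * Z ^ k)
    (hb : b ≤ X * Z ^ k) : a + b ≤ X * Z ^ (k + 1) := by
  have : X * Z ^ k * 2 ≤ X * Z ^ k * Z := Nat.mul_le_mul_left _ hZ
  rw [pow_succ, ← mul_assoc]
  omega

theorem mul_pow_le_mul_pow {X Z j k : ℕ} (hZ : 2 ≤ Z) (h : j ≤ k) : X * Z ^ j ≤ X * Z ^ k :=
  Nat.mul_le_mul_left _ (Nat.pow_le_pow_right (by omega) h)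

/-! ### Bit operations as n T D.size times a power of Z. -/

section Bits

variable {n T D V W Z : ℕ}

theorem primeLimit_le (hZ : 2 ≤ Z) (hV : T * D.size = V) (hVZ : V.size ≤ Z) :
    primeLimit T D ≤ V * Z ^ 14 ∧ (primeLimit T D).size ≤ 14 * Z := by
  subst hV
  unfold primeLimit
  generalize T * D.size = V at *
  constructor
  · calc 8192 * (V * V.size) ≤ Z ^ 13 * (V * Z) := by
          have : 8192 ≤ Z ^ 13 := le_pow_of_le_two_pow hZ (by norm_num)
          gcongr
      _ = V * Z ^ 14 := by ring
  · have h1 := size_mul_le 8192 (V * V.size)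
    have h2 := size_mul_le V V.size
    have h3 := size_le_self V.size
    have h4 : (8192 : ℕ).size ≤ 14 := Nat.size_le.2 (by norm_num)
    omega

/-- The integers have O(Z + D.size) bits. The bit length of D appears only to the first power; its
own logarithm, from fast multiplication, goes into Z. This is why the final bound is linear in log D
up to logarithmic factors. -/
theorem stepCost_le {P : ℕ} (hZ : 2 ≤ Z) (hn : n.size + 1 ≤ Z) (hD : 1 ≤ D)
    (hd : D.size.size + 1 ≤ Z) (hTP : T ≤ P) (hP : P.size ≤ 14 * Z) :
    stepCost n T D P ≤ D.size * Z ^ 15 := by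
  have hd1 : 1 ≤ D.size := Nat.size_pos.2 hD
  have hM : integerBound T D P ≤ 8 * (P * D) := by
    have : T ≤ P * D := hTP.trans (Nat.le_mul_of_pos_right _ hD)
    unfold integerBound
    rw [mul_assoc]
    omega
  have h8 : (8 : ℕ).size ≤ 4 := Nat.size_le.2 (by norm_num)
  have h1 : (integerBound T D P).size ≤ 4 + 14 * Z + D.size := by
    have := size_mul_le 8 (P * D)
    have := size_mul_le P D
    have := Nat.size_le_size hM
    omega
  have one_size : (1 : ℕ).size = 1 := Nat.size_one
  have h2 : (capacity n (integerBound T D P)).size ≤ 30 * Z + 10 + 2 * D.size := by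
    unfold capacity
    rw [pow_two]
    have e1 := size_mul_le (n + 1) ((integerBound T D P + 1) * (integerBound T D P + 1))
    have e2 := size_mul_le (integerBound T D P + 1) (integerBound T D P + 1)
    have e3 := size_add_le n 1
    have e4 := size_add_le (integerBound T D P) 1
    omega
  unfold stepCost unitCost mulCost
  generalize (capacity n (integerBound T D P)).size = s at *
  generalize D.size = d at *
  have h3 : s + 1 ≤ 64 * (Z * d) := by
    have e1 : Z ≤ Z * d := Nat.le_mul_of_pos_right _ hd1
    have e2 : 2 * d ≤ Z * d := Nat.mul_le_mul_right _ hZ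
    omega
  have h4 : (s + 1).size ≤ Z ^ 4 := by
    have e0 := Nat.size_le_size h3
    have e1 := size_mul_le 64 (Z * d)
    have e2 := size_mul_le Z d
    have e3 := size_le_self Z
    have e4 : (64 : ℕ).size ≤ 7 := Nat.size_le.2 (by norm_num)
    have e5 : 8 * Z ≤ Z ^ 4 := by
      rw [pow_succ]
      exact Nat.mul_le_mul_right _ (le_pow_of_le_two_pow hZ (by norm_num))
    omega
  calc (s + 1) * (s + 1).size ^ 2 ≤ (Z ^ 6 * (Z * d)) * (Z ^ 4) ^ 2 := by
        refine Nat.mul_le_mul ?_ (Nat.pow_le_pow_left h4 2)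
        exact h3.trans (Nat.mul_le_mul_right _ (le_pow_of_le_two_pow hZ (by norm_num)))
    _ = d * Z ^ 15 := by ring

theorem mulCost_le {m X Z j : ℕ} (hZ : 2 ≤ Z) (hX : 1 ≤ X) (h : m ≤ X * Z ^ j)
    (hs : m.size ≤ 14 * Z) : mulCost m ≤ X * Z ^ (j + 11) := by
  have h1 : m + 1 ≤ X * Z ^ (j + 1) :=
    add_le_mul_pow_succ hZ h (Nat.mul_pos hX (Nat.pow_pos (by omega)))
  have h2 : (m + 1).size ≤ Z ^ 5 := by
    have e1 := size_add_le m 1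
    have e2 : (1 : ℕ).size = 1 := Nat.size_one
    have e3 : 16 * Z ≤ Z ^ 5 := by
      rw [pow_succ]
      exact Nat.mul_le_mul_right _ (le_pow_of_le_two_pow hZ (by norm_num))
    omega
  calc (m + 1) * (m + 1).size ^ 2 ≤ X * Z ^ (j + 1) * (Z ^ 5) ^ 2 :=
        Nat.mul_le_mul h1 (Nat.pow_le_pow_left h2 2)
    _ = _ := by ring

/-- Two sources give the factor T D.size: the sieve and the tables, whose size P has this order, and
the term lists, with O(T) operations on integers of about D.size bits. The exponents of Z are not
optimised. -/
theorem roundBits_le {P l : ℕ} (hn : 1 ≤ n) (hT : 1 ≤ T) (hD : 1 ≤ D) (hZ : 2 ≤ Z)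
    (hnZ : n.size + 1 ≤ Z) (hTZ : T.size + 1 ≤ Z) (hd : D.size.size + 1 ≤ Z)
    (hP : P ≤ T * D.size * Z ^ 14) (hPs : P.size ≤ 14 * Z) (hTP : T ≤ P)
    (hl : l ≤ 130 * Z) : roundBits n T D P l ≤ n * (T * D.size) * Z ^ 60 := by
  have hw := stepCost_le hZ hnZ hD hd hTP hPs
  have hd1 : 1 ≤ D.size := Nat.size_pos.2 hD
  have hl' : l ≤ 1 * Z ^ 9 := by
    refine hl.trans ?_
    rw [one_mul, pow_succ]
    exact Nat.mul_le_mul_right _ (le_pow_of_le_two_pow hZ (by norm_num))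
  have hl1 : l + 1 ≤ 1 * Z ^ 10 :=
    add_le_mul_pow_succ hZ hl' (by rw [one_mul]; exact Nat.pow_pos (by omega))
  have hn1 : n + 1 ≤ n * Z := by
    have : n * 2 ≤ n * Z := Nat.mul_le_mul_left _ hZ
    omega
  have hq : (3 * T + 1) * ((3 * T).size + 1) ≤ T * Z ^ 4 := by
    have e1 : 3 * T + 1 ≤ T * Z ^ 2 := by
      have : T * 4 ≤ T * Z ^ 2 := Nat.mul_le_mul_left _ (le_pow_of_le_two_pow hZ (by norm_num))
      omega
    have e2 : (3 * T).size + 1 ≤ Z ^ 2 := by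
      have e3 := size_mul_le 3 T
      have e4 : (3 : ℕ).size ≤ 2 := Nat.size_le.2 (by norm_num)
      have e5 : 2 * Z ≤ Z ^ 2 := by
        rw [pow_two]
        exact Nat.mul_le_mul_right _ hZ
      omega
    calc _ ≤ T * Z ^ 2 * Z ^ 2 := Nat.mul_le_mul e1 e2
      _ = _ := by ring
  have hV1 : 1 ≤ T * D.size := Nat.mul_pos hT hd1
  have hdV : D.size ≤ n * (T * D.size) :=
    (Nat.le_mul_of_pos_left _ hT).trans (Nat.le_mul_of_pos_left _ hn)
  have two_pow : ∀ {c k : ℕ}, c ≤ 2 ^ k → c ≤ Z ^ k := fun h => le_pow_of_le_two_pow hZ h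
  rw [one_mul] at hl' hl1
  have c1 : mulCost l ≤ n * (T * D.size) * Z ^ 35 :=
    calc (l + 1) * (l + 1).size ^ 2 ≤ Z ^ 10 * (Z ^ 10) ^ 2 :=
          Nat.mul_le_mul hl1 (Nat.pow_le_pow_left ((size_le_self _).trans hl1) 2)
      _ = 1 * Z ^ 30 := by ring
      _ ≤ n * (T * D.size) * Z ^ 35 :=
          Nat.mul_le_mul (hd1.trans hdV) (Nat.pow_le_pow_right (by omega) (by norm_num))
  have c2 : mulCost P ≤ n * (T * D.size) * Z ^ 35 :=
    (mulCost_le hZ hV1 hP hPs).trans ((Nat.mul_le_mul_right _ (Nat.le_mul_of_pos_left _ hn)).trans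
      (mul_pow_le_mul_pow hZ (by norm_num)))
  have c3 : (P + 1) * (3 * P.size + 20) * mulCost P.size ≤ n * (T * D.size) * Z ^ 45 := by
    have e1 : P + 1 ≤ T * D.size * Z ^ 15 :=
      add_le_mul_pow_succ hZ hP (Nat.mul_pos hV1 (Nat.pow_pos (by omega)))
    have e2 : 3 * P.size + 20 ≤ Z ^ 6 * Z := by
      have : 64 * Z ≤ Z ^ 6 * Z := Nat.mul_le_mul_right _ (two_pow (by norm_num))
      omega
    have e3 : P.size + 1 ≤ Z ^ 4 * Z := by
      have : 16 * Z ≤ Z ^ 4 * Z := Nat.mul_le_mul_right _ (two_pow (by norm_num))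
      omega
    calc (P + 1) * (3 * P.size + 20) * ((P.size + 1) * (P.size + 1).size ^ 2)
        ≤ T * D.size * Z ^ 15 * (Z ^ 6 * Z) * (Z ^ 4 * Z * (Z ^ 4 * Z) ^ 2) :=
          Nat.mul_le_mul (Nat.mul_le_mul e1 e2)
            (Nat.mul_le_mul e3 (Nat.pow_le_pow_left ((size_le_self _).trans e3) 2))
      _ = T * D.size * Z ^ 37 := by ring
      _ ≤ n * (T * D.size) * Z ^ 45 :=
          Nat.mul_le_mul (Nat.le_mul_of_pos_left _ hn)
            (Nat.pow_le_pow_right (by omega) (by norm_num))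
  have c4 : 8 * stepCost n T D P ≤ n * (T * D.size) * Z ^ 35 :=
    calc 8 * stepCost n T D P ≤ Z ^ 3 * (D.size * Z ^ 15) :=
          Nat.mul_le_mul (two_pow (by norm_num)) hw
      _ = D.size * Z ^ 18 := by ring
      _ ≤ n * (T * D.size) * Z ^ 35 :=
          Nat.mul_le_mul hdV (Nat.pow_le_pow_right (by omega) (by norm_num))
  have c5 : l * ((n + 1) * (4 * stepCost n T D P)) ≤ n * (T * D.size) * Z ^ 45 :=
    calc l * ((n + 1) * (4 * stepCost n T D P))
        ≤ Z ^ 9 * (n * Z * (Z ^ 2 * (D.size * Z ^ 15))) :=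
          Nat.mul_le_mul hl' (Nat.mul_le_mul hn1 (Nat.mul_le_mul (two_pow (by norm_num)) hw))
      _ = n * D.size * Z ^ 27 := by ring
      _ ≤ n * (T * D.size) * Z ^ 45 :=
          Nat.mul_le_mul (Nat.mul_le_mul_left _ (Nat.le_mul_of_pos_left _ hT))
            (Nat.pow_le_pow_right (by omega) (by norm_num))
  have c6 : finishBits n T D P l ≤ n * (T * D.size) * Z ^ 55 := by
    have e1 : (3 * T + 1) * ((3 * T).size + 1) * (170 * stepCost n T D P) ≤
        T * D.size * Z ^ 27 :=
      calc _ ≤ T * Z ^ 4 * (Z ^ 8 * (D.size * Z ^ 15)) :=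
            Nat.mul_le_mul hq (Nat.mul_le_mul (two_pow (by norm_num)) hw)
        _ = _ := by ring
    have e2 := add_le_mul_pow_succ hZ (hP.trans (mul_pow_le_mul_pow hZ (by norm_num))) e1
    calc finishBits n T D P l ≤ n * Z * ((Z ^ 10) ^ 2 * (T * D.size * Z ^ 28)) :=
          Nat.mul_le_mul hn1 (Nat.mul_le_mul (Nat.pow_le_pow_left hl1 2) e2)
      _ = n * (T * D.size) * Z ^ 49 := by ring
      _ ≤ _ := mul_pow_le_mul_pow hZ (by norm_num)
  have c7 : (n + 1) * ((3 * T + 1) * ((3 * T).size + 1) * (40 * stepCost n T D P)) ≤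
      n * (T * D.size) * Z ^ 55 :=
    calc _ ≤ n * Z * (T * Z ^ 4 * (Z ^ 6 * (D.size * Z ^ 15))) :=
          Nat.mul_le_mul hn1 (Nat.mul_le_mul hq (Nat.mul_le_mul (two_pow (by norm_num)) hw))
      _ = n * (T * D.size) * Z ^ 26 := by ring
      _ ≤ _ := mul_pow_le_mul_pow hZ (by norm_num)
  have hm : ∀ {x j : ℕ}, j ≤ 55 → x ≤ n * (T * D.size) * Z ^ j → x ≤ n * (T * D.size) * Z ^ 55 :=
    fun hj hx => hx.trans (mul_pow_le_mul_pow hZ hj)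
  -- Seven summands: four from the setup, then the draws, the conclusion of the round and the final
  -- addition.
  have e : 7 * (n * (T * D.size) * Z ^ 55) ≤ n * (T * D.size) * Z ^ 60 := by
    have : 7 ≤ Z ^ 5 := le_pow_of_le_two_pow hZ (by norm_num)
    calc _ ≤ Z ^ 5 * (n * (T * D.size) * Z ^ 55) := Nat.mul_le_mul_right _ this
      _ = _ := by ring
  have c1 := hm (by norm_num) c1
  have c2 := hm (by norm_num) c2
  have c3 := hm (by norm_num) c3
  have c4 := hm (by norm_num) c4
  have c5 := hm (by norm_num) c5
  unfold roundBits setupBits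
  omega

/-- The total number of bit operations, in terms of `n T log D`. -/
theorem totalBits_le (hn : 1 ≤ n) (hT : 1 ≤ T) (hD : 1 ≤ D) (hW : n * (T * D.size) = W)
    (hZ : W.size + 1 = Z) :
    T.size * roundBits n T D (primeLimit T D) (130 * T.size) + (T.size + 2) ≤ W * Z ^ 62 := by
  have hd1 : 1 ≤ D.size := Nat.size_pos.2 hD
  have hV1 : 1 ≤ T * D.size := Nat.mul_pos hT hd1
  have hVW : T * D.size ≤ W := hW ▸ Nat.le_mul_of_pos_left _ hn
  have hTW : T ≤ W := (Nat.le_mul_of_pos_right _ hd1).trans hVW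
  have hdW : D.size ≤ W := (Nat.le_mul_of_pos_left _ hT).trans hVW
  have hnW : n ≤ W := hW ▸ Nat.le_mul_of_pos_right _ hV1
  have hW1 : 1 ≤ W.size := Nat.size_pos.2 (hn.trans hnW)
  have s1 := Nat.size_le_size hVW
  have s2 := Nat.size_le_size hTW
  have s3 := Nat.size_le_size hdW
  have s4 := Nat.size_le_size hnW
  have hZ2 : 2 ≤ Z := by omega
  obtain ⟨p1, p2⟩ := primeLimit_le (T := T) (D := D) hZ2 rfl (by omega)
  have p3 : T ≤ primeLimit T D := by
    have e1 : T ≤ T * D.size := Nat.le_mul_of_pos_right _ hd1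
    have e2 : T * D.size ≤ T * D.size * (T * D.size).size :=
      Nat.le_mul_of_pos_right _ (Nat.size_pos.2 hV1)
    unfold primeLimit
    omega
  have h := roundBits_le hn hT hD hZ2 (by omega) (by omega) (by omega) p1 p2 p3
    (show 130 * T.size ≤ 130 * Z by omega)
  rw [hW] at h
  have h1 : T.size * roundBits n T D (primeLimit T D) (130 * T.size) ≤ W * Z ^ 61 :=
    calc _ ≤ Z * (W * Z ^ 60) := Nat.mul_le_mul (by omega) h
      _ = _ := by ring
  refine add_le_mul_pow_succ hZ2 h1 ?_
  calc T.size + 2 ≤ 1 * Z ^ 2 := by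
        rw [one_mul, pow_two]
        have : 2 * Z ≤ Z * Z := Nat.mul_le_mul_right _ hZ2
        omega
    _ ≤ W * Z ^ 61 := Nat.mul_le_mul (by omega) (Nat.pow_le_pow_right (by omega) (by norm_num))

end Bits

/-! ### Conversion to `softO` -/

theorem one_le_logb {g : ℝ} (hg : 0 ≤ g) : 1 ≤ Real.logb 2 (3 + g) := by
  rw [Real.le_logb_iff_rpow_le one_lt_two (by linarith), Real.rpow_one]
  linarith

theorem softO_mono {C C' g : ℝ} {k k' : ℕ} (hC : 0 ≤ C) (hC' : C ≤ C') (hk : k ≤ k')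
    (hg : 0 ≤ g) : softO C k g ≤ softO C' k' g := by
  have h := one_le_logb hg
  have := pow_le_pow_right₀ h hk
  have := hC.trans hC'
  unfold softO
  gcongr

theorem size_le_logb (m : ℕ) : (m.size : ℝ) + 1 ≤ 3 * Real.logb 2 (3 + m) := by
  have h0 := one_le_logb (Nat.cast_nonneg (α := ℝ) m)
  rcases Nat.eq_zero_or_pos m with rfl | hm
  · simp at h0 ⊢
    linarith
  have hs : 1 ≤ m.size := Nat.size_pos.2 hm
  have h1 : (2 : ℝ) ^ (m.size - 1) ≤ 3 + m := by
    have : 2 ^ (m.size - 1) ≤ m := Nat.lt_size.1 (show m.size - 1 < m.size by omega)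
    have : (2 : ℝ) ^ (m.size - 1) ≤ m := by exact_mod_cast this
    linarith
  have h2 : ((m.size - 1 : ℕ) : ℝ) ≤ Real.logb 2 (3 + m) := by
    rw [Real.le_logb_iff_rpow_le one_lt_two (by positivity), Real.rpow_natCast]
    exact h1
  push_cast [hs] at h2
  linarith

theorem cast_le_softO {x m k : ℕ} {c : ℝ} (h : (x : ℝ) ≤ c * (m * (m.size + 1 : ℝ) ^ k))
    (hc : 0 ≤ c) : (x : ℝ) ≤ softO (c * 3 ^ k) k m := by
  have h1 := size_le_logb m
  refine h.trans ?_
  unfold softO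
  calc c * (m * (m.size + 1 : ℝ) ^ k) ≤ c * (m * (3 * Real.logb 2 (3 + m)) ^ k) := by gcongr
    _ = _ := by rw [mul_pow]; ring

/-- A factor 3 in the argument also enters the logarithm, where log₂(3 + 3g) ≤ 3 log₂(3 + g); this
costs 3^k. -/
theorem softO_le_of_le_mul {C a g : ℝ} {k : ℕ} (hC : 0 ≤ C) (ha : 0 ≤ a) (hg : 0 ≤ g)
    (h : a ≤ 3 * g) : softO C k a ≤ softO (C * (3 * 3 ^ k)) k g := by
  have h1 := one_le_logb hg
  have h2 : Real.logb 2 (3 + a) ≤ 3 * Real.logb 2 (3 + g) := by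
    have : Real.logb 2 3 ≤ 2 := by
      rw [Real.logb_le_iff_le_rpow one_lt_two (by norm_num)]
      norm_num
    calc Real.logb 2 (3 + a) ≤ Real.logb 2 (3 * (3 + g)) :=
          Real.logb_le_logb_of_le one_lt_two (by linarith) (by linarith)
      _ = Real.logb 2 3 + Real.logb 2 (3 + g) := Real.logb_mul (by norm_num) (by linarith)
      _ ≤ _ := by linarith
  have h3 := one_le_logb ha
  unfold softO
  calc C * (a * Real.logb 2 (3 + a) ^ k) ≤ C * (3 * g * (3 * Real.logb 2 (3 + g)) ^ k) := by
        gcongr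
    _ = _ := by rw [mul_pow]; ring


/-! ### The four totals in the form of the theorem. -/

section Totals

variable {n T D : ℕ}

theorem degree_bound_le (hT : 1 ≤ T) :
    ((2 * primeLimit T D * D : ℕ) : ℝ) ≤ softO (16384 * 3 ^ 2) 2 (T * D) := by
  rw [← Nat.cast_mul]
  refine cast_le_softO ?_ (by norm_num)
  have h1 : D.size ≤ (T * D).size := Nat.size_le_size (Nat.le_mul_of_pos_left _ hT)
  have h2 : (T * D.size).size ≤ (T * D).size :=
    Nat.size_le_size (Nat.mul_le_mul_left _ (size_le_self D))
  have : 2 * primeLimit T D * D ≤ 16384 * (T * D * ((T * D).size + 1) ^ 2) :=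
    calc 2 * primeLimit T D * D = 16384 * (T * D * (D.size * (T * D.size).size)) := by
          unfold primeLimit
          ring
      _ ≤ 16384 * (T * D * (((T * D).size + 1) * ((T * D).size + 1))) := by
          gcongr <;> omega
      _ = _ := by ring
  exact_mod_cast this

/-- The samples cost T log² T over all rounds, without a factor n, and the recovery costs n T log T.
The constant is 2487 = 130 · 19 + 13 + 4. -/
theorem ringOps_bound_le (hn : 1 ≤ n) :
    ((T.size * (130 * T.size * (19 * T) + n * (13 * T) + 4 * T) : ℕ) : ℝ) ≤
      softO (2487 * 3 ^ 2) 2 (n * T) := by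
  rw [← Nat.cast_mul]
  refine cast_le_softO ?_ (by norm_num)
  have hTn : T ≤ n * T := Nat.le_mul_of_pos_left _ hn
  have h1 : T.size ≤ (n * T).size + 1 := (Nat.size_le_size hTn).trans (Nat.le_succ _)
  have : T.size * (130 * T.size * (19 * T) + n * (13 * T) + 4 * T) ≤
      2487 * (n * T * ((n * T).size + 1) ^ 2) := by
    generalize (n * T).size + 1 = s at *
    generalize T.size = r at *
    have h3 : r ≤ s ^ 2 := h1.trans (Nat.le_self_pow two_ne_zero _)
    calc r * (130 * r * (19 * T) + n * (13 * T) + 4 * T)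
        = 2470 * (T * r ^ 2) + 13 * (n * T * r) + 4 * (T * r) := by ring
      _ ≤ 2470 * (n * T * s ^ 2) + 13 * (n * T * s ^ 2) + 4 * (n * T * s ^ 2) := by gcongr
      _ = _ := by ring
  exact_mod_cast this

theorem bitOps_bound_le (hn : 1 ≤ n) (hT : 1 ≤ T) (hD : 1 ≤ D) :
    ((T.size * roundBits n T D (primeLimit T D) (130 * T.size) + (T.size + 2) : ℕ) : ℝ) ≤
      softO (1 * 3 ^ 62 * (3 * 3 ^ 62)) 62 (n * T * Real.log (D + 1)) := by
  have h := totalBits_le hn hT hD rfl rfl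
  have h1 : ((T.size * roundBits n T D (primeLimit T D) (130 * T.size) + (T.size + 2) : ℕ) : ℝ) ≤
      1 * ((n * (T * D.size) : ℕ) * ((n * (T * D.size)).size + 1 : ℝ) ^ 62) := by
    rw [one_mul]
    exact_mod_cast h
  have hlog : 0 ≤ Real.log (D + 1) := Real.log_nonneg (by linarith [Nat.cast_nonneg (α := ℝ) D])
  refine (cast_le_softO h1 (by norm_num)).trans
    (softO_le_of_le_mul (by norm_num) (Nat.cast_nonneg _) (by positivity) ?_)
  have h2 := size_le_log hD
  push_cast
  calc (n : ℝ) * (T * D.size) ≤ n * (T * (3 * Real.log (D + 1))) := by gcongr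
    _ = _ := by ring

theorem queries_bound_le (hT : 1 ≤ T) : ((T.size * (130 * T.size + n) : ℕ) : ℝ) ≤
    1170 * (n * Real.log (T + 1) + Real.log (T + 1) ^ 2) := by
  have h := size_le_log hT
  have hlog : 0 ≤ Real.log (T + 1) := Real.log_nonneg (by linarith [Nat.cast_nonneg (α := ℝ) T])
  push_cast
  calc (T.size : ℝ) * (130 * T.size + n)
      ≤ 3 * Real.log (T + 1) * (130 * (3 * Real.log (T + 1)) + n) := by gcongr
    _ = 1170 * Real.log (T + 1) ^ 2 + 3 * (n * Real.log (T + 1)) := by ring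
    _ ≤ _ := by
      have : 0 ≤ n * Real.log (T + 1) := by positivity
      linarith

end Totals

end SparseInterp

theorem mainTheorem7 :
    ∃ (C : ℝ) (κ : ℕ), 0 < C ∧
      ∀ (R : Type u) [CommRing R] (E : Type v) [CommRing E] [Algebra R E]
        (n T D : ℕ) (f : MvPolynomial (Fin n) R)
        (B : (Fin n → E) → E) (U : UnivInterpolator R E),
        1 ≤ n → 1 ≤ T → 1 ≤ D → f.support.card ≤ T → f.totalDegree ≤ D →
        (∀ a : Fin n → E, B a = MvPolynomial.aeval a f) →
        U.CorrectUpTo (softO C κ (T * D)) T →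
        -- the output is `f` with probability at least `3/4`
        3 / 4 ≤ (mulPolySI B U T D (1 / 4)).toOuterMeasure
            {t | ∃ L, t.val = some L ∧ IsSparseRep L f} ∧
        -- the cost bounds hold for every outcome of the coin flips
        ∀ t ∈ (mulPolySI B U T D (1 / 4)).support,
          (t.cost.queries.length : ℝ) ≤
              C * (n * Real.log (T + 1) + Real.log (T + 1) ^ 2) ∧
          (∀ q ∈ t.cost.queries,
            (q.degBound : ℝ) ≤ softO C κ (T * D) ∧ q.termBound ≤ T ∧
            (kronecker f q.exps).natDegree ≤ q.degBound ∧
            (kronecker f q.exps).support.card ≤ q.termBound) ∧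
          (t.cost.ringOps : ℝ) ≤ softO C κ (n * T) ∧
          (t.cost.bitOps : ℝ) ≤ softO C κ (n * T * Real.log (D + 1)) := by
  -- The bit operations dictate both values: the exponent 62 and the constant 3^62 · 3 · 3^62 from
  -- the two conversions of bit lengths to logarithms. All other bounds are far smaller.
  refine ⟨3 ^ 125, 62, by norm_num, ?_⟩
  intro R _ E _ _ n T D f B U hn hT hD hcard hdeg hB hU
  have H : Setting f B U T D (softO (3 ^ 125) 62 (T * D)) := ⟨hT, hD, hcard, hdeg, hB, hU⟩
  have hΔ : ((2 * primeLimit T D * D : ℕ) : ℝ) ≤ softO (3 ^ 125) 62 (T * D) :=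
    (degree_bound_le hT).trans
      (softO_mono (by norm_num) (by norm_num) (by norm_num) (by positivity))
  refine ⟨prob_mulPolySI_ge H hΔ, fun t ht => ?_⟩
  obtain ⟨h1, h2, h3, h4⟩ := mem_support_mulPolySI H hΔ ht
  have hlogT : 0 ≤ Real.log (T + 1) := Real.log_nonneg (by linarith [Nat.cast_nonneg (α := ℝ) T])
  refine ⟨?_, h2, ?_, ?_⟩
  · refine (Nat.cast_le.2 h1).trans ((queries_bound_le hT).trans ?_)
    exact mul_le_mul_of_nonneg_right (by norm_num) (by positivity)
  · refine (Nat.cast_le.2 h3).trans ((ringOps_bound_le hn).trans ?_)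
    exact softO_mono (by norm_num) (by norm_num) (by norm_num) (by positivity)
  · refine (Nat.cast_le.2 h4).trans ((bitOps_bound_le hn hT hD).trans (le_of_eq ?_))
    norm_num
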